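/- There is a randomized polynomial-time algorithm with value-oracle access that achieves an approximation ratio of $e^{-1}-o(1)$ for maximizing a non-negative, not necessarily symmetric, submodular function subject to an equality cardinality constraint. Precisely: there are one algorithm (a fixed program of a randomized real RAM which accesses the objective function only through queries $S\mapsto f(S)$), a polynomial $p$ and a sequence $\varepsilon(n)\to 0$ as $n\to\infty$ such that the following holds for all integers $1\le k\le n$, every ground set $\mathcal N=\{0,\dots,n-1\}$, and every function $f\colon 2^{\mathcal N}\to\mathbb R_{\ge 0}$ with $f(A)+f(B)\ge f(A\cup B)+f(A\cap B)$ for all $A,B\subseteq\mathcal N$. On input $n,k$ and with oracle access to $f$, the algorithm always stops within $p(n)$ steps (arithmetic operations, comparisons, memory accesses and oracle queries count one step each, and drawing a uniformly random integer from $\{0,\dots,m\}$ counts the number of binary digits of $m$, up to an additive constant), it always returns a set $S\subseteq\mathcal N$ with $|S|=k$, and $$\mathbb E[f(S)]\ \ge\ \bigl(e^{-1}-\varepsilon(n)\bigr)\cdot\max\{f(S') : S'\subseteq\mathcal N,\ |S'|=k\}.$$ -/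

import Mathlib

open Filter Topology

noncomputable section

/-- A set function `f : 2^𝒩 → ℝ` is submodular if `f A + f B ≥ f (A ∪ B) + f (A ∩ B)`. -/
def IsSubmodular {α : Type*} [DecidableEq α] (f : Finset α → ℝ) : Prop :=
  ∀ A B : Finset α, f (A ∪ B) + f (A ∩ B) ≤ f A + f B

namespace OracleRAM

/-! A randomized real RAM with a value oracle, programmed in a structured language.

The memory consists of arrays of natural numbers and arrays of real numbers. Natural numbers
support addition, truncated subtraction and comparison (no multiplication in unit time, so that a
number computed in `t` steps has `O(t)` bits), and serve as indices. Real numbers support the four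
arithmetic operations and comparison. There is no rounding of reals to integers, and the only
constants are natural numbers. The only access to the objective function is through queries. -/

/-- Natural number expressions: constants, (indirectly addressed) cells, sums, differences. -/
inductive NExp : Type
  | lit (c : ℕ)
  | get (a : ℕ) (i : NExp)
  | add (e₁ e₂ : NExp)
  | sub (e₁ e₂ : NExp)

/-- Real number expressions. -/
inductive RExp : Type
  | ofNat (e : NExp)
  | get (a : ℕ) (i : NExp)
  | add (r₁ r₂ : RExp)
  | sub (r₁ r₂ : RExp)
  | mul (r₁ r₂ : RExp)
  | div (r₁ r₂ : RExp)

/-- Tests. -/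
inductive Test : Type
  | natLE (e₁ e₂ : NExp)
  | realLE (r₁ r₂ : RExp)

/-- Programs. Every loop fixes its number of rounds when it is entered; within a time bound that is
itself computable this is no restriction, since a `while` loop can be replaced by a loop over the
time bound with a test in its body. -/
inductive Cmd : Type
  | skip
  /-- cell `i` of the natural array `a` gets the value of `e` -/
  | setNat (a : ℕ) (i e : NExp)
  /-- cell `i` of the real array `a` gets the value of `r` -/
  | setReal (a : ℕ) (i : NExp) (r : RExp)
  /-- cell `i` of the real array `a` gets the value `f S` where `S` is the set that is stored
  in the natural array `b` -/
  | query (a : ℕ) (i : NExp) (b : ℕ)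
  /-- cell `i` of the natural array `a` gets a fresh uniformly random element
  of `{0, …, e}` -/
  | rand (a : ℕ) (i e : NExp)
  | seq (c₁ c₂ : Cmd)
  | ite (b : Test) (c₁ c₂ : Cmd)
  /-- execute `c` as many times as the value that `e` has on entry -/
  | loop (e : NExp) (c : Cmd)

/-- A memory content together with the number of steps performed so far. -/
structure State : Type where
  nat : ℕ → ℕ → ℕ
  real : ℕ → ℕ → ℝ
  time : ℕ

namespace State

/-- Count `t` more steps. -/
def tick (s : State) (t : ℕ) : State := { s with time := s.time + t }

/-- Write into a cell of a natural array. -/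
def writeNat (s : State) (a i v : ℕ) : State :=
  { s with nat := Function.update s.nat a (Function.update (s.nat a) i v) }

/-- Write into a cell of a real array. -/
def writeReal (s : State) (a i : ℕ) (v : ℝ) : State :=
  { s with real := Function.update s.real a (Function.update (s.real a) i v) }

/-- The subset of `{0, …, n - 1}` stored in the natural array `b`: the positions of its non-zero
cells. -/
def storedSet (s : State) (n b : ℕ) : Finset (Fin n) :=
  Finset.univ.filter fun u : Fin n => s.nat b u ≠ 0

end State

/-- Value of a natural expression. -/
def NExp.eval (s : State) : NExp → ℕ
  | lit c => c
  | get a i => s.nat a (i.eval s)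
  | add e₁ e₂ => e₁.eval s + e₂.eval s
  | sub e₁ e₂ => e₁.eval s - e₂.eval s

/-- Number of steps needed to evaluate a natural expression: one per operation. -/
def NExp.cost : NExp → ℕ
  | lit _ => 1
  | get _ i => i.cost + 1
  | add e₁ e₂ => e₁.cost + e₂.cost + 1
  | sub e₁ e₂ => e₁.cost + e₂.cost + 1

/-- Value of a real expression (a quotient by `0` is `0`). -/
def RExp.eval (s : State) : RExp → ℝ
  | ofNat e => (e.eval s : ℝ)
  | get a i => s.real a (i.eval s)
  | add r₁ r₂ => r₁.eval s + r₂.eval s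
  | sub r₁ r₂ => r₁.eval s - r₂.eval s
  | mul r₁ r₂ => r₁.eval s * r₂.eval s
  | div r₁ r₂ => r₁.eval s / r₂.eval s

/-- Number of steps needed to evaluate a real expression: one per operation. -/
def RExp.cost : RExp → ℕ
  | ofNat e => e.cost + 1
  | get _ i => i.cost + 1
  | add r₁ r₂ => r₁.cost + r₂.cost + 1
  | sub r₁ r₂ => r₁.cost + r₂.cost + 1
  | mul r₁ r₂ => r₁.cost + r₂.cost + 1
  | div r₁ r₂ => r₁.cost + r₂.cost + 1

/-- When a test succeeds. -/
def Test.Holds (s : State) : Test → Prop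
  | natLE e₁ e₂ => e₁.eval s ≤ e₂.eval s
  | realLE r₁ r₂ => r₁.eval s ≤ r₂.eval s

/-- Number of steps of a test. -/
def Test.cost : Test → ℕ
  | natLE e₁ e₂ => e₁.cost + e₂.cost + 1
  | realLE r₁ r₂ => r₁.cost + r₂.cost + 1

/-- Perform the random transition `step` exactly `m` times, at the price of one additional step
per round. -/
def rounds (step : State → PMF State) : ℕ → State → PMF State
  | 0, s => PMF.pure s
  | m + 1, s => (step (s.tick 1)).bind (rounds step m)

open Classical in
/-- The distribution of the state in which a program ends, when it is started in the state `s` with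
access to a value oracle for `f`. A random number from `{0, …, m}` costs its bit length. -/
def Cmd.exec {n : ℕ} (f : Finset (Fin n) → ℝ) : Cmd → State → PMF State
  | skip, s => PMF.pure (s.tick 1)
  | setNat a i e, s =>
      PMF.pure ((s.writeNat a (i.eval s) (e.eval s)).tick (i.cost + e.cost + 1))
  | setReal a i r, s =>
      PMF.pure ((s.writeReal a (i.eval s) (r.eval s)).tick (i.cost + r.cost + 1))
  | query a i b, s =>
      PMF.pure ((s.writeReal a (i.eval s) (f (s.storedSet n b))).tick (i.cost + 1))
  | rand a i e, s =>
      (PMF.uniformOfFintype (Fin (e.eval s + 1))).map fun v : Fin (e.eval s + 1) =>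
        (s.writeNat a (i.eval s) v.val).tick (i.cost + e.cost + Nat.size (e.eval s) + 1)
  | seq c₁ c₂, s => (exec f c₁ s).bind (exec f c₂)
  | ite b c₁ c₂, s =>
      if b.Holds s then exec f c₁ (s.tick (b.cost + 1)) else exec f c₂ (s.tick (b.cost + 1))
  | loop e c, s => rounds (exec f c) (e.eval s) (s.tick (e.cost + 1))

/-- The initial state: the cells `0` and `1` of the natural array `0` hold `n` and `k`, everything
else is zero. -/
def init (n k : ℕ) : State where
  nat a i := if a = 0 then (if i = 0 then n else if i = 1 then k else 0) else 0
  real _ _ := 0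
  time := 0

/-- The distribution of the final state of the program `c` on the instance `(f, k)`. -/
def Cmd.run (c : Cmd) {n : ℕ} (f : Finset (Fin n) → ℝ) (k : ℕ) : PMF State :=
  c.exec f (init n k)

/-- The output of a computation: the set stored in the natural array `1`. -/
def State.output (s : State) (n : ℕ) : Finset (Fin n) := s.storedSet n 1

/-- The distribution of the set returned by the program `c` on the instance `(f, k)`. -/
def Cmd.outputDist (c : Cmd) {n : ℕ} (f : Finset (Fin n) → ℝ) (k : ℕ) :
    PMF (Finset (Fin n)) :=
  (c.run f k).map fun s => s.output n

/-- The expected value `𝔼[f(S)]` of the set `S` returned by the program `c` on `(f, k)`. -/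
def Cmd.expectedValue (c : Cmd) {n : ℕ} (f : Finset (Fin n) → ℝ) (k : ℕ) : ℝ :=
  ∑ S : Finset (Fin n), (c.outputDist f k S).toReal * f S

end OracleRAM

end

/-! Write F for the multilinear extension of f, O for an optimal set of size k, and δ = 1/T. Two
points of the cube approach each other: y rises from 0 and x falls from 1. In each step a set M of k
elements is chosen; the coordinates of y in M cover the fraction δ of their distance to 1, and those
of x outside M the fraction δ of their distance to 0. For every u exactly one factor of (1 - y u) *
x u shrinks by 1 - δ, so after t steps this product is (1 - δ)^t (`PairInv`), whence y ≤ 1 - (1 -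
δ)^t and x ≥ (1 - δ)^t. Concavity of F along nonnegative directions then shows that joining O to the
random set of y, or intersecting the random set of x with O, gives expected value at least (1 - δ)^t
f(O) (`le_ml_of_le`, `le_ml_of_ge`). By submodularity the changes are bounded by sums of
single-element gains. So if M consists of the k best elements for the gains weighted by lam and 1 -
lam, then lam * v₁ + (1 - lam) * v₂ ≥ (1 - δ)^t f(O), where v₁ and v₂ are the values at y and x plus
the gains of the respective moves (`le_combined`).

This controls a combination, while both values are needed. The weight lam therefore takes a
projected gradient step against v₁ - v₂, as in online optimization. With the quadratic potentials
F(y) - c(1 - lam)² and F(x) - c lam², each point on its own satisfies w' ≥ (1 - δ)w + δ(1 - δ)^t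
f(O) - loss (`step_arith`, `advance_values`). After T steps both values are at least Tδ(1 - δ)^(T-1)
f(O) ≥ f(O)/e, up to the losses.

At the end the mass of y is at most k, that of x at least k, and y ≤ x. By concavity the point of
mass k on the segment is at least as good as the worse end, and pipage rounding turns it into a set
of size k (`le_pexp_pipage`).

Gains are estimated by sampling; Chebyshev's inequality and a union bound control the failures. All
errors scale with the computable bound R = f ∅ + ∑ f {u}, and R ≤ (n + 1)² f(O) for k < n
(`IsSubmodular.le_card_mul`). Hence polynomial parameters bring the total loss down to 20/(n + 1)
(`setAlg_guarantee`).

The program is tied to this abstract process by couplings (`Lift`), with `Sat` for facts that hold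
for all outcomes. What a piece of program leaves unchanged, and how long it runs, is read off its
syntax (`keepsNat`, `timePoly`). -/

/-! ### The multilinear extension -/

section Multilinear

set_option linter.unusedSectionVars false

variable {α : Type*} [DecidableEq α]

/-- The expected value of `f` on the set that arises from `S` when every `u` in the list `l` is
independently inserted with probability `y u` and erased otherwise. -/
def ml : List α → (α → ℝ) → (Finset α → ℝ) → Finset α → ℝ
  | [], _, f, S => f S
  | u :: l, y, f, S => y u * ml l y f (insert u S) + (1 - y u) * ml l y f (S.erase u)

/-- One step of averaging. -/
def avg (u : α) (p : ℝ) (f : Finset α → ℝ) : Finset α → ℝ :=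
  fun S => p * f (insert u S) + (1 - p) * f (S.erase u)

/-- The function `S ↦ f (S ∪ {u})`. -/
def ins (u : α) (f : Finset α → ℝ) : Finset α → ℝ := fun S => f (insert u S)

/-- The function `S ↦ f (S \ {u})`. -/
def del (u : α) (f : Finset α → ℝ) : Finset α → ℝ := fun S => f (S.erase u)

/-- Averaging over the last coordinate can be absorbed into the function. This permits induction
from the end of the list with `f` generalized, as `avg` preserves submodularity and bounds on the
oscillation. -/
theorem ml_concat (l : List α) (u : α) (y : α → ℝ) (f : Finset α → ℝ) :
    ml (l ++ [u]) y f = ml l y (avg u (y u) f) := by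
  induction l with
  | nil => funext S; simp [ml, avg]
  | cons v l ih => funext S; simp [ml, ih]

theorem ml_combo (l : List α) (y : α → ℝ) (c d : ℝ) (f g : Finset α → ℝ) (S : Finset α) :
    ml l y (fun S => c * f S + d * g S) S = c * ml l y f S + d * ml l y g S := by
  induction l generalizing S with
  | nil => simp [ml]
  | cons v l ih => simp only [ml, ih]; ring

theorem ml_add (l : List α) (y : α → ℝ) (f g : Finset α → ℝ) (S : Finset α) :
    ml l y (fun S => f S + g S) S = ml l y f S + ml l y g S := by
  simpa using ml_combo l y 1 1 f g S

theorem ml_sub (l : List α) (y : α → ℝ) (f g : Finset α → ℝ) (S : Finset α) :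
    ml l y (fun S => f S - g S) S = ml l y f S - ml l y g S := by
  have := ml_combo l y 1 (-1) f g S
  simp only [one_mul, neg_mul, ← sub_eq_add_neg] at this
  exact this

theorem ml_const (l : List α) (y : α → ℝ) (c : ℝ) (S : Finset α) :
    ml l y (fun _ => c) S = c := by
  induction l generalizing S with
  | nil => simp [ml]
  | cons v l ih => simp only [ml, ih]; ring

theorem ml_sum {ι : Type*} (s : Finset ι) (l : List α) (y : α → ℝ) (f : ι → Finset α → ℝ)
    (S : Finset α) : ml l y (fun S => ∑ i ∈ s, f i S) S = ∑ i ∈ s, ml l y (f i) S := by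
  classical
  induction s using Finset.induction_on with
  | empty => simpa using ml_const l y 0 S
  | insert a s ha ih => simp only [Finset.sum_insert ha, ml_add, ih]

/-- All coordinates are probabilities. -/
def InCube (y : α → ℝ) : Prop := ∀ u, 0 ≤ y u ∧ y u ≤ 1

theorem ml_mono {l : List α} {y : α → ℝ} (hy : InCube y) {f g : Finset α → ℝ}
    (h : ∀ S, f S ≤ g S) (S : Finset α) : ml l y f S ≤ ml l y g S := by
  induction l generalizing S with
  | nil => exact h S
  | cons v l ih =>
    simp only [ml]
    have := hy v
    exact add_le_add (mul_le_mul_of_nonneg_left (ih _) this.1)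
      (mul_le_mul_of_nonneg_left (ih _) (by linarith))

theorem ml_nonneg {l : List α} {y : α → ℝ} (hy : InCube y) {f : Finset α → ℝ}
    (h : ∀ S, 0 ≤ f S) (S : Finset α) : 0 ≤ ml l y f S := by
  have := ml_mono (l := l) hy h S
  rwa [ml_const] at this

theorem ml_le {l : List α} {y : α → ℝ} (hy : InCube y) {f : Finset α → ℝ} {c : ℝ}
    (h : ∀ S, f S ≤ c) (S : Finset α) : ml l y f S ≤ c := by
  have := ml_mono (l := l) hy h S
  rwa [ml_const] at this

theorem abs_ml_le {l : List α} {y : α → ℝ} (hy : InCube y) {f : Finset α → ℝ} {c : ℝ}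
    (h : ∀ S, |f S| ≤ c) (S : Finset α) : |ml l y f S| ≤ c := by
  rw [abs_le]
  refine ⟨?_, ml_le hy (fun S => (abs_le.mp (h S)).2) S⟩
  have := ml_mono (l := l) hy (fun S => (abs_le.mp (h S)).1) S
  rwa [ml_const] at this

theorem avg_ins_of_ne {u v : α} (h : v ≠ u) (p : ℝ) (f : Finset α → ℝ) :
    avg v p (ins u f) = ins u (avg v p f) := by
  funext S
  simp only [avg, ins, Finset.insert_comm u v, Finset.erase_insert_of_ne h.symm]

theorem avg_del_of_ne {u v : α} (h : v ≠ u) (p : ℝ) (f : Finset α → ℝ) :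
    avg v p (del u f) = del u (avg v p f) := by
  funext S
  simp only [avg, del, Finset.erase_insert_of_ne h, Finset.erase_right_comm]

theorem insert_erase_eq (u : α) (S : Finset α) : insert u (S.erase u) = insert u S := by
  ext v; by_cases h : v = u <;> simp [h]

theorem avg_ins_self (u : α) (p : ℝ) (f : Finset α → ℝ) : avg u p (ins u f) = ins u f := by
  funext S
  simp only [avg, ins, Finset.insert_idem, insert_erase_eq]
  ring

theorem avg_del_self (u : α) (p : ℝ) (f : Finset α → ℝ) : avg u p (del u f) = del u f := by
  funext S
  simp only [avg, del, Finset.erase_insert_eq_erase, Finset.erase_idem]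
  ring

theorem ml_avg (l : List α) (y : α → ℝ) (u : α) (p : ℝ) (f : Finset α → ℝ) (S : Finset α) :
    ml l y (avg u p f) S = p * ml l y (ins u f) S + (1 - p) * ml l y (del u f) S :=
  ml_combo l y p (1 - p) (ins u f) (del u f) S

/-- Averaging over `v ≠ u` commutes with fixing the status of `u`, and averaging over `u` does
nothing once that status is fixed. -/
theorem ml_split {l : List α} (hl : l.Nodup) {u : α} (hu : u ∈ l) (y : α → ℝ)
    (f : Finset α → ℝ) (S : Finset α) :
    ml l y f S = y u * ml l y (ins u f) S + (1 - y u) * ml l y (del u f) S := by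
  induction l using List.reverseRecOn generalizing f with
  | nil => simp at hu
  | append_singleton l v ih =>
    simp only [ml_concat]
    rw [List.nodup_append] at hl
    obtain ⟨hl, -, hd⟩ := hl
    rcases eq_or_ne v u with rfl | hvu
    · rw [avg_ins_self, avg_del_self, ml_avg]
    · have hul : u ∈ l := by simpa [hvu.symm] using hu
      rw [avg_ins_of_ne hvu, avg_del_of_ne hvu]
      exact ih hl hul _

/-! ### Lipschitz and first-order estimates for the multilinear extension. -/

/-- The oscillation of `f` is at most `c`. -/
def OscLE (f : Finset α → ℝ) (c : ℝ) : Prop := ∀ S S', |f S - f S'| ≤ c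

theorem OscLE.ins {f : Finset α → ℝ} {c : ℝ} (h : OscLE f c) (u : α) : OscLE (ins u f) c :=
  fun _ _ => h _ _

theorem OscLE.del {f : Finset α → ℝ} {c : ℝ} (h : OscLE f c) (u : α) : OscLE (del u f) c :=
  fun _ _ => h _ _

theorem OscLE.nonneg {f : Finset α → ℝ} {c : ℝ} (h : OscLE f c) : 0 ≤ c :=
  (abs_nonneg _).trans (h ∅ ∅)

theorem OscLE.of_bounds {f : Finset α → ℝ} {c : ℝ} (h0 : ∀ S, 0 ≤ f S) (h1 : ∀ S, f S ≤ c) :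
    OscLE f c := fun S S' => by
  rw [abs_le]; constructor <;> linarith [h0 S, h0 S', h1 S, h1 S']

theorem OscLE.avg {f : Finset α → ℝ} {c : ℝ} (h : OscLE f c) (u : α) {p : ℝ} (hp : 0 ≤ p)
    (hp1 : p ≤ 1) : OscLE (avg u p f) c := fun S S' => by
  have h1 := abs_le.mp (h (insert u S) (insert u S'))
  have h2 := abs_le.mp (h (S.erase u) (S'.erase u))
  rw [abs_le]
  simp only [_root_.avg]
  constructor <;> nlinarith

theorem abs_ml_sub_ml_le {l : List α} {y y' : α → ℝ} (hy : InCube y) (hy' : InCube y')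
    {f : Finset α → ℝ} {c : ℝ} (hf : OscLE f c) (S : Finset α) :
    |ml l y' f S - ml l y f S| ≤ c * (l.map fun u => |y' u - y u|).sum := by
  induction l using List.reverseRecOn generalizing f with
  | nil => simp [ml]
  | append_singleton l v ih =>
    simp only [ml_concat, List.map_append, List.sum_append, List.map_cons, List.map_nil,
      List.sum_cons, List.sum_nil, add_zero]
    -- The move is split in two: first the coordinates in `l`, with `v` averaged at `y v`, then the
    -- coordinate `v` alone.
    have h1 := ih (hf.avg v (hy v).1 (hy v).2)
    have h2 : |ml l y' (fun S => avg v (y' v) f S - avg v (y v) f S) S| ≤ c * |y' v - y v| := by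
      refine abs_ml_le hy' (fun S => ?_) S
      have : avg v (y' v) f S - avg v (y v) f S
          = (f (insert v S) - f (S.erase v)) * (y' v - y v) := by simp only [avg]; ring
      rw [this, abs_mul]
      exact mul_le_mul_of_nonneg_right (hf _ _) (abs_nonneg _)
    rw [ml_sub] at h2
    have := abs_add_le (ml l y' (avg v (y v) f) S - ml l y (avg v (y v) f) S)
      (ml l y' (avg v (y' v) f) S - ml l y' (avg v (y v) f) S)
    rw [show ml l y' (avg v (y' v) f) S - ml l y (avg v (y v) f) S =
      (ml l y' (avg v (y v) f) S - ml l y (avg v (y v) f) S) +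
      (ml l y' (avg v (y' v) f) S - ml l y' (avg v (y v) f) S) by ring]
    linarith

/-- Adding a coordinate `v` with displacement d creates one new error: d times the change of the
partial derivative at `v` while the earlier coordinates move. By the Lipschitz bound this is at most
2cs|d|, where s is the earlier displacement, and it fits into 2c(s + |d|)² - 2cs². -/
theorem ml_taylor {l : List α} (hl : l.Nodup) {y y' : α → ℝ} (hy : InCube y) (hy' : InCube y')
    {f : Finset α → ℝ} {c : ℝ} (hf : OscLE f c) (S : Finset α) :
    |ml l y' f S - ml l y f S
      - (l.map fun u => (y' u - y u) * (ml l y (ins u f) S - ml l y (del u f) S)).sum|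
      ≤ 2 * c * (l.map fun u => |y' u - y u|).sum ^ 2 := by
  induction l using List.reverseRecOn generalizing f with
  | nil => simp [ml]
  | append_singleton l v ih =>
    rw [List.nodup_append] at hl
    obtain ⟨hl, -, hd⟩ := hl
    have hne : ∀ u ∈ l, v ≠ u := fun u hu => (hd u hu v (by simp)).symm
    simp only [ml_concat, List.map_append, List.sum_append, List.map_cons, List.map_nil,
      List.sum_cons, List.sum_nil, add_zero, avg_ins_self, avg_del_self]
    have h1 := ih hl (hf.avg v (hy v).1 (hy v).2)
    have hmap : (l.map fun u => (y' u - y u) *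
        (ml l y (avg v (y v) (ins u f)) S - ml l y (avg v (y v) (del u f)) S))
        = (l.map fun u => (y' u - y u) *
        (ml l y (ins u (avg v (y v) f)) S - ml l y (del u (avg v (y v) f)) S)) := by
      refine List.map_congr_left fun u hu => ?_
      rw [avg_ins_of_ne (hne u hu), avg_del_of_ne (hne u hu)]
    rw [hmap]
    set A := (l.map fun u => (y' u - y u) *
        (ml l y (ins u (avg v (y v) f)) S - ml l y (del u (avg v (y v) f)) S)).sum
    set s := (l.map fun u => |y' u - y u|).sum
    have hs : 0 ≤ s := List.sum_nonneg (by simp +contextual [abs_nonneg])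
    have h2 := abs_ml_sub_ml_le (l := l) hy hy' (hf.ins v) S
    have h3 := abs_ml_sub_ml_le (l := l) hy hy' (hf.del v) S
    have hc := hf.nonneg
    have e : ml l y' (avg v (y' v) f) S - ml l y (avg v (y v) f) S
        - (A + (y' v - y v) * (ml l y (ins v f) S - ml l y (del v f) S))
        = (ml l y' (avg v (y v) f) S - ml l y (avg v (y v) f) S - A)
          + (y' v - y v) * ((ml l y' (ins v f) S - ml l y (ins v f) S)
            - (ml l y' (del v f) S - ml l y (del v f) S)) := by
      rw [ml_avg l y', ml_avg l y' v (y v)]; ring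
    rw [e]
    refine (abs_add_le _ _).trans ?_
    rw [abs_mul]
    have h4 := abs_sub (ml l y' (ins v f) S - ml l y (ins v f) S)
      (ml l y' (del v f) S - ml l y (del v f) S)
    have h5 : |y' v - y v| * |(ml l y' (ins v f) S - ml l y (ins v f) S)
            - (ml l y' (del v f) S - ml l y (del v f) S)| ≤ |y' v - y v| * (2 * c * s) :=
      mul_le_mul_of_nonneg_left (by linarith) (abs_nonneg _)
    have h6 := mul_nonneg (mul_nonneg hc (abs_nonneg (y' v - y v))) hs
    have h7 := mul_nonneg hc (sq_nonneg |y' v - y v|)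
    nlinarith

/-! ### Submodularity under averaging, and concavity along nonnegative directions. -/

theorem IsSubmodular.ins {f : Finset α → ℝ} (hf : IsSubmodular f) (u : α) :
    IsSubmodular (ins u f) := fun A B => by
  simp only [_root_.ins, Finset.insert_union_distrib, Finset.insert_inter_distrib]
  exact hf _ _

theorem IsSubmodular.del {f : Finset α → ℝ} (hf : IsSubmodular f) (u : α) :
    IsSubmodular (del u f) := fun A B => by
  have e : (A ∩ B).erase u = A.erase u ∩ B.erase u := by
    ext v; simp only [Finset.mem_erase, Finset.mem_inter]; tauto
  simp only [_root_.del, Finset.erase_union_distrib, e]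
  exact hf _ _

theorem IsSubmodular.avg {f : Finset α → ℝ} (hf : IsSubmodular f) (u : α) {p : ℝ} (hp : 0 ≤ p)
    (hp1 : p ≤ 1) : IsSubmodular (avg u p f) := fun A B => by
  have h1 := mul_le_mul_of_nonneg_left (hf.ins u A B) hp
  have h2 := mul_le_mul_of_nonneg_left (hf.del u A B) (sub_nonneg.mpr hp1)
  simp only [_root_.avg, _root_.ins, _root_.del] at *
  linarith

theorem IsSubmodular.insert_sub_le {f : Finset α → ℝ} (hf : IsSubmodular f) {A B : Finset α}
    (h : A ⊆ B) {u : α} (hu : u ∉ B) : f (insert u B) - f B ≤ f (insert u A) - f A := by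
  have := hf (insert u A) B
  have e1 : insert u A ∪ B = insert u B := by
    rw [Finset.insert_union, Finset.union_eq_right.mpr h]
  have e2 : insert u A ∩ B = A := by
    rw [Finset.insert_inter_of_notMem hu, Finset.inter_eq_left.mpr h]
  rw [e1, e2] at this
  linarith

/-- Diminishing returns; erasing `u` first removes any side condition on membership. -/
theorem IsSubmodular.antitone_ins_sub_del {f : Finset α → ℝ} (hf : IsSubmodular f) (u : α) :
    Antitone fun S => f (insert u S) - f (S.erase u) := fun A B h => by
  have := hf.insert_sub_le (Finset.erase_subset_erase u h) (Finset.notMem_erase u B)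
  simpa only [insert_erase_eq] using this

theorem ml_antitone {l : List α} {x y : α → ℝ} (hx : InCube x) (hy : InCube y)
    (hxy : ∀ u, y u ≤ x u) {g : Finset α → ℝ} (hg : Antitone g) (S : Finset α) :
    ml l x g S ≤ ml l y g S := by
  induction l using List.reverseRecOn generalizing g with
  | nil => simp [ml]
  | append_singleton l v ih =>
    simp only [ml_concat]
    have h1 : ml l x (avg v (x v) g) S ≤ ml l x (avg v (y v) g) S := by
      refine ml_mono hx (fun S => ?_) S
      have := hg ((Finset.erase_subset v S).trans (Finset.subset_insert v S))
      simp only [avg]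
      nlinarith [hxy v]
    refine h1.trans (ih fun A B h => ?_)
    simp only [avg]
    exact add_le_add (mul_le_mul_of_nonneg_left (hg (Finset.insert_subset_insert v h)) (hy v).1)
      (mul_le_mul_of_nonneg_left (hg (Finset.erase_subset_erase v h)) (by linarith [(hy v).2]))

/-- The multilinear extension of a submodular function is concave along nonnegative directions. -/
theorem ml_concave {l : List α} {x y : α → ℝ} (hx : InCube x) (hy : InCube y)
    (hxy : ∀ u, y u ≤ x u) {s : ℝ} (hs : 0 ≤ s) (hs1 : s ≤ 1) {f : Finset α → ℝ}
    (hf : IsSubmodular f) (S : Finset α) :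
    (1 - s) * ml l y f S + s * ml l x f S ≤ ml l (fun u => y u + s * (x u - y u)) f S := by
  induction l using List.reverseRecOn generalizing f with
  | nil => simp only [ml]; linarith
  | append_singleton l v ih =>
    simp only [ml_concat]
    set p := fun u => y u + s * (x u - y u) with hp
    -- Averaging at `v` is affine in the probability. Applying the induction hypothesis to both
    -- averages leaves the cross term s(1 - s)(x v - y v) times the difference of the partial
    -- derivatives at `y` and at `x`, which is nonnegative by `h3`.
    have e : avg v (p v) f = fun S => (1 - s) * avg v (y v) f S + s * avg v (x v) f S := by
      funext S; simp only [avg, hp]; ring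
    rw [e, ml_combo]
    have h1 := ih (hf.avg v (hy v).1 (hy v).2)
    have h2 := ih (hf.avg v (hx v).1 (hx v).2)
    have h3 := ml_antitone (l := l) hx hy hxy (hf.antitone_ins_sub_del v) S
    have e1 : ml l x (fun S => f (insert v S) - f (S.erase v)) S
      = ml l x (ins v f) S - ml l x (del v f) S := ml_sub _ _ (ins v f) (del v f) S
    have e2 : ml l y (fun S => f (insert v S) - f (S.erase v)) S
      = ml l y (ins v f) S - ml l y (del v f) S := ml_sub _ _ (ins v f) (del v f) S
    rw [e1, e2] at h3
    have h1' := mul_le_mul_of_nonneg_left h1 (sub_nonneg.mpr hs1)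
    have h2' := mul_le_mul_of_nonneg_left h2 hs
    refine le_trans ?_ (add_le_add h1' h2')
    simp only [ml_avg]
    have := mul_le_mul_of_nonneg_left h3
      (mul_nonneg (mul_nonneg hs (sub_nonneg.mpr hs1)) (sub_nonneg.mpr (hxy v)))
    nlinarith

/-- `P` survives every outcome of positive probability, so only the values of `f` on `P` matter. -/
theorem ml_eq_of_sure {l : List α} {y : α → ℝ} {f : Finset α → ℝ} {P : Finset α → Prop}
    {S : Finset α} {c : ℝ} (hS : P S) (hf : ∀ S, P S → f S = c)
    (h1 : ∀ u ∈ l, ∀ S, P S → y u ≠ 0 → P (insert u S))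
    (h0 : ∀ u ∈ l, ∀ S, P S → y u ≠ 1 → P (S.erase u)) : ml l y f S = c := by
  induction l generalizing S with
  | nil => exact hf S hS
  | cons v l ih =>
    simp only [ml]
    have ih' := fun S hS => ih (S := S) hS (fun u hu => h1 u (by simp [hu]))
      (fun u hu => h0 u (by simp [hu]))
    by_cases hv0 : y v = 0
    · rw [ih' _ (h0 v (by simp) S hS (by simp [hv0])), hv0]; ring
    · by_cases hv1 : y v = 1
      · rw [ih' _ (h1 v (by simp) S hS hv0), hv1]; ring
      · rw [ih' _ (h0 v (by simp) S hS hv1), ih' _ (h1 v (by simp) S hS hv0)]; ring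

theorem ml_zero (l : List α) (f : Finset α → ℝ) : ml l (fun _ => 0) f ∅ = f ∅ := by
  refine ml_eq_of_sure (P := fun S => S = ∅) rfl (by rintro _ rfl; rfl) (by simp) ?_
  rintro u - S rfl -
  simp

theorem ml_one {l : List α} (hl : l.Nodup) (f : Finset α → ℝ) (S : Finset α) :
    ml l (fun _ => 1) f S = f (S ∪ l.toFinset) := by
  induction l generalizing S with
  | nil => simp [ml]
  | cons v l ih =>
    simp only [ml, ih (List.nodup_cons.mp hl).2]
    simp

/-- If no coordinate exceeds `θ`, sampling keeps a `1 - θ` fraction of the value at `∅`. -/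
theorem le_ml_of_le {l : List α} {y : α → ℝ} (hy : InCube y) {θ : ℝ} (hyθ : ∀ u, y u ≤ θ)
    (hθ : θ ≤ 1) (hθ0 : 0 ≤ θ) {g : Finset α → ℝ} (hg : IsSubmodular g) (h0 : ∀ S, 0 ≤ g S) :
    (1 - θ) * g ∅ ≤ ml l y g ∅ := by
  rcases hθ0.eq_or_lt with rfl | hθ0
  · rw [show y = fun _ => 0 from funext fun u => le_antisymm (hyθ u) (hy u).1, ml_zero]
    simp
  -- `y` lies at the fraction `θ` of the segment from 0 to `y / θ`, which is still in the cube.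
  -- Concavity on this segment and nonnegativity at its far end give the claim.
  have hv : InCube fun u => y u / θ := fun u =>
    ⟨div_nonneg (hy u).1 hθ0.le, (div_le_one hθ0).mpr (hyθ u)⟩
  have hz : InCube fun _ : α => (0 : ℝ) := fun _ => ⟨le_rfl, zero_le_one⟩
  have := ml_concave (l := l) hv hz (fun u => (hv u).1) hθ0.le hθ hg ∅
  rw [ml_zero] at this
  have e : (fun u => 0 + θ * (y u / θ - 0)) = y := by
    funext u; field_simp; ring
  rw [e] at this
  nlinarith [ml_nonneg (l := l) hv h0 ∅]

/-- If no coordinate is below `τ`, sampling keeps a `τ` fraction of the value at the full set. -/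
theorem le_ml_of_ge {l : List α} (hl : l.Nodup) {y : α → ℝ} (hy : InCube y) {τ : ℝ}
    (hyτ : ∀ u, τ ≤ y u) (hτ : 0 ≤ τ) (hτ1 : τ ≤ 1) {g : Finset α → ℝ} (hg : IsSubmodular g)
    (h0 : ∀ S, 0 ≤ g S) : τ * g l.toFinset ≤ ml l y g ∅ := by
  rcases hτ1.eq_or_lt with rfl | hτ1
  · rw [show y = fun _ => 1 from funext fun u => le_antisymm (hy u).2 (hyτ u), ml_one hl]
    simp
  have h1 : (0 : ℝ) < 1 - τ := by linarith
  -- `y` lies at the fraction `τ` of the segment from this point to the all-ones point, where the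
  -- value is that of the full set.
  have hv : InCube fun u => (y u - τ) / (1 - τ) := fun u =>
    ⟨div_nonneg (by linarith [hyτ u]) h1.le, (div_le_one h1).mpr (by linarith [(hy u).2])⟩
  have hz : InCube fun _ : α => (1 : ℝ) := fun _ => ⟨zero_le_one, le_rfl⟩
  have := ml_concave (l := l) hz hv (fun u => (hv u).2) hτ hτ1.le hg ∅
  rw [ml_one hl] at this
  have e : (fun u => (y u - τ) / (1 - τ) + τ * (1 - (y u - τ) / (1 - τ))) = y := by
    funext u; field_simp; ring
  rw [e, Finset.empty_union] at this
  nlinarith [ml_nonneg (l := l) hv h0 ∅]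

theorem ml_ins_congr {l : List α} {u : α} {y y' : α → ℝ} (h : ∀ v ∈ l, v ≠ u → y v = y' v)
    (f : Finset α → ℝ) (S : Finset α) : ml l y (ins u f) S = ml l y' (ins u f) S := by
  induction l using List.reverseRecOn generalizing f with
  | nil => rfl
  | append_singleton l v ih =>
    have ih' := fun f => ih (fun v hv => h v (by simp [hv])) f
    simp only [ml_concat]
    rcases eq_or_ne v u with rfl | hvu
    · rw [avg_ins_self, avg_ins_self, ih']
    · rw [avg_ins_of_ne hvu, avg_ins_of_ne hvu, ih', h v (by simp) hvu]

theorem ml_del_congr {l : List α} {u : α} {y y' : α → ℝ} (h : ∀ v ∈ l, v ≠ u → y v = y' v)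
    (f : Finset α → ℝ) (S : Finset α) : ml l y (del u f) S = ml l y' (del u f) S := by
  induction l using List.reverseRecOn generalizing f with
  | nil => rfl
  | append_singleton l v ih =>
    have ih' := fun f => ih (fun v hv => h v (by simp [hv])) f
    simp only [ml_concat]
    rcases eq_or_ne v u with rfl | hvu
    · rw [avg_del_self, avg_del_self, ih']
    · rw [avg_del_of_ne hvu, avg_del_of_ne hvu, ih', h v (by simp) hvu]

/-- Dependence on two coordinates: bilinear, with a nonpositive mixed coefficient. -/
theorem ml_update_update {l : List α} (hl : l.Nodup) {i j : α} (hi : i ∈ l) (hj : j ∈ l)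
    (hij : i ≠ j) {y : α → ℝ} (hy : InCube y) {f : Finset α → ℝ} (hf : IsSubmodular f)
    (S : Finset α) : ∃ c₀ c₁ c₂ c₃ : ℝ, c₃ ≤ 0 ∧ ∀ a b,
      ml l (Function.update (Function.update y i a) j b) f S
        = c₀ + c₁ * a + c₂ * b + c₃ * (a * b) := by
  have key : ∀ a b, ml l (Function.update (Function.update y i a) j b) f S
      = a * (b * ml l y (ins i (ins j f)) S + (1 - b) * ml l y (ins i (del j f)) S)
        + (1 - a) * (b * ml l y (del i (ins j f)) S + (1 - b) * ml l y (del i (del j f)) S) := by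
    intro a b
    set y' := Function.update (Function.update y i a) j b with hy'
    have hyj : y' j = b := by simp [hy']
    have hyi : y' i = a := by simp [hy', hij]
    have hyo : ∀ v, v ≠ i → v ≠ j → y' v = y v := fun v h1 h2 => by simp [hy', h1, h2]
    have c1 : ∀ g : Finset α → ℝ, ins i (ins j g) = ins j (ins i g) := fun g => by
      funext S; simp [ins, Finset.insert_comm]
    have c2 : ∀ g : Finset α → ℝ, ins i (del j g) = del j (ins i g) := fun g => by
      funext S; simp [ins, del, Finset.erase_insert_of_ne hij]
    have c3 : ∀ g : Finset α → ℝ, del i (ins j g) = ins j (del i g) := fun g => by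
      funext S; simp [ins, del, Finset.erase_insert_of_ne hij.symm]
    have c4 : ∀ g : Finset α → ℝ, del i (del j g) = del j (del i g) := fun g => by
      funext S; simp [del, Finset.erase_right_comm]
    have yi : InCube y := hy
    let y₁ := Function.update y j b
    have a1 : ∀ v ∈ l, v ≠ i → y' v = y₁ v := fun v _ h => by
      by_cases hvj : v = j
      · subst hvj; simp [hyj, y₁]
      · simp [hyo v h hvj, y₁, hvj]
    have a2 : ∀ v ∈ l, v ≠ j → y₁ v = y v := fun v _ h => by simp [y₁, h]
    rw [ml_split hl hi, ml_ins_congr a1, ml_del_congr a1, hyi,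
      ml_split hl hj y₁ (ins i f), ml_split hl hj y₁ (del i f)]
    rw [ml_ins_congr a2, ml_del_congr a2, ml_ins_congr a2, ml_del_congr a2, c1, c2, c3, c4]
    simp [y₁]
  refine ⟨ml l y (del i (del j f)) S,
    ml l y (ins i (del j f)) S - ml l y (del i (del j f)) S,
    ml l y (del i (ins j f)) S - ml l y (del i (del j f)) S,
    (ml l y (ins i (ins j f)) S + ml l y (del i (del j f)) S)
      - (ml l y (ins i (del j f)) S + ml l y (del i (ins j f)) S), ?_, fun a b => ?_⟩
  · rw [sub_nonpos, ← ml_add, ← ml_add]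
    refine ml_mono hy (fun S => ?_) S
    -- The mixed coefficient is the expectation of a mixed second difference in `i` and `j`;
    -- diminishing returns make it nonpositive.
    have h := hf.antitone_ins_sub_del i ((Finset.erase_subset j S).trans (Finset.subset_insert j S))
    simp only [ins, del, Finset.erase_insert_of_ne hij.symm, Finset.erase_insert_of_ne hij,
      Finset.insert_comm i j, Finset.erase_right_comm (a := j) (b := i)] at h ⊢
    linarith
  · rw [key]; ring

/-! ### Submodular inequalities on sets, and passing to sets of prescribed size. -/

theorem IsSubmodular.le_sum_insert {f : Finset α → ℝ} (hf : IsSubmodular f) (A O : Finset α) :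
    f (A ∪ O) - f A ≤ ∑ u ∈ O, (f (insert u A) - f A) := by
  induction O using Finset.induction_on with
  | empty => simp
  | insert v O hv ih =>
    rw [Finset.sum_insert hv, Finset.union_insert]
    by_cases hvA : v ∈ A ∪ O
    · rw [Finset.insert_eq_self.mpr hvA]
      have hvA' : v ∈ A := by simpa [hv] using hvA
      rw [Finset.insert_eq_self.mpr hvA']; linarith
    · have := hf.insert_sub_le (Finset.subset_union_left (s₁ := A) (s₂ := O)) hvA
      linarith

theorem IsSubmodular.le_sum_erase {f : Finset α → ℝ} (hf : IsSubmodular f) (A D : Finset α) :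
    f (A \ D) - f A ≤ ∑ u ∈ D, (f (A.erase u) - f A) := by
  induction D using Finset.induction_on with
  | empty => simp
  | insert v D hv ih =>
    rw [Finset.sum_insert hv, Finset.sdiff_insert]
    by_cases hvA : v ∈ A
    · have := hf.insert_sub_le (Finset.erase_subset_erase v (Finset.sdiff_subset (s := A) (t := D)))
        (Finset.notMem_erase v A)
      rw [Finset.insert_erase hvA, Finset.insert_erase (by simp [hvA, hv])] at this
      linarith
    · rw [Finset.erase_eq_of_notMem hvA, Finset.erase_eq_of_notMem (by simp [hvA])]; linarith

theorem IsSubmodular.union_right {f : Finset α → ℝ} (hf : IsSubmodular f) (O : Finset α) :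
    IsSubmodular fun S => f (S ∪ O) := fun A B => by
  have := hf (A ∪ O) (B ∪ O)
  rwa [← Finset.union_union_distrib_right, ← Finset.inter_union_distrib_right] at this

theorem IsSubmodular.inter_right {f : Finset α → ℝ} (hf : IsSubmodular f) (O : Finset α) :
    IsSubmodular fun S => f (S ∩ O) := fun A B => by
  have := hf (A ∩ O) (B ∩ O)
  rwa [← Finset.union_inter_distrib_right, ← Finset.inter_inter_distrib_right] at this

theorem IsSubmodular.le_sum_singleton {f : Finset α → ℝ} [Fintype α] (hf : IsSubmodular f)
    (h0 : ∀ S, 0 ≤ f S) (S : Finset α) : f S ≤ f ∅ + ∑ u, f {u} := by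
  have h1 := hf.le_sum_insert ∅ S
  simp only [Finset.empty_union, insert_empty_eq] at h1
  have h2 : ∑ u ∈ S, (f {u} - f ∅) ≤ ∑ u ∈ S, f {u} :=
    Finset.sum_le_sum fun u _ => by linarith [h0 ∅]
  have h3 : ∑ u ∈ S, f {u} ≤ ∑ u, f {u} :=
    Finset.sum_le_sum_of_subset_of_nonneg (Finset.subset_univ S) fun u _ _ => h0 _
  linarith

/-- Averaging: the losses from erasing single elements of `S` add up to at most f(S) - f(∅) ≤ f(S),
so some loss is at most f(S)/|S|. -/
theorem IsSubmodular.exists_erase {f : Finset α → ℝ} (hf : IsSubmodular f) (h0 : ∀ S, 0 ≤ f S)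
    {S : Finset α} (hS : S.Nonempty) : ∃ u ∈ S, ((S.card : ℝ) - 1) * f S ≤ S.card * f (S.erase u) := by
  by_contra! h
  have h1 := hf.le_sum_erase S S
  rw [Finset.sum_sub_distrib, Finset.sum_const, nsmul_eq_mul, Finset.sdiff_self] at h1
  have h2 := Finset.sum_lt_sum_of_nonempty hS h
  rw [← Finset.mul_sum, Finset.sum_const, nsmul_eq_mul] at h2
  have hc : (0 : ℝ) < S.card := by exact_mod_cast hS.card_pos
  nlinarith [h0 ∅, h0 S, mul_nonneg hc.le (h0 ∅)]

/-- Elements are erased one at a time; the factors (s - 1)/s telescope to k/|S|. -/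
theorem IsSubmodular.exists_subset_card {f : Finset α → ℝ} (hf : IsSubmodular f)
    (h0 : ∀ S, 0 ≤ f S) {k : ℕ} (S : Finset α) (h : k ≤ S.card) :
    ∃ S' : Finset α, S'.card = k ∧ (k : ℝ) * f S ≤ S.card * f S' := by
  obtain ⟨d, hd⟩ := Nat.exists_eq_add_of_le h
  induction d generalizing S with
  | zero => exact ⟨S, by simpa using hd, by rw [hd]; simp⟩
  | succ d ih =>
    have hne : S.Nonempty := Finset.card_pos.mp (by omega)
    obtain ⟨u, hu, h1⟩ := hf.exists_erase h0 hne
    have hc := Finset.card_erase_of_mem hu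
    obtain ⟨S', hS', h2⟩ := ih (S.erase u) (by omega) (by omega)
    refine ⟨S', hS', ?_⟩
    rw [show (((S.erase u).card : ℕ) : ℝ) = (k : ℝ) + d by rw [hc, hd]; simp [← add_assoc]] at h2
    rw [hd] at h1 ⊢
    push_cast at h1 ⊢
    -- The two inequalities are combined after multiplication by `k + d`, which can be cancelled
    -- only if it is positive; otherwise `k = 0` and the left side vanishes.
    rcases Nat.eq_zero_or_pos (k + d) with h3 | h3
    · have : k = 0 := by omega
      subst this
      simp only [Nat.cast_zero, zero_mul]
      have := h0 S'
      positivity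
    have h4 : (0 : ℝ) < k + d := by exact_mod_cast h3
    have h5 : ((k : ℝ) + d) * (k * f S) ≤ (k + d) * ((k + (d + 1)) * f S') := by
      have := mul_le_mul_of_nonneg_left h1 (Nat.cast_nonneg (α := ℝ) k)
      have := mul_le_mul_of_nonneg_left h2 (by positivity : (0 : ℝ) ≤ k + (d + 1))
      nlinarith
    exact le_of_mul_le_mul_left h5 h4

/-- S ↦ f(Sᶜ) is again submodular, which turns enlarging into shrinking. -/
theorem IsSubmodular.exists_superset_card {f : Finset α → ℝ} [Fintype α] (hf : IsSubmodular f)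
    (h0 : ∀ S, 0 ≤ f S) {k : ℕ} (S : Finset α) (h : k ≤ Sᶜ.card) :
    ∃ S' : Finset α, S'ᶜ.card = k ∧ (k : ℝ) * f S ≤ Sᶜ.card * f S' := by
  have hg : IsSubmodular fun S => f Sᶜ := fun A B => by
    have := hf Aᶜ Bᶜ
    rw [← Finset.compl_inter, ← Finset.compl_union] at this
    simp only
    linarith
  obtain ⟨S', h1, h2⟩ := hg.exists_subset_card (fun S => h0 _) Sᶜ h
  exact ⟨S'ᶜ, by simpa using h1, by simpa using h2⟩

/-- A bound on the values of `f` in terms of its values on sets of size `k`. -/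
theorem IsSubmodular.le_card_mul {f : Finset α → ℝ} [Fintype α] (hf : IsSubmodular f)
    (h0 : ∀ S, 0 ≤ f S) {k : ℕ} (hk : 1 ≤ k) (hkn : k < Fintype.card α) {M : ℝ}
    (hM : ∀ S : Finset α, S.card = k → f S ≤ M) (S : Finset α) :
    f S ≤ Fintype.card α * M := by
  -- Here `j` is `k` when `S` is shrunk, and the size of the complement of a `k`-set when `S` is
  -- enlarged. Both are positive only because `k` lies strictly between 0 and the size of the ground
  -- set.
  have key : ∀ (j s : ℕ) (S' : Finset α), 1 ≤ j → s ≤ Fintype.card α → S'.card = k →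
      (j : ℝ) * f S ≤ s * f S' → f S ≤ Fintype.card α * M := by
    intro j s S' hj hs hS' h
    have h1 : f S ≤ (j : ℝ) * f S := by
      have : (1 : ℝ) ≤ j := by exact_mod_cast hj
      nlinarith [h0 S]
    have h2 : (s : ℝ) * f S' ≤ Fintype.card α * f S' :=
      mul_le_mul_of_nonneg_right (by exact_mod_cast hs) (h0 _)
    have h3 : (Fintype.card α : ℝ) * f S' ≤ Fintype.card α * M :=
      mul_le_mul_of_nonneg_left (hM _ hS') (Nat.cast_nonneg _)
    linarith
  rcases le_total k S.card with h | h
  · obtain ⟨S', h1, h2⟩ := hf.exists_subset_card h0 S h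
    exact key k S.card S' hk (Finset.card_le_univ S) h1 h2
  · have hc := Finset.card_compl S
    obtain ⟨S', h1, h2⟩ := hf.exists_superset_card h0 (k := Fintype.card α - k) S (by omega)
    have hc' := Finset.card_compl S'
    have := Finset.card_le_univ S'
    exact key _ _ S' (by omega) (Finset.card_le_univ _) (by omega) h2

end Multilinear

noncomputable section

/-! ### Expectations of nonnegative functions -/

section Expectation

open scoped ENNReal

variable {α β σ : Type*}

/-- The expectation of a nonnegative function. -/
def pexp (p : PMF α) (g : α → ℝ≥0∞) : ℝ≥0∞ := ∑' a, p a * g a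

theorem pexp_pure (a : α) (g : α → ℝ≥0∞) : pexp (PMF.pure a) g = g a := by
  unfold pexp
  rw [tsum_eq_single a]
  · simp
  · intro b hb; simp [hb]

theorem pexp_bind (p : PMF α) (q : α → PMF β) (g : β → ℝ≥0∞) :
    pexp (p.bind q) g = pexp p fun a => pexp (q a) g := by
  unfold pexp
  simp only [PMF.bind_apply, ← ENNReal.tsum_mul_right, ← ENNReal.tsum_mul_left]
  rw [ENNReal.tsum_comm]
  simp only [mul_assoc]

theorem pexp_map (p : PMF α) (h : α → β) (g : β → ℝ≥0∞) :
    pexp (p.map h) g = pexp p fun a => g (h a) := by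
  rw [PMF.map, pexp_bind]
  simp only [Function.comp, pexp_pure]

theorem pexp_mono_support {p : PMF α} {g h : α → ℝ≥0∞} (H : ∀ a ∈ p.support, g a ≤ h a) :
    pexp p g ≤ pexp p h := by
  refine ENNReal.tsum_le_tsum fun a => ?_
  by_cases ha : a ∈ p.support
  · exact mul_le_mul_right (H a ha) _
  · rw [PMF.mem_support_iff, not_not] at ha
    simp [ha]

theorem pexp_const (p : PMF α) (c : ℝ≥0∞) : pexp p (fun _ => c) = c := by
  unfold pexp
  rw [ENNReal.tsum_mul_right, p.tsum_coe, one_mul]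

theorem pexp_add (p : PMF α) (g h : α → ℝ≥0∞) :
    pexp p (fun a => g a + h a) = pexp p g + pexp p h := by
  unfold pexp
  simp only [mul_add]
  exact ENNReal.tsum_add

theorem pexp_mul_right (p : PMF α) (g : α → ℝ≥0∞) (c : ℝ≥0∞) :
    pexp p (fun a => g a * c) = pexp p g * c := by
  unfold pexp
  simp only [← mul_assoc]
  exact ENNReal.tsum_mul_right

theorem pexp_sum {ι : Type*} (s : Finset ι) (p : PMF α) (g : ι → α → ℝ≥0∞) :
    pexp p (fun a => ∑ i ∈ s, g i a) = ∑ i ∈ s, pexp p (g i) := by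
  classical
  induction s using Finset.induction_on with
  | empty => simp [pexp]
  | insert a s ha ih => simp only [Finset.sum_insert ha, pexp_add, ih]

open Classical in
/-- The probability of an event. -/
def prob (p : PMF α) (P : α → Prop) : ℝ≥0∞ := pexp p fun a => if P a then 1 else 0

theorem prob_add_prob_not (p : PMF α) (P : α → Prop) : prob p P + prob p (fun a => ¬ P a) = 1 := by
  unfold prob
  rw [← pexp_add]
  refine (congrArg (pexp p) (funext fun a => ?_)).trans (pexp_const p 1)
  by_cases h : P a <;> simp [h]

/-- If `P` fails with probability at most `η` and `P` forces `c ≤ g`, then `c ≤ 𝔼 g + η c`. -/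
theorem le_pexp_add {p : PMF α} {P : α → Prop} {g : α → ℝ≥0∞} {c η : ℝ≥0∞}
    (hP : prob p (fun a => ¬ P a) ≤ η) (hg : ∀ a, P a → c ≤ g a) : c ≤ pexp p g + η * c := by
  have h1 : prob p P * c ≤ pexp p g := by
    unfold prob
    rw [← pexp_mul_right]
    refine pexp_mono_support fun a _ => ?_
    by_cases h : P a <;> simp [h]
    exact hg a h
  calc c = (prob p P + prob p fun a => ¬ P a) * c := by rw [prob_add_prob_not, one_mul]
    _ = prob p P * c + (prob p fun a => ¬ P a) * c := add_mul _ _ _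
    _ ≤ _ := add_le_add h1 (mul_le_mul_left hP c)

theorem prob_bind_le {p : PMF α} {q : α → PMF β} {P : α → Prop} {Q : β → Prop} {η₁ η₂ : ℝ≥0∞}
    (hp : prob p (fun a => ¬ P a) ≤ η₁) (hq : ∀ a, P a → prob (q a) (fun b => ¬ Q b) ≤ η₂) :
    prob (p.bind q) (fun b => ¬ Q b) ≤ η₁ + η₂ := by
  classical
  unfold prob at *
  rw [pexp_bind]
  calc _ ≤ pexp p fun a => (if ¬ P a then 1 else 0) + η₂ := by
        refine pexp_mono_support fun a _ => ?_
        by_cases h : P a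
        · simpa [h] using hq a h
        · simp only [h, not_false_eq_true, if_true]
          refine le_add_right ((pexp_mono_support (h := fun _ => 1) fun b _ => ?_).trans
            (pexp_const _ 1).le)
          split_ifs <;> simp
    _ = _ := pexp_add _ _ _
    _ ≤ _ := by rw [pexp_const]; exact add_le_add_left (by convert hp) _

/-- `m` rounds of a random transition. -/
def piter (K : σ → PMF σ) : ℕ → σ → PMF σ
  | 0, s => PMF.pure s
  | m + 1, s => (K s).bind (piter K m)

/-- Random transitions along a list. -/
def pfold (K : β → σ → PMF σ) : List β → σ → PMF σ
  | [], s => PMF.pure s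
  | u :: l, s => (K u s).bind (pfold K l)

theorem prob_piter_le {K : σ → PMF σ} {P : ℕ → σ → Prop} {η : ℝ≥0∞}
    (hK : ∀ t s, P t s → prob (K s) (fun s' => ¬ P (t + 1) s') ≤ η) (m t : ℕ) (s : σ)
    (hs : P t s) : prob (piter K m s) (fun s' => ¬ P (t + m) s') ≤ m * η := by
  induction m generalizing t s with
  | zero => simp [piter, prob, pexp_pure, hs]
  | succ m ih =>
    have := prob_bind_le (hK t s hs) (q := piter K m) (Q := P (t + 1 + m)) (η₂ := m * η)
      (fun a ha => ih (t + 1) a ha)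
    rw [show t + (m + 1) = t + 1 + m by omega]
    refine this.trans (le_of_eq ?_)
    push_cast; ring

/-- Invariants of a fold over all indices. -/
theorem pfold_finRange_support {n : ℕ} {K : Fin n → σ → PMF σ} {Inv : ℕ → σ → Prop}
    (hK : ∀ (u : Fin n) s, Inv u s → ∀ s' ∈ (K u s).support, Inv (u + 1) s') {s : σ}
    (hs : Inv 0 s) : ∀ s' ∈ (pfold K (List.finRange n) s).support, Inv n s' := by
  -- The suffix that starts at position `i` has the element `i` as its head, so the time index of
  -- the invariant agrees with the element treated.
  have key : ∀ (d i : ℕ), i + d = n → ∀ s, Inv i s →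
      ∀ s' ∈ (pfold K ((List.finRange n).drop i) s).support, Inv n s' := by
    intro d
    induction d with
    | zero =>
      intro i hi s hs s' hs'
      rw [List.drop_of_length_le (by simp; omega)] at hs'
      simp only [pfold, PMF.support_pure, Set.mem_singleton_iff] at hs'
      subst hs'
      rwa [← hi]
    | succ d ih =>
      intro i hi s hs s' hs'
      rw [List.drop_eq_getElem_cons (by simp; omega)] at hs'
      simp only [pfold, PMF.mem_support_bind_iff] at hs'
      obtain ⟨t, ht, hs'⟩ := hs'
      refine ih (i + 1) (by omega) t ?_ s' hs'
      have := hK _ s (by simpa using hs) t ht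
      simpa using this
  simpa using key n 0 (by omega) s hs

/-- A potential that drops by at most `e` in expectation in every step. -/
theorem pfold_finRange_pexp {n : ℕ} {K : Fin n → σ → PMF σ} {Inv : ℕ → σ → Prop}
    (hK : ∀ (u : Fin n) s, Inv u s → ∀ s' ∈ (K u s).support, Inv (u + 1) s') {h : σ → ℝ≥0∞}
    {e : ℝ≥0∞} (he : ∀ (u : Fin n) s, Inv u s → h s ≤ pexp (K u s) h + e) {s : σ}
    (hs : Inv 0 s) : h s ≤ pexp (pfold K (List.finRange n) s) h + n * e := by
  have key : ∀ (d i : ℕ), i + d = n → ∀ s, Inv i s →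
      h s ≤ pexp (pfold K ((List.finRange n).drop i) s) h + d * e := by
    intro d
    induction d with
    | zero =>
      intro i hi s hs
      rw [List.drop_of_length_le (by simp; omega)]
      simp [pfold, pexp_pure]
    | succ d ih =>
      intro i hi s hs
      rw [List.drop_eq_getElem_cons (by simp; omega)]
      simp only [pfold, pexp_bind]
      set u := (List.finRange n)[i]'(by simp; omega) with hu
      have hui : (u : ℕ) = i := by simp [hu]
      have h1 := he u s (by rwa [hui])
      refine h1.trans ?_
      have h2 : pexp (K u s) h ≤ pexp (K u s) (fun a =>
          pexp (pfold K ((List.finRange n).drop (i + 1)) a) h + d * e) := by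
        refine pexp_mono_support fun a ha => ih (i + 1) (by omega) a ?_
        have := hK u s (by rwa [hui]) a ha
        rwa [hui] at this
      rw [pexp_add, pexp_const] at h2
      refine (add_le_add_left h2 e).trans (le_of_eq ?_)
      push_cast; ring
  simpa using key n 0 (by omega) s hs

end Expectation

/-! ### Sampling with random integers -/

section Sampling

open scoped ENNReal

open Classical in
/-- An approximate Bernoulli variable: a uniformly random element of `{0, …, m}` is compared with
`θ * (m + 1)`. -/
def bern (m : ℕ) (θ : ℝ) : PMF Bool :=
  (PMF.uniformOfFintype (Fin (m + 1))).map fun v => decide (¬ θ * ((m : ℝ) + 1) ≤ (v.val : ℝ))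

/-- The success probability of `bern m θ`. -/
def bernProb (m : ℕ) (θ : ℝ) : ℝ := (bern m θ true).toReal

theorem bernProb_nonneg (m : ℕ) (θ : ℝ) : 0 ≤ bernProb m θ := ENNReal.toReal_nonneg

theorem bernProb_le_one (m : ℕ) (θ : ℝ) : bernProb m θ ≤ 1 :=
  ENNReal.toReal_le_of_le_ofReal zero_le_one (by simpa using (bern m θ).coe_le_one true)

theorem pexp_bern (m : ℕ) (θ : ℝ) (g : Bool → ℝ) (hg : ∀ b, 0 ≤ g b) :
    pexp (bern m θ) (fun b => ENNReal.ofReal (g b))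
      = ENNReal.ofReal (bernProb m θ * g true + (1 - bernProb m θ) * g false) := by
  have h1 : bern m θ true + bern m θ false = 1 := by
    have := (bern m θ).tsum_coe
    rwa [tsum_bool, add_comm] at this
  have ht : bern m θ true = ENNReal.ofReal (bernProb m θ) :=
    (ENNReal.ofReal_toReal ((bern m θ).apply_ne_top true)).symm
  have hf : bern m θ false = ENNReal.ofReal (1 - bernProb m θ) := by
    rw [ENNReal.ofReal_sub _ (bernProb_nonneg m θ), ← ht, ENNReal.ofReal_one, ← h1,
      ENNReal.add_sub_cancel_left ((bern m θ).apply_ne_top true)]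
  have h0 := bernProb_nonneg m θ
  have h2 := sub_nonneg.mpr (bernProb_le_one m θ)
  unfold pexp
  rw [tsum_bool, ht, hf, ← ENNReal.ofReal_mul h0, ← ENNReal.ofReal_mul h2,
    ← ENNReal.ofReal_add (mul_nonneg h2 (hg _)) (mul_nonneg h0 (hg _)), add_comm]

/-- Exactly ⌈θ(m + 1)⌉ of the m + 1 equally likely values lie strictly below θ(m + 1). -/
theorem abs_bernProb_sub_le (m : ℕ) {θ : ℝ} (h0 : 0 ≤ θ) (h1 : θ ≤ 1) :
    |bernProb m θ - θ| ≤ 1 / ((m : ℝ) + 1) := by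
  classical
  have hm : (0 : ℝ) < (m : ℝ) + 1 := by positivity
  have hb : bernProb m θ = (⌈θ * ((m : ℝ) + 1)⌉₊ : ℝ) / ((m : ℝ) + 1) := by
    have hc : ⌈θ * ((m : ℝ) + 1)⌉₊ ≤ m + 1 := by
      rw [Nat.ceil_le]; push_cast; nlinarith
    unfold bernProb bern
    rw [PMF.map_apply, tsum_fintype]
    simp only [PMF.uniformOfFintype_apply, Fintype.card_fin]
    rw [← Finset.sum_filter, Finset.sum_const]
    have : (Finset.univ.filter fun v : Fin (m + 1) =>
        true = decide (¬ θ * ((m : ℝ) + 1) ≤ (v.val : ℝ))).card = ⌈θ * ((m : ℝ) + 1)⌉₊ := by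
      have e : (Finset.univ.filter fun v : Fin (m + 1) =>
        true = decide (¬ θ * ((m : ℝ) + 1) ≤ (v.val : ℝ)))
        = Finset.univ.filter fun v : Fin (m + 1) => v.val < ⌈θ * ((m : ℝ) + 1)⌉₊ := by
        ext v
        simp [Nat.lt_ceil]
      rw [e, Fin.card_filter_val_lt, min_eq_right hc]
    rw [this, nsmul_eq_mul, ENNReal.toReal_mul, ENNReal.toReal_inv]
    simp only [ENNReal.toReal_natCast]
    push_cast
    rw [div_eq_mul_inv]
  rw [hb]
  have h2 := Nat.le_ceil (θ * ((m : ℝ) + 1))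
  have h3 := Nat.ceil_lt_add_one (mul_nonneg h0 hm.le)
  rw [abs_le]
  constructor
  · rw [le_sub_iff_add_le, le_div_iff₀ hm]
    have : 0 < 1 / ((m : ℝ) + 1) * ((m : ℝ) + 1) := by positivity
    nlinarith
  · rw [sub_le_iff_le_add, div_le_iff₀ hm, add_mul, div_mul_cancel₀ _ hm.ne']
    linarith

variable {α : Type*}

/-- The actual sampling probabilities. -/
def rounded (m : ℕ) (y : α → ℝ) : α → ℝ := fun u => bernProb m (y u)

theorem inCube_rounded (m : ℕ) (y : α → ℝ) : InCube (rounded m y) := fun _ =>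
  ⟨bernProb_nonneg _ _, bernProb_le_one _ _⟩

variable [DecidableEq α]

/-- Independent sampling along a list. -/
def sample (m : ℕ) (y : α → ℝ) : List α → Finset α → PMF (Finset α) :=
  pfold fun u S => (bern m (y u)).map fun b => if b then insert u S else S.erase u

theorem pexp_sample (m : ℕ) (y : α → ℝ) (l : List α) (S : Finset α) {g : Finset α → ℝ}
    (hg : ∀ S, 0 ≤ g S) :
    pexp (sample m y l S) (fun A => ENNReal.ofReal (g A))
      = ENNReal.ofReal (ml l (rounded m y) g S) := by
  induction l generalizing S with
  | nil => simp [sample, pfold, pexp_pure, ml]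
  | cons u l ih =>
    have h := fun S => ih S
    simp only [sample] at h
    simp only [sample, pfold, pexp_bind, pexp_map, h]
    rw [pexp_bern m (y u) (fun b => ml l (rounded m y) g (if b then insert u S else S.erase u))
      (fun b => ml_nonneg (inCube_rounded m y) hg _)]
    simp [ml, rounded]

/-- The second moment of a sum of independent samples. -/
theorem pexp_piter_sq {σ : Type*} {K : σ → PMF σ} {φ : σ → ℝ} {l : List α} {y : α → ℝ}
    (hy : InCube y) {h : Finset α → ℝ}
    (hK : ∀ (s : σ) (g : ℝ → ℝ), (∀ t, 0 ≤ g t) → pexp (K s) (fun s' => ENNReal.ofReal (g (φ s')))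
      = ENNReal.ofReal (ml l y (fun A => g (φ s + h A)) ∅)) (m : ℕ) (s : σ) (c : ℝ) :
    pexp (piter K m s) (fun s' => ENNReal.ofReal ((φ s' - c) ^ 2))
      = ENNReal.ofReal ((φ s + m * ml l y h ∅ - c) ^ 2
        + m * (ml l y (fun A => h A ^ 2) ∅ - ml l y h ∅ ^ 2)) := by
  -- The variance is nonnegative. This is needed because `hK` speaks of nonnegative test functions
  -- only.
  have hv : 0 ≤ ml l y (fun A => h A ^ 2) ∅ - ml l y h ∅ ^ 2 := by
    have := ml_nonneg (l := l) hy (f := fun A => (h A - ml l y h ∅) ^ 2) (fun _ => sq_nonneg _) ∅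
    have e : (fun A => (h A - ml l y h ∅) ^ 2)
      = fun A => (1 : ℝ) * (h A ^ 2) + 1 * ((-2 * ml l y h ∅) * h A + (ml l y h ∅ ^ 2) * 1) := by
      funext A; ring
    rw [e, ml_combo, ml_combo l y (-2 * ml l y h ∅) _ h (fun _ => 1), ml_const] at this
    linarith
  induction m generalizing s with
  | zero => simp [piter, pexp_pure]
  | succ m ih =>
    simp only [piter, pexp_bind, ih]
    rw [hK s (fun t => (t + m * ml l y h ∅ - c) ^ 2
        + m * (ml l y (fun A => h A ^ 2) ∅ - ml l y h ∅ ^ 2))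
        (fun t => add_nonneg (sq_nonneg _) (mul_nonneg (Nat.cast_nonneg _) hv))]
    congr 1
    set μ := ml l y h ∅
    set V := ml l y (fun A => h A ^ 2) ∅
    have e : (fun A => (φ s + h A + m * μ - c) ^ 2 + m * (V - μ ^ 2))
      = fun A => (1 : ℝ) * (h A ^ 2) + 1 * ((2 * (φ s + m * μ - c)) * h A
        + ((φ s + m * μ - c) ^ 2 + m * (V - μ ^ 2)) * 1) := by
      funext A; ring
    rw [e, ml_combo, ml_combo l y _ _ h (fun _ => 1), ml_const]
    push_cast
    ring

/-- Chebyshev's inequality for a sum of independent samples of `h : 2^α → [0, R]`. -/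
theorem prob_piter_sum_le {σ : Type*} {K : σ → PMF σ} {φ : σ → ℝ} {l : List α} {y : α → ℝ}
    (hy : InCube y) {h : Finset α → ℝ} {R : ℝ} (h0 : ∀ S, 0 ≤ h S) (hR : ∀ S, h S ≤ R)
    (hK : ∀ (s : σ) (g : ℝ → ℝ), (∀ t, 0 ≤ g t) → pexp (K s) (fun s' => ENNReal.ofReal (g (φ s')))
      = ENNReal.ofReal (ml l y (fun A => g (φ s + h A)) ∅)) {m : ℕ} {s : σ} (hs : φ s = 0)
    {δ ε : ℝ} (hδ : 0 < δ) (hε : R ^ 2 ≤ ε * (m * δ ^ 2)) (hm : 0 < m) :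
    prob (piter K m s) (fun s' => ¬ |φ s' - m * ml l y h ∅| ≤ m * δ) ≤ ENNReal.ofReal ε := by
  classical
  have h1 := pexp_piter_sq hy hK m s (m * ml l y h ∅)
  have hm' : (0 : ℝ) < m := by exact_mod_cast hm
  have hpos : (0 : ℝ) < (m * δ) ^ 2 := by positivity
  -- Markov's inequality for the squared deviation, whose expectation is at most m R².
  have h2 : prob (piter K m s) (fun s' => ¬ |φ s' - m * ml l y h ∅| ≤ m * δ)
      * ENNReal.ofReal ((m * δ) ^ 2) ≤ ENNReal.ofReal (ε * (m * δ) ^ 2) := by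
    unfold prob
    rw [← pexp_mul_right]
    calc _ ≤ pexp (piter K m s) (fun s' => ENNReal.ofReal ((φ s' - m * ml l y h ∅) ^ 2)) := by
          refine pexp_mono_support fun a _ => ?_
          by_cases hh : |φ a - m * ml l y h ∅| ≤ m * δ
          · simp [hh]
          · simp only [hh, not_false_eq_true, if_true, one_mul]
            refine ENNReal.ofReal_le_ofReal ?_
            rw [← sq_abs (φ a - _)]
            push Not at hh
            exact pow_le_pow_left₀ (by positivity) hh.le 2
      _ ≤ _ := by
          rw [h1, hs]
          refine ENNReal.ofReal_le_ofReal ?_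
          have h3 : ml l y (fun A => h A ^ 2) ∅ ≤ R ^ 2 :=
            ml_le hy (fun S => pow_le_pow_left₀ (h0 S) (hR S) 2) ∅
          have h4 := sq_nonneg (ml l y h ∅)
          nlinarith
  have hε0 : 0 ≤ ε := by
    by_contra hneg
    push Not at hneg
    have : 0 < (m : ℝ) * δ ^ 2 := by positivity
    nlinarith [sq_nonneg R]
  rw [ENNReal.ofReal_mul hε0] at h2
  exact (ENNReal.mul_le_mul_iff_left (by positivity) ENNReal.ofReal_ne_top).mp h2

end Sampling

end

noncomputable section

/-! ### The `k` elements of largest score -/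

section TopK

variable {n : ℕ}

/-- `v` precedes `u` in the order of decreasing scores, ties being broken by the index. -/
def Precedes (sc : Fin n → ℝ) (v u : Fin n) : Prop := sc u < sc v ∨ (sc u ≤ sc v ∧ v < u)

open Classical in
/-- The number of elements that precede `u`. -/
def rank (sc : Fin n → ℝ) (u : Fin n) : ℕ := (Finset.univ.filter fun v => Precedes sc v u).card

/-- The first `k` elements in the order of decreasing scores. -/
def topk (k : ℕ) (sc : Fin n → ℝ) : Finset (Fin n) :=
  Finset.univ.filter fun u => rank sc u < k

variable {sc : Fin n → ℝ}

theorem not_precedes_self (u : Fin n) : ¬ Precedes sc u u := by simp [Precedes]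

theorem Precedes.rank_lt {u v : Fin n} (h : Precedes sc v u) : rank sc v < rank sc u := by
  classical
  refine Finset.card_lt_card ?_
  rw [Finset.ssubset_iff_of_subset]
  · exact ⟨v, Finset.mem_filter.mpr ⟨Finset.mem_univ _, h⟩,
      fun hv => not_precedes_self v (Finset.mem_filter.mp hv).2⟩
  · intro w hw
    replace hw := (Finset.mem_filter.mp hw).2
    refine Finset.mem_filter.mpr ⟨Finset.mem_univ _, ?_⟩
    unfold Precedes at *
    rcases h with h | ⟨h, h'⟩ <;> rcases hw with hw | ⟨hw, hw'⟩
    · left; linarith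
    · left; linarith
    · left; linarith
    · right; exact ⟨by linarith, hw'.trans h'⟩

theorem precedes_or (u v : Fin n) (h : u ≠ v) : Precedes sc u v ∨ Precedes sc v u := by
  unfold Precedes
  rcases lt_trichotomy (sc u) (sc v) with h1 | h1 | h1
  · exact Or.inr (Or.inl h1)
  · rcases lt_or_gt_of_ne h with h2 | h2
    · exact Or.inl (Or.inr ⟨h1.ge, h2⟩)
    · exact Or.inr (Or.inr ⟨h1.le, h2⟩)
  · exact Or.inl (Or.inl h1)

theorem rank_injective : Function.Injective (rank sc) := fun u v h => by
  by_contra hne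
  rcases precedes_or (sc := sc) u v hne with h1 | h1
  · exact absurd h h1.rank_lt.ne
  · exact absurd h h1.rank_lt.ne'

theorem rank_lt (u : Fin n) : rank sc u < n := by
  classical
  calc rank sc u < (Finset.univ : Finset (Fin n)).card := by
        refine Finset.card_lt_card ?_
        rw [Finset.ssubset_iff_of_subset (Finset.subset_univ _)]
        exact ⟨u, Finset.mem_univ _, fun hu => not_precedes_self u (Finset.mem_filter.mp hu).2⟩
    _ = n := by simp

/-- Since ties are broken by the index, ranks are distinct; being below `n`, they form a bijection
onto `Fin n`. -/
theorem card_topk {k : ℕ} (hk : k ≤ n) : (topk k sc).card = k := by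
  have hbij : Function.Bijective fun u : Fin n => (⟨rank sc u, rank_lt u⟩ : Fin n) := by
    rw [Fintype.bijective_iff_injective_and_card]
    exact ⟨fun u v h => rank_injective (by simpa using h), rfl⟩
  have h1 : (topk k sc).card = (Finset.univ.filter fun i : Fin n => i.val < k).card := by
    refine Finset.card_bij (fun u _ => ⟨rank sc u, rank_lt u⟩) ?_ ?_ ?_
    · intro u hu; simpa [topk] using hu
    · intro u _ v _ h; exact hbij.1 h
    · intro i hi
      obtain ⟨u, hu⟩ := hbij.2 i
      refine ⟨u, ?_, hu⟩
      subst hu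
      simpa [topk] using hi
  rw [h1, Fin.card_filter_val_lt, min_eq_right hk]

theorem le_of_mem_topk {k : ℕ} {u v : Fin n} (hu : u ∈ topk k sc) (hv : v ∉ topk k sc) :
    sc v ≤ sc u := by
  by_contra! h
  have h1 : Precedes sc v u := Or.inl h
  have h2 := h1.rank_lt
  simp only [topk, Finset.mem_filter, Finset.mem_univ, true_and] at hu hv
  omega

/-- Exchange argument: `M \ O` and `O \ M` have the same size, and every score in the first is at
least every score in the second. -/
theorem sum_le_sum_topk {k : ℕ} (hk : k ≤ n) {O : Finset (Fin n)} (hO : O.card = k) :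
    ∑ u ∈ O, sc u ≤ ∑ u ∈ topk k sc, sc u := by
  set M := topk k sc with hM
  have hc : (M \ O).card = (O \ M).card := by
    rw [Finset.card_sdiff_comm]; rw [hM, card_topk hk, hO]
  rw [← Finset.sum_inter_add_sum_sdiff O M, ← Finset.sum_inter_add_sum_sdiff M O,
    Finset.inter_comm O M]
  refine add_le_add_right ?_ _
  rcases (O \ M).eq_empty_or_nonempty with h | h
  · rw [h, Finset.card_empty, Finset.card_eq_zero] at hc
    rw [h, hc]
  · obtain ⟨v, hv, hmax⟩ := Finset.exists_max_image _ sc h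
    calc ∑ u ∈ O \ M, sc u ≤ (O \ M).card • sc v := Finset.sum_le_card_nsmul _ _ _ hmax
      _ = (M \ O).card • sc v := by rw [hc]
      _ ≤ _ := Finset.card_nsmul_le_sum _ _ _ fun u hu =>
        le_of_mem_topk (Finset.mem_sdiff.mp hu).1 (Finset.mem_sdiff.mp hv).2

end TopK

/-! ### One step of the continuous process -/

section Step

variable {n : ℕ}

/-- The multilinear extension over all of `Fin n`. -/
def mext (f : Finset (Fin n) → ℝ) (y : Fin n → ℝ) : ℝ := ml (List.finRange n) y f ∅

/-- The increase of `f` in expectation when `u` is inserted into a random set. -/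
def gainIns (f : Finset (Fin n) → ℝ) (y : Fin n → ℝ) (u : Fin n) : ℝ :=
  mext (ins u f) y - mext f y

/-- The increase of `f` in expectation when `u` is erased from a random set. -/
def gainDel (f : Finset (Fin n) → ℝ) (x : Fin n → ℝ) (u : Fin n) : ℝ :=
  mext (del u f) x - mext f x

theorem sum_finRange (g : Fin n → ℝ) : ((List.finRange n).map g).sum = ∑ u, g u :=
  (Fin.sum_univ_def g).symm

theorem mext_split (f : Finset (Fin n) → ℝ) (y : Fin n → ℝ) (u : Fin n) :
    mext f y = y u * mext (ins u f) y + (1 - y u) * mext (del u f) y :=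
  ml_split (List.nodup_finRange n) (List.mem_finRange u) y f ∅

/-- Up to the factor 1 - y u, the gain is a partial derivative. This is why y u moves by (1 - y u)δ:
to first order, F then changes by exactly δ times the gain. -/
theorem gainIns_eq (f : Finset (Fin n) → ℝ) (y : Fin n → ℝ) (u : Fin n) :
    gainIns f y u = (1 - y u) * (mext (ins u f) y - mext (del u f) y) := by
  rw [gainIns, mext_split f y u]; ring

theorem gainDel_eq (f : Finset (Fin n) → ℝ) (x : Fin n → ℝ) (u : Fin n) :
    gainDel f x u = -(x u * (mext (ins u f) x - mext (del u f) x)) := by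
  rw [gainDel, mext_split f x u]; ring

variable {f : Finset (Fin n) → ℝ}

/-- The function S ↦ f(S ∪ O) has the value f(O) at ∅, and sampling keeps the fraction `τ` of it.
Joining `O` in turn increases f by at most the sum of the single insertions. -/
theorem le_add_sum_gainIns (hf : IsSubmodular f) (h0 : ∀ S, 0 ≤ f S) {y : Fin n → ℝ}
    (hy : InCube y) {τ : ℝ} (hτ : 0 ≤ τ) (hτ1 : τ ≤ 1) (hyτ : ∀ u, y u ≤ 1 - τ)
    (O : Finset (Fin n)) : τ * f O ≤ mext f y + ∑ u ∈ O, gainIns f y u := by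
  have h1 := le_ml_of_le (l := List.finRange n) hy hyτ (by linarith) (by linarith)
    (hf.union_right O) (fun S => h0 _)
  have h2 := ml_mono (l := List.finRange n) hy (fun A => sub_le_iff_le_add.mp (hf.le_sum_insert A O)) ∅
  rw [ml_add, ml_sum] at h2
  have h3 : ∀ u, ml (List.finRange n) y (fun A => f (insert u A) - f A) ∅ = gainIns f y u :=
    fun u => ml_sub _ _ (ins u f) f ∅
  simp only [h3] at h2
  simp only [Finset.empty_union, sub_sub_cancel] at h1
  unfold mext
  linarith

/-- The mirror image: intersecting with `O` amounts to erasing `Oᶜ`, and S ↦ f(S ∩ O) has the value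
f(O) at the full set. -/
theorem le_add_sum_gainDel (hf : IsSubmodular f) (h0 : ∀ S, 0 ≤ f S) {x : Fin n → ℝ}
    (hx : InCube x) {τ : ℝ} (hτ : 0 ≤ τ) (hτ1 : τ ≤ 1) (hxτ : ∀ u, τ ≤ x u)
    (O : Finset (Fin n)) : τ * f O ≤ mext f x + ∑ u ∈ Oᶜ, gainDel f x u := by
  have h1 := le_ml_of_ge (List.nodup_finRange n) hx hxτ hτ hτ1
    (hf.inter_right O) (fun S => h0 _)
  have h2 := ml_mono (l := List.finRange n) hx
    (fun A => sub_le_iff_le_add.mp (hf.le_sum_erase A Oᶜ)) ∅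
  rw [ml_add, ml_sum] at h2
  have h3 : ∀ u, ml (List.finRange n) x (fun A => f (A.erase u) - f A) ∅ = gainDel f x u :=
    fun u => ml_sub _ _ (del u f) f ∅
  simp only [h3] at h2
  have h4 : (fun A : Finset (Fin n) => f (A \ Oᶜ)) = fun A => f (A ∩ O) := by
    funext A; congr 1; ext; simp
  rw [h4] at h2
  have h5 : (List.finRange n).toFinset = Finset.univ := by ext; simp
  rw [h5, Finset.univ_inter] at h1
  unfold mext
  linarith

/-- Truncation to `[0, 1]`. -/
def clip (t : ℝ) : ℝ := open Classical in if t ≤ 0 then 0 else if 1 ≤ t then 1 else t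

theorem clip_mem (t : ℝ) : 0 ≤ clip t ∧ clip t ≤ 1 := by
  unfold clip; split_ifs <;> constructor <;> linarith

/-- Projection to the unit interval does not increase the distance to either end point, so clipping
the weight never costs potential. -/
theorem clip_sq_le (t : ℝ) : clip t ^ 2 ≤ t ^ 2 := by
  unfold clip; split_ifs <;> nlinarith

theorem one_sub_clip_sq_le (t : ℝ) : (1 - clip t) ^ 2 ≤ (1 - t) ^ 2 := by
  unfold clip; split_ifs <;> nlinarith

/-- The combined value of a set chosen greedily with respect to approximate gains. -/
theorem le_combined (hf : IsSubmodular f) (h0 : ∀ S, 0 ≤ f S) {y x : Fin n → ℝ}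
    (hy : InCube y) (hx : InCube x) {τ : ℝ} (hτ : 0 ≤ τ) (hτ1 : τ ≤ 1)
    (hyτ : ∀ u, y u ≤ 1 - τ) (hxτ : ∀ u, τ ≤ x u) {lam : ℝ} (hlam : 0 ≤ lam) (hlam1 : lam ≤ 1)
    {k : ℕ} (hk : k ≤ n) {O : Finset (Fin n)} (hO : O.card = k) {wa wb : Fin n → ℝ} {e : ℝ}
    (ha : ∀ u, |wa u - gainIns f y u| ≤ e) (hb : ∀ u, |wb u - gainDel f x u| ≤ e)
    {M : Finset (Fin n)} (hM : M.card = k)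
    (hMO : ∑ u ∈ O, (lam * wa u - (1 - lam) * wb u) ≤ ∑ u ∈ M, (lam * wa u - (1 - lam) * wb u)) :
    τ * f O - 2 * n * e ≤ lam * (mext f y + ∑ u ∈ M, gainIns f y u)
      + (1 - lam) * (mext f x + ∑ u ∈ Mᶜ, gainDel f x u) := by
  have h1 := le_add_sum_gainIns hf h0 hy hτ hτ1 hyτ O
  have h2 := le_add_sum_gainDel hf h0 hx hτ hτ1 hxτ O
  -- The sum of all deletion gains does not depend on the set, so maximizing over complements means
  -- subtracting the deletion gain from the score.
  have hcompl : ∀ S : Finset (Fin n), ∑ u ∈ Sᶜ, gainDel f x u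
      = ∑ u, gainDel f x u - ∑ u ∈ S, gainDel f x u := fun S => by
    rw [← Finset.sum_add_sum_compl S]; ring
  rw [hcompl] at h2 ⊢
  have key : ∀ u, |(lam * wa u - (1 - lam) * wb u)
      - (lam * gainIns f y u - (1 - lam) * gainDel f x u)| ≤ e := fun u => by
    have h3 := abs_le.mp (ha u)
    have h4 := abs_le.mp (hb u)
    rw [abs_le]; constructor <;> nlinarith
  -- For `n = 0` the hypotheses do not determine the sign of `e`, but then `k = 0`.
  have he : 0 ≤ k * e ∧ k * e ≤ n * e := by
    rcases Nat.eq_zero_or_pos n with hn | hn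
    · subst hn
      have : k = 0 := by omega
      subst this; simp
    · have := (abs_nonneg _).trans (key ⟨0, hn⟩)
      exact ⟨by positivity, mul_le_mul_of_nonneg_right (by exact_mod_cast hk) this⟩
  have hsum : ∀ S : Finset (Fin n), S.card = k → |∑ u ∈ S, (lam * wa u - (1 - lam) * wb u)
      - (lam * ∑ u ∈ S, gainIns f y u - (1 - lam) * ∑ u ∈ S, gainDel f x u)| ≤ k * e := by
    intro S hS
    rw [Finset.mul_sum, Finset.mul_sum, ← Finset.sum_sub_distrib, ← Finset.sum_sub_distrib]
    refine (Finset.abs_sum_le_sum_abs _ _).trans ?_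
    refine (Finset.sum_le_card_nsmul _ _ e fun u _ => key u).trans ?_
    rw [hS, nsmul_eq_mul]
  have h5 := abs_le.mp (hsum O hO)
  have h6 := abs_le.mp (hsum M hM)
  have h7 := mul_le_mul_of_nonneg_left h1 hlam
  have h8 := mul_le_mul_of_nonneg_left h2 (sub_nonneg.mpr hlam1)
  nlinarith

theorem mext_taylor {y y' : Fin n → ℝ} (hy : InCube y) (hy' : InCube y') {c : ℝ}
    (hf : OscLE f c) : |mext f y' - mext f y
      - ∑ u, (y' u - y u) * (mext (ins u f) y - mext (del u f) y)|
      ≤ 2 * c * (∑ u, |y' u - y u|) ^ 2 := by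
  have := ml_taylor (List.nodup_finRange n) hy hy' hf ∅
  rwa [sum_finRange, sum_finRange] at this

/-- The move of the lower point. -/
def raisePt (M : Finset (Fin n)) (δ : ℝ) (y : Fin n → ℝ) : Fin n → ℝ :=
  fun u => if u ∈ M then y u + (1 - y u) * δ else y u

/-- The move of the upper point. -/
def lowerPt (M : Finset (Fin n)) (δ : ℝ) (x : Fin n → ℝ) : Fin n → ℝ :=
  fun u => if u ∈ M then x u else x u - x u * δ

theorem inCube_raise (M : Finset (Fin n)) {δ : ℝ} (h0 : 0 ≤ δ) (h1 : δ ≤ 1) {y : Fin n → ℝ}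
    (hy : InCube y) : InCube (raisePt M δ y) := fun u => by
  have := hy u
  unfold raisePt; split_ifs
  · constructor <;> nlinarith
  · exact this

theorem inCube_lower (M : Finset (Fin n)) {δ : ℝ} (h0 : 0 ≤ δ) (h1 : δ ≤ 1) {x : Fin n → ℝ}
    (hx : InCube x) : InCube (lowerPt M δ x) := fun u => by
  have := hx u
  unfold lowerPt; split_ifs
  · exact this
  · constructor <;> nlinarith

theorem sum_abs_le {δ : ℝ} {y y' : Fin n → ℝ} (h : ∀ u, |y' u - y u| ≤ δ) :
    (∑ u, |y' u - y u|) ^ 2 ≤ (n * δ) ^ 2 := by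
  refine pow_le_pow_left₀ (Finset.sum_nonneg fun u _ => abs_nonneg _) ?_ 2
  refine (Finset.sum_le_card_nsmul _ _ δ fun u _ => h u).trans ?_
  simp

/-- The linear term of the expansion is `δ` times the gains by `gainIns_eq`, and the total
displacement in the remainder is at most nδ. -/
theorem le_mext_raise {R : ℝ} (hR : OscLE f R) (M : Finset (Fin n)) {δ : ℝ} (h0 : 0 ≤ δ)
    (h1 : δ ≤ 1) {y : Fin n → ℝ} (hy : InCube y) :
    mext f y + δ * ∑ u ∈ M, gainIns f y u - 2 * R * (n * δ) ^ 2 ≤ mext f (raisePt M δ y) := by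
  have ht := abs_le.mp (mext_taylor hy (inCube_raise M h0 h1 hy) hR)
  have e1 : ∑ u, (raisePt M δ y u - y u) * (mext (ins u f) y - mext (del u f) y)
      = δ * ∑ u ∈ M, gainIns f y u := by
    rw [Finset.mul_sum, ← Finset.sum_subset (Finset.subset_univ M)]
    · refine Finset.sum_congr rfl fun u hu => ?_
      rw [gainIns_eq, raisePt, if_pos hu]; ring
    · intro u _ hu
      rw [raisePt, if_neg hu]; ring
  have e2 := sum_abs_le (δ := δ) (y := y) (y' := raisePt M δ y) fun u => by
    have := hy u
    unfold raisePt; split_ifs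
    · rw [add_sub_cancel_left, abs_le]; constructor <;> nlinarith
    · simpa using h0
  have := mul_le_mul_of_nonneg_left e2 (mul_nonneg zero_le_two hR.nonneg)
  rw [e1] at ht
  linarith

theorem le_mext_lower {R : ℝ} (hR : OscLE f R) (M : Finset (Fin n)) {δ : ℝ} (h0 : 0 ≤ δ)
    (h1 : δ ≤ 1) {x : Fin n → ℝ} (hx : InCube x) :
    mext f x + δ * ∑ u ∈ Mᶜ, gainDel f x u - 2 * R * (n * δ) ^ 2 ≤ mext f (lowerPt M δ x) := by
  have ht := abs_le.mp (mext_taylor hx (inCube_lower M h0 h1 hx) hR)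
  have e1 : ∑ u, (lowerPt M δ x u - x u) * (mext (ins u f) x - mext (del u f) x)
      = δ * ∑ u ∈ Mᶜ, gainDel f x u := by
    rw [Finset.mul_sum, ← Finset.sum_subset (Finset.subset_univ Mᶜ)]
    · refine Finset.sum_congr rfl fun u hu => ?_
      rw [gainDel_eq, lowerPt, if_neg (Finset.mem_compl.mp hu)]; ring
    · intro u _ hu
      rw [lowerPt, if_pos (by simpa using hu)]; ring
  have e2 := sum_abs_le (δ := δ) (y := x) (y' := lowerPt M δ x) fun u => by
    have := hx u
    unfold lowerPt; split_ifs
    · simpa using h0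
    · rw [sub_sub_cancel_left, abs_neg, abs_le]; constructor <;> nlinarith
  have := mul_le_mul_of_nonneg_left e2 (mul_nonneg zero_le_two hR.nonneg)
  rw [e1] at ht
  linarith

/-- The arithmetic of one step: `v₁`, `v₂` are the combined slopes of the two points, `g` is the
estimate of their difference that drives the weight `lam`. -/
theorem step_arith {δ R h lam g v₁ v₂ C e₁ e₂ B : ℝ} (hδ : 0 ≤ δ)
    (hR : 0 < R) (hh : 0 < h) (hlam : 0 ≤ lam) (hlam1 : lam ≤ 1)
    (hcomb : C - e₁ ≤ lam * v₁ + (1 - lam) * v₂) (hg : |g - (v₁ - v₂)| ≤ e₂) (hB : |g| ≤ B * R) :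
    δ * R / (2 * h) * (1 - clip (lam - h * g / R)) ^ 2 - δ * R / (2 * h) * (1 - lam) ^ 2
        + δ * C - δ * (e₁ + e₂ + h * B ^ 2 * R / 2) ≤ δ * v₁ ∧
    δ * R / (2 * h) * clip (lam - h * g / R) ^ 2 - δ * R / (2 * h) * lam ^ 2
        + δ * C - δ * (e₁ + e₂ + h * B ^ 2 * R / 2) ≤ δ * v₂ := by
  have hg' := abs_le.mp hg
  have hB2 : g ^ 2 ≤ (B * R) ^ 2 := sq_le_sq' (abs_le.mp hB).1 (abs_le.mp hB).2
  have hc : 0 ≤ δ * R / (2 * h) := by positivity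
  have he : 0 ≤ e₂ := (abs_nonneg _).trans hg
  -- The identities v₁ = lam v₁ + (1 - lam) v₂ + (1 - lam)(v₁ - v₂) and v₂ = lam v₁ + (1 - lam) v₂ -
  -- lam (v₁ - v₂) separate the slopes. When the squares in the potentials are expanded, the linear
  -- terms are (1 - lam)δg and -lam δg, exactly the extra terms with `g` for v₁ - v₂; the quadratic
  -- term bounded here remains as a loss.
  have hq : δ * R / (2 * h) * (h * g / R) ^ 2 ≤ δ * (h * B ^ 2 * R / 2) := by
    have e : δ * R / (2 * h) * (h * g / R) ^ 2 = δ * h / (2 * R) * g ^ 2 := by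
      field_simp
    rw [e]
    refine (mul_le_mul_of_nonneg_left hB2 (by positivity)).trans (le_of_eq ?_)
    field_simp
  have hq2 : δ * R / (2 * h) * (2 * (h * g / R)) = δ * g := by field_simp
  constructor
  · have h1 := mul_le_mul_of_nonneg_left (one_sub_clip_sq_le (lam - h * g / R)) hc
    have h2 : δ * R / (2 * h) * (1 - (lam - h * g / R)) ^ 2 = δ * R / (2 * h) * (1 - lam) ^ 2
        + (1 - lam) * (δ * g) + δ * R / (2 * h) * (h * g / R) ^ 2 := by
      rw [← hq2]; ring
    have h3 : δ * (C - e₁ + (1 - lam) * g - e₂) ≤ δ * v₁ :=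
      mul_le_mul_of_nonneg_left (by nlinarith) hδ
    nlinarith
  · have h1 := mul_le_mul_of_nonneg_left (clip_sq_le (lam - h * g / R)) hc
    have h2 : δ * R / (2 * h) * (lam - h * g / R) ^ 2 = δ * R / (2 * h) * lam ^ 2
        - lam * (δ * g) + δ * R / (2 * h) * (h * g / R) ^ 2 := by
      rw [← hq2]; ring
    have h3 : δ * (C - e₁ - lam * g - e₂) ≤ δ * v₂ :=
      mul_le_mul_of_nonneg_left (by nlinarith) hδ
    nlinarith

end Step

end

noncomputable section

/-! ### Pipage rounding -/

section Pipage

open scoped ENNReal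

theorem ml_integral {α : Type*} [DecidableEq α] (l : List α) {y : α → ℝ}
    (hy : ∀ u, y u = 0 ∨ y u = 1) (f : Finset α → ℝ) (S : Finset α) :
    ml l y f S = f ((S \ l.toFinset) ∪ l.toFinset.filter fun u => 1 ≤ y u) := by
  induction l generalizing S with
  | nil => simp [ml]
  | cons v l ih =>
    simp only [ml, ih]
    rcases hy v with h | h
    · have e : S.erase v \ l.toFinset ∪ l.toFinset.filter (fun u => 1 ≤ y u)
          = S \ (v :: l).toFinset ∪ (v :: l).toFinset.filter fun u => 1 ≤ y u := by
        ext u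
        rcases eq_or_ne u v with rfl | huv
        · simp [h]
        · simp [huv]
      rw [h, e]; ring
    · have e : insert v S \ l.toFinset ∪ l.toFinset.filter (fun u => 1 ≤ y u)
          = S \ (v :: l).toFinset ∪ (v :: l).toFinset.filter fun u => 1 ≤ y u := by
        ext u
        rcases eq_or_ne u v with rfl | huv
        · by_cases hu : u ∈ l <;> simp [h, hu]
        · simp [huv]
      rw [h, e]; ring

variable {n : ℕ}

/-- A fractional solution together with the index of the coordinate that may be fractional among
those treated so far. -/
structure Carried (n : ℕ) where
  p : Fin n → ℝ
  c : Fin n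

open Classical in
/-- Replace the two coordinates `c` and `j`. -/
def Carried.set (s : Carried n) (j : Fin n) (a b : ℝ) : Carried n where
  p := Function.update (Function.update s.p s.c a) j b
  c := if a ≤ 0 ∨ 1 ≤ a then j else s.c

open Classical in
/-- The smallest value that a coordinate can be given when two coordinates have sum `t`. -/
def loVal (t : ℝ) : ℝ := if t ≤ 1 then 0 else t - 1

open Classical in
/-- The largest value that a coordinate can be given when two coordinates have sum `t`. -/
def hiVal (t : ℝ) : ℝ := if t ≤ 1 then t else 1

/-- Make one of the coordinates `c`, `j` integral. -/
def pipStep (m : ℕ) (j : Fin n) (s : Carried n) : PMF (Carried n) :=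
  if 1 ≤ j.val then
    let t := s.p s.c + s.p j
    (bern m ((s.p s.c - loVal t) / (hiVal t - loVal t))).map fun b =>
      if b then s.set j (hiVal t) (loVal t) else s.set j (loVal t) (hiVal t)
  else PMF.pure s

/-- The set of coordinates that have been rounded up. -/
def Carried.out (s : Carried n) : Finset (Fin n) := Finset.univ.filter fun u => 1 ≤ s.p u

/-- The invariant of pipage rounding. -/
structure PipInv (k j : ℕ) (s : Carried n) : Prop where
  cube : InCube s.p
  sum_eq : ∑ u, s.p u = k
  carry : s.c.val < j ∨ s.c.val = 0
  integral : ∀ u : Fin n, u.val < j → u ≠ s.c → s.p u = 0 ∨ s.p u = 1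

theorem lo_hi {t : ℝ} : loVal t + hiVal t = t ∧ (loVal t = 0 ∨ hiVal t = 1) := by
  unfold loVal hiVal
  split_ifs <;> constructor <;> simp

theorem lo_hi_mem {a b : ℝ} (ha : 0 ≤ a ∧ a ≤ 1) (hb : 0 ≤ b ∧ b ≤ 1) :
    0 ≤ loVal (a + b) ∧ hiVal (a + b) ≤ 1 ∧ loVal (a + b) ≤ a ∧ loVal (a + b) ≤ b := by
  unfold loVal hiVal
  split_ifs <;> refine ⟨?_, ?_, ?_, ?_⟩ <;> linarith

theorem sum_update_update {p : Fin n → ℝ} {i j : Fin n} (hij : i ≠ j) {a b : ℝ}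
    (h : a + b = p i + p j) :
    ∑ u, Function.update (Function.update p i a) j b u = ∑ u, p u := by
  rw [Finset.sum_update_of_mem (Finset.mem_univ j),
    Finset.sum_update_of_mem (by simpa using hij),
    ← Finset.add_sum_erase _ p (Finset.mem_univ j),
    ← Finset.add_sum_erase (Finset.univ.erase j) p (by simpa using hij)]
  have : (Finset.univ \ {j}) \ {i} = (Finset.univ.erase j).erase i := by
    ext; simp [and_comm]
  rw [this]
  linarith

/-- If `a` is integral, the old carried coordinate is settled and `j` takes over. If not, `hint`
makes `b` integral, so `j` is settled and the old coordinate stays carried. -/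
theorem PipInv.set {k : ℕ} {j : Fin n} {s : Carried n} (hs : PipInv k j s) (hj : s.c ≠ j)
    {a b : ℝ} (ha : 0 ≤ a ∧ a ≤ 1) (hb : 0 ≤ b ∧ b ≤ 1) (hab : a + b = s.p s.c + s.p j)
    (hint : (a = 0 ∨ a = 1) ∨ (b = 0 ∨ b = 1)) : PipInv k (j + 1) (s.set j a b) where
  cube u := by
    simp only [Carried.set, Function.update_apply]
    split_ifs
    · exact hb
    · exact ha
    · exact hs.cube u
  sum_eq := by
    simp only [Carried.set]
    rw [sum_update_update hj hab, hs.sum_eq]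
  carry := by
    simp only [Carried.set]
    split_ifs
    · left; omega
    · rcases hs.carry with h | h <;> left <;> omega
  integral u hu hne := by
    simp only [Carried.set] at hne ⊢
    by_cases h : a ≤ 0 ∨ 1 ≤ a
    · rw [if_pos h] at hne
      rw [Function.update_of_ne hne]
      have hlt : u.val < j.val := by
        have : u.val ≠ j.val := fun h => hne (Fin.ext h)
        omega
      by_cases huc : u = s.c
      · subst huc
        rw [Function.update_self]
        rcases h with h | h
        · left; linarith
        · right; linarith
      · rw [Function.update_of_ne huc]
        exact hs.integral u hlt huc
    · rw [if_neg h] at hne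
      push Not at h
      by_cases huj : u = j
      · subst huj
        rw [Function.update_self]
        rcases hint with (h1 | h1) | h1
        · linarith
        · linarith
        · exact h1
      · rw [Function.update_of_ne huj, Function.update_of_ne hne]
        have : u.val ≠ j.val := fun h => huj (Fin.ext h)
        exact hs.integral u (by omega) hne

theorem PipInv.ne {k : ℕ} {j : Fin n} {s : Carried n} (hs : PipInv k j s) (hj : 1 ≤ j.val) :
    s.c ≠ j := fun h => by
  have := hs.carry
  rw [h] at this
  omega

theorem PipInv.step {k m : ℕ} (j : Fin n) (s : Carried n) (hs : PipInv k j s) :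
    ∀ s' ∈ (pipStep m j s).support, PipInv k (j + 1) s' := by
  intro s' hs'
  unfold pipStep at hs'
  split_ifs at hs' with hj
  · have hne := hs.ne hj
    obtain ⟨h1, h2, h3, h4⟩ := lo_hi_mem (hs.cube s.c) (hs.cube j)
    obtain ⟨h5, h6⟩ := lo_hi (t := s.p s.c + s.p j)
    have := hs.cube s.c
    have := hs.cube j
    simp only [PMF.mem_support_map_iff] at hs'
    obtain ⟨b, -, rfl⟩ := hs'
    split_ifs
    · exact hs.set hne ⟨by linarith, by linarith⟩ ⟨by linarith, by linarith⟩ (by linarith)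
        (h6.symm.imp Or.inr Or.inl)
    · exact hs.set hne ⟨by linarith, by linarith⟩ ⟨by linarith, by linarith⟩ (by linarith)
        (h6.imp Or.inl Or.inr)
  · simp only [PMF.support_pure, Set.mem_singleton_iff] at hs'
    subst hs'
    -- Here `j` is the index 0, which is itself the carried coordinate, so there is nothing to round
    -- yet.
    have hc := hs.carry
    refine ⟨hs.cube, hs.sum_eq, by omega, fun u hu hne => ?_⟩
    exact absurd (Fin.ext (by omega)) hne

/-- With the sum of two coordinates fixed, their product is concave and its coefficient `c₃` is
nonpositive, so F is convex on this line. The two outcomes are the ends of the admissible segment,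
and with the exact probability θ the point is preserved in expectation, so F does not drop on
average. Replacing θ by the probability realized with random integers costs at most R/(m + 1). -/
theorem le_pexp_pipStep {k m : ℕ} {f : Finset (Fin n) → ℝ} (hf : IsSubmodular f)
    (h0 : ∀ S, 0 ≤ f S) {R : ℝ} (hR : ∀ S, f S ≤ R) (j : Fin n) (s : Carried n)
    (hs : PipInv k j s) :
    ENNReal.ofReal (mext f s.p) ≤ pexp (pipStep m j s) (fun s => ENNReal.ofReal (mext f s.p))
      + ENNReal.ofReal (R / ((m : ℝ) + 1)) := by
  unfold pipStep
  split_ifs with hj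
  swap
  · rw [pexp_pure]; exact le_self_add
  have hne := hs.ne hj
  obtain ⟨c₀, c₁, c₂, c₃, hc₃, hG⟩ := ml_update_update (List.nodup_finRange n)
    (List.mem_finRange s.c) (List.mem_finRange j) hne hs.cube hf ∅
  have hR0 : 0 ≤ R := (h0 ∅).trans (hR ∅)
  obtain ⟨h1, h2, h3, h4⟩ := lo_hi_mem (hs.cube s.c) (hs.cube j)
  obtain ⟨h5, h6⟩ := lo_hi (t := s.p s.c + s.p j)
  have hc := hs.cube s.c
  have hj' := hs.cube j
  have hself : Function.update (Function.update s.p s.c (s.p s.c)) j (s.p j) = s.p := by simp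
  set t := s.p s.c + s.p j
  set lo := loVal t
  set hi := hiVal t
  set θ := (s.p s.c - lo) / (hi - lo) with hθ
  have hθ0 : 0 ≤ θ ∧ θ ≤ 1 := by
    constructor
    · exact div_nonneg (by linarith) (by linarith)
    · exact div_le_one_of_le₀ (by linarith) (by linarith)
  -- If the extreme values coincide, the quotient is 0 by convention, and the coordinate already
  -- equals `lo`.
  have hθe : θ * (hi - lo) = s.p s.c - lo := by
    rcases eq_or_ne (hi - lo) 0 with h | h
    · rw [h, mul_zero]; linarith
    · rw [hθ, div_mul_cancel₀ _ h]
  simp only [pexp_map]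
  have hnn : ∀ b : Bool, 0 ≤ mext f (if b then s.set j hi lo else s.set j lo hi).p := by
    intro b
    refine ml_nonneg ?_ h0 ∅
    intro u
    cases b
    · simp only [Bool.false_eq_true, if_false, Carried.set, Function.update_apply]
      split_ifs
      · constructor <;> linarith
      · constructor <;> linarith
      · exact hs.cube u
    · simp only [if_true, Carried.set, Function.update_apply]
      split_ifs
      · constructor <;> linarith
      · constructor <;> linarith
      · exact hs.cube u
  have hle : ∀ b : Bool, mext f (if b then s.set j hi lo else s.set j lo hi).p ≤ R := by
    intro b
    refine ml_le ?_ hR ∅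
    intro u
    cases b
    · simp only [Bool.false_eq_true, if_false, Carried.set, Function.update_apply]
      split_ifs
      · constructor <;> linarith
      · constructor <;> linarith
      · exact hs.cube u
    · simp only [if_true, Carried.set, Function.update_apply]
      split_ifs
      · constructor <;> linarith
      · constructor <;> linarith
      · exact hs.cube u
  rw [pexp_bern m θ (fun b => mext f (if b then s.set j hi lo else s.set j lo hi).p) hnn]
  have hm : 0 ≤ R / ((m : ℝ) + 1) := by positivity
  have hρ := abs_le.mp (abs_bernProb_sub_le m hθ0.1 hθ0.2)
  have hρ0 := bernProb_nonneg m θ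
  have hρ1 := bernProb_le_one m θ
  have hA0 := hnn true
  have hA1 := hle true
  have hB0 := hnn false
  have hB1 := hle false
  rw [← ENNReal.ofReal_add (add_nonneg (mul_nonneg hρ0 hA0)
    (mul_nonneg (sub_nonneg.mpr hρ1) hB0)) hm]
  refine ENNReal.ofReal_le_ofReal ?_
  have eA : mext f (if true then s.set j hi lo else s.set j lo hi).p
    = c₀ + c₁ * hi + c₂ * lo + c₃ * (hi * lo) := hG hi lo
  have eB : mext f (if false then s.set j hi lo else s.set j lo hi).p
    = c₀ + c₁ * lo + c₂ * hi + c₃ * (lo * hi) := hG lo hi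
  have eC : mext f s.p = c₀ + c₁ * s.p s.c + c₂ * s.p j + c₃ * (s.p s.c * s.p j) := by
    rw [← hG, hself]; rfl
  set A := mext f (if true then s.set j hi lo else s.set j lo hi).p
  set B := mext f (if false then s.set j hi lo else s.set j lo hi).p
  have k1 : mext f s.p ≤ θ * A + (1 - θ) * B := by
    have e1 : θ * A + (1 - θ) * B = c₀ + c₁ * s.p s.c + c₂ * s.p j + c₃ * (hi * lo) := by
      rw [eA, eB]
      have hpj : s.p j = hi - θ * (hi - lo) := by linarith
      have hpc : s.p s.c = lo + θ * (hi - lo) := by linarith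
      rw [hpc, hpj]; ring
    rw [e1, eC]
    have : hi * lo ≤ s.p s.c * s.p j := by
      have := mul_nonneg (sub_nonneg.mpr h3) (sub_nonneg.mpr h4)
      have e : hi = s.p s.c + s.p j - lo := by linarith
      rw [e]; nlinarith
    nlinarith
  have k2 : (θ - bernProb m θ) * (A - B) ≤ R / ((m : ℝ) + 1) := by
    have hAB : |A - B| ≤ R := by rw [abs_le]; constructor <;> linarith
    have hd : |θ - bernProb m θ| ≤ 1 / ((m : ℝ) + 1) := by
      rw [abs_le]; constructor <;> linarith
    calc _ ≤ |(θ - bernProb m θ) * (A - B)| := le_abs_self _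
      _ = |θ - bernProb m θ| * |A - B| := abs_mul _ _
      _ ≤ 1 / ((m : ℝ) + 1) * R := mul_le_mul hd hAB (abs_nonneg _) (by positivity)
      _ = _ := by ring
  show mext f s.p ≤ bernProb m θ * A + (1 - bernProb m θ) * B + R / ((m : ℝ) + 1)
  linarith [k1, k2]

/-- All other coordinates are integral and the total is the integer `k`, so the carried one is an
integer in [0, 1]. -/
theorem PipInv.integral_all {k : ℕ} {s : Carried n} (hs : PipInv k n s) (u : Fin n) :
    s.p u = 0 ∨ s.p u = 1 := by
  by_cases hu : u = s.c
  · subst hu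
    have h1 : ∃ z : ℤ, ∑ v ∈ Finset.univ.erase s.c, s.p v = z := by
      refine ⟨∑ v ∈ Finset.univ.erase s.c, ⌊s.p v⌋, ?_⟩
      push_cast
      refine Finset.sum_congr rfl fun v hv => ?_
      rcases hs.integral v v.isLt (Finset.ne_of_mem_erase hv) with h | h <;> simp [h]
    obtain ⟨z, hz⟩ := h1
    have h2 := hs.sum_eq
    rw [← Finset.add_sum_erase _ _ (Finset.mem_univ s.c), hz] at h2
    have h3 : s.p s.c = ((k - z : ℤ) : ℝ) := by push_cast; linarith
    have h4 := hs.cube s.c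
    rw [h3] at h4 ⊢
    have h5 : (0 : ℤ) ≤ k - z := by exact_mod_cast h4.1
    have h6 : (k - z : ℤ) ≤ 1 := by exact_mod_cast h4.2
    have : (k - z : ℤ) = 0 ∨ (k - z : ℤ) = 1 := by omega
    rcases this with h | h <;> rw [h] <;> simp
  · exact hs.integral u u.isLt hu

theorem PipInv.mext_eq {k : ℕ} {s : Carried n} (hs : PipInv k n s) (f : Finset (Fin n) → ℝ) :
    mext f s.p = f s.out := by
  unfold mext
  rw [ml_integral _ hs.integral_all]
  congr 1
  ext u
  simp [Carried.out]

theorem PipInv.card_out {k : ℕ} {s : Carried n} (hs : PipInv k n s) : s.out.card = k := by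
  have h1 : ∑ u, s.p u = ∑ u : Fin n, if 1 ≤ s.p u then (1 : ℝ) else 0 := by
    refine Finset.sum_congr rfl fun u _ => ?_
    rcases hs.integral_all u with h | h <;> simp [h]
  rw [hs.sum_eq, ← Finset.sum_filter, Finset.sum_const, nsmul_eq_mul, mul_one] at h1
  exact_mod_cast h1.symm

/-- Pipage rounding. -/
def pipage (m : ℕ) (s : Carried n) : PMF (Carried n) := pfold (pipStep m) (List.finRange n) s

theorem pipage_support {k m : ℕ} {s : Carried n} (hs : PipInv k 0 s) :
    ∀ s' ∈ (pipage m s).support, PipInv k n s' :=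
  pfold_finRange_support (fun j s hs => PipInv.step j s hs) hs

theorem le_pexp_pipage {k m : ℕ} {f : Finset (Fin n) → ℝ} (hf : IsSubmodular f)
    (h0 : ∀ S, 0 ≤ f S) {R : ℝ} (hR : ∀ S, f S ≤ R) {s : Carried n} (hs : PipInv k 0 s) :
    ENNReal.ofReal (mext f s.p) ≤ pexp (pipage m s) (fun s => ENNReal.ofReal (f s.out))
      + n * ENNReal.ofReal (R / ((m : ℝ) + 1)) := by
  have h1 := pfold_finRange_pexp (K := pipStep m) (fun j s hs => PipInv.step j s hs)
    (fun j s hs => le_pexp_pipStep hf h0 hR j s hs) hs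
  refine h1.trans (add_le_add_left (pexp_mono_support fun s' hs' => ?_) _)
  rw [(pipage_support hs s' hs').mext_eq]

end Pipage

end

noncomputable section

/-! ### The continuous process with estimated gains -/

section Main

open scoped ENNReal

variable {n : ℕ}

/-- Sums of sampled function values. -/
structure Sums (n : ℕ) where
  a0 : ℝ
  b0 : ℝ
  a : Fin n → ℝ
  b : Fin n → ℝ

/-- All sums are zero. -/
def Sums.zero (n : ℕ) : Sums n := ⟨0, 0, fun _ => 0, fun _ => 0⟩

/-- Add the values of one pair of samples. -/
def Sums.push (f : Finset (Fin n) → ℝ) (s : Sums n) (A B : Finset (Fin n)) : Sums n :=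
  ⟨s.a0 + f A, s.b0 + f B, fun u => s.a u + f (insert u A), fun u => s.b u + f (B.erase u)⟩

/-- One round of sampling. -/
def accRound (f : Finset (Fin n) → ℝ) (m : ℕ) (y x : Fin n → ℝ) (s : Sums n) : PMF (Sums n) :=
  (sample m y (List.finRange n) ∅).bind fun A =>
    (sample m x (List.finRange n) ∅).bind fun B => PMF.pure (s.push f A B)

/-- The two fractional points and the weight of the first one. -/
structure Pair (n : ℕ) where
  y : Fin n → ℝ
  x : Fin n → ℝ
  lam : ℝ

/-- The scores of the elements. -/
def scores (lam : ℝ) (s : Sums n) (u : Fin n) : ℝ :=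
  lam * (s.a u - s.a0) - (1 - lam) * (s.b u - s.b0)

open Classical in
/-- The estimated difference of the slopes of the two points. -/
def gap (M : Finset (Fin n)) (s : Sums n) : ℝ :=
  s.a0 - s.b0 + ∑ u, if u ∈ M then s.a u - s.a0 else -(s.b u - s.b0)

/-- The step that is taken on the basis of the sums of `N` samples. -/
def advance (k T N E : ℕ) (R : ℝ) (st : Pair n) (s : Sums n) : Pair n :=
  let M := topk k (scores st.lam s)
  { y := raisePt M (1 / (T : ℝ)) st.y
    x := lowerPt M (1 / (T : ℝ)) st.x
    lam := clip (st.lam - 1 / (E : ℝ) * (gap M s / (N : ℝ)) / R) }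

/-- One step of the process. -/
def mainStep (f : Finset (Fin n) → ℝ) (k m T N E : ℕ) (R : ℝ) (st : Pair n) : PMF (Pair n) :=
  (piter (accRound f m st.y st.x) N (Sums.zero n)).map (advance k T N E R st)

/-- The initial pair. -/
def Pair.start (n : ℕ) : Pair n := ⟨fun _ => 0, fun _ => 1, 0⟩

/-- The invariant of the process. -/
structure PairInv (k : ℕ) (δ : ℝ) (t : ℕ) (st : Pair n) : Prop where
  cube_y : InCube st.y
  cube_x : InCube st.x
  prod : ∀ u, (1 - st.y u) * st.x u = (1 - δ) ^ t
  sum_y : ∑ u, st.y u ≤ k * (t * δ)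
  sum_x : n - (n - k) * (t * δ) ≤ ∑ u, st.x u
  lam_mem : 0 ≤ st.lam ∧ st.lam ≤ 1

theorem pairInv_start (k : ℕ) (δ : ℝ) : PairInv k δ 0 (Pair.start n) where
  cube_y u := by simp [Pair.start]
  cube_x u := by simp [Pair.start]
  prod u := by simp [Pair.start]
  sum_y := by simp [Pair.start]
  sum_x := by simp [Pair.start]
  lam_mem := by simp [Pair.start]

theorem PairInv.advance {k T N E t : ℕ} {R : ℝ} {st : Pair n} (hT : 1 ≤ T) (hk : k ≤ n)
    (h : PairInv k (1 / (T : ℝ)) t st) (s : Sums n) :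
    PairInv k (1 / (T : ℝ)) (t + 1) (advance k T N E R st s) := by
  set δ := 1 / (T : ℝ) with hδ
  have hδ0 : 0 ≤ δ := by positivity
  have hδ1 : δ ≤ 1 := by
    rw [hδ]; exact div_le_one_of_le₀ (by exact_mod_cast hT) (by positivity)
  set M := topk k (scores st.lam s) with hM
  have hMc : M.card = k := card_topk hk
  refine ⟨inCube_raise M hδ0 hδ1 h.cube_y, inCube_lower M hδ0 hδ1 h.cube_x, fun u => ?_, ?_, ?_,
    clip_mem _⟩
  -- Exactly one of the two factors is multiplied by 1 - δ: the first if `u ∈ M`, the second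
  -- otherwise.
  · have := h.prod u
    show (1 - raisePt M δ st.y u) * lowerPt M δ st.x u = _
    unfold raisePt lowerPt
    rw [pow_succ, ← this]
    split_ifs <;> ring
  · show ∑ u, raisePt M δ st.y u ≤ _
    have h1 : ∀ u, raisePt M δ st.y u ≤ st.y u + if u ∈ M then δ else 0 := fun u => by
      have := h.cube_y u
      unfold raisePt
      split_ifs <;> nlinarith
    refine (Finset.sum_le_sum fun u _ => h1 u).trans ?_
    rw [Finset.sum_add_distrib, ← Finset.sum_filter, Finset.sum_const, nsmul_eq_mul]
    simp only [Finset.filter_mem_eq_inter, Finset.univ_inter, hMc]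
    have := h.sum_y
    push_cast
    nlinarith
  · show _ ≤ ∑ u, lowerPt M δ st.x u
    have h1 : ∀ u, st.x u - (if u ∈ Mᶜ then δ else 0) ≤ lowerPt M δ st.x u := fun u => by
      have := h.cube_x u
      unfold lowerPt
      by_cases hu : u ∈ M
      · simp [hu]
      · simp only [Finset.mem_compl, hu, not_false_eq_true, if_true, if_false]
        nlinarith
    refine le_trans ?_ (Finset.sum_le_sum fun u _ => h1 u)
    rw [Finset.sum_sub_distrib, ← Finset.sum_filter, Finset.sum_const, nsmul_eq_mul]
    simp only [Finset.filter_mem_eq_inter, Finset.univ_inter, Finset.card_compl, hMc,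
      Fintype.card_fin]
    have := h.sum_x
    rw [Nat.cast_sub hk]
    push_cast
    nlinarith

/-- All estimates are correct up to an error of `e`. -/
structure Accurate (f : Finset (Fin n) → ℝ) (N : ℕ) (e : ℝ) (y x : Fin n → ℝ) (s : Sums n) :
    Prop where
  a0 : |s.a0 - N * mext f y| ≤ N * e
  b0 : |s.b0 - N * mext f x| ≤ N * e
  a : ∀ u, |s.a u - N * mext (ins u f) y| ≤ N * e
  b : ∀ u, |s.b u - N * mext (del u f) x| ≤ N * e

theorem prob_and_le {α : Type*} {p : PMF α} {P Q : α → Prop} {a b : ℝ≥0∞}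
    (hP : prob p (fun s => ¬ P s) ≤ a) (hQ : prob p (fun s => ¬ Q s) ≤ b) :
    prob p (fun s => ¬ (P s ∧ Q s)) ≤ a + b := by
  refine le_trans ?_ (add_le_add hP hQ)
  unfold prob
  rw [← pexp_add]
  refine pexp_mono_support fun s _ => ?_
  by_cases h1 : P s <;> by_cases h2 : Q s <;> simp [h1, h2]

theorem prob_forall_le {α ι : Type*} [Fintype ι] {p : PMF α} {P : ι → α → Prop} {a : ℝ≥0∞}
    (hP : ∀ i, prob p (fun s => ¬ P i s) ≤ a) :
    prob p (fun s => ¬ ∀ i, P i s) ≤ Fintype.card ι * a := by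
  classical
  have h1 : prob p (fun s => ¬ ∀ i, P i s) ≤ ∑ i, prob p (fun s => ¬ P i s) := by
    unfold prob
    rw [← pexp_sum]
    refine pexp_mono_support fun s _ => ?_
    by_cases h : ∀ i, P i s
    · simp [h]
    · simp only [h, not_false_eq_true, if_true]
      push Not at h
      obtain ⟨i, hi⟩ := h
      refine le_trans ?_ (Finset.single_le_sum (fun _ _ => zero_le) (Finset.mem_univ i))
      simp [hi]
  refine h1.trans ((Finset.sum_le_card_nsmul _ _ a fun i _ => hP i).trans ?_)
  simp

theorem prob_mono {α : Type*} {p : PMF α} {P Q : α → Prop} (h : ∀ s, P s → Q s) :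
    prob p P ≤ prob p Q := by
  classical
  refine pexp_mono_support fun s _ => ?_
  by_cases h1 : P s
  · simp [h1, h s h1]
  · simp [h1]

/-- Chebyshev's inequality for each of the 2n + 2 sums, and a union bound. The same samples serve
all the sums; no independence between different sums is needed. -/
theorem prob_not_accurate_le {f : Finset (Fin n) → ℝ} (h0 : ∀ S, 0 ≤ f S) {R : ℝ}
    (hR : ∀ S, f S ≤ R) (m : ℕ) (y x : Fin n → ℝ) {N : ℕ} (hN : 0 < N) {e η : ℝ} (he : 0 < e)
    (hη : R ^ 2 ≤ η * (N * e ^ 2)) :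
    prob (piter (accRound f m y x) N (Sums.zero n))
      (fun s => ¬ Accurate f N e (rounded m y) (rounded m x) s) ≤ (2 * n + 2) * ENNReal.ofReal η := by
  have h1 := prob_piter_sum_le (K := accRound f m y x) (φ := Sums.a0) (s := Sums.zero n)
    (l := List.finRange n) (inCube_rounded m y) h0 hR
    (fun s g hg => by
      simp only [accRound, pexp_bind, pexp_pure, Sums.push, pexp_const]
      exact pexp_sample m y _ _ (fun A => hg _)) rfl he hη hN
  have h2 := prob_piter_sum_le (K := accRound f m y x) (φ := Sums.b0) (s := Sums.zero n)
    (l := List.finRange n) (inCube_rounded m x) h0 hR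
    (fun s g hg => by
      simp only [accRound, pexp_bind, pexp_pure, Sums.push, pexp_const]
      exact pexp_sample m x _ _ (fun A => hg _)) rfl he hη hN
  have h3 := prob_forall_le fun u : Fin n => prob_piter_sum_le (K := accRound f m y x)
    (φ := fun s => s.a u) (s := Sums.zero n)
    (l := List.finRange n) (inCube_rounded m y) (h := ins u f) (fun S => h0 _) (fun S => hR _)
    (fun s g hg => by
      simp only [accRound, pexp_bind, pexp_pure, Sums.push, pexp_const]
      exact pexp_sample m y _ _ (fun A => hg _)) rfl he hη hN
  have h4 := prob_forall_le fun u : Fin n => prob_piter_sum_le (K := accRound f m y x)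
    (φ := fun s => s.b u) (s := Sums.zero n)
    (l := List.finRange n) (inCube_rounded m x) (h := del u f) (fun S => h0 _) (fun S => hR _)
    (fun s g hg => by
      simp only [accRound, pexp_bind, pexp_pure, Sums.push, pexp_const]
      exact pexp_sample m x _ _ (fun A => hg _)) rfl he hη hN
  refine (prob_mono fun s hs => ?_).trans
    ((prob_and_le (prob_and_le h1 h2) (prob_and_le h3 h4)).trans (le_of_eq ?_))
  · intro h
    exact hs ⟨h.1.1, h.1.2, h.2.1, h.2.2⟩
  · rw [Fintype.card_fin]; ring

theorem abs_mext_rounded_sub_le {f : Finset (Fin n) → ℝ} {R : ℝ} (hR : OscLE f R) (m : ℕ)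
    {y : Fin n → ℝ} (hy : InCube y) : |mext f (rounded m y) - mext f y| ≤ R * (n / ((m : ℝ) + 1)) := by
  refine (abs_ml_sub_ml_le hy (inCube_rounded m y) hR ∅).trans
    (mul_le_mul_of_nonneg_left ?_ hR.nonneg)
  rw [sum_finRange]
  refine (Finset.sum_le_card_nsmul _ _ (1 / ((m : ℝ) + 1)) fun u _ =>
    abs_bernProb_sub_le m (hy u).1 (hy u).2).trans (le_of_eq ?_)
  rw [Finset.card_univ, Fintype.card_fin, nsmul_eq_mul, mul_one_div]

/-- The bias caused by the finite resolution of the sampling probabilities is added to the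
statistical error. -/
theorem Accurate.of_rounded {f : Finset (Fin n) → ℝ} {R : ℝ} (hR : OscLE f R) {m N : ℕ}
    {y x : Fin n → ℝ} (hy : InCube y) (hx : InCube x) {e : ℝ} {s : Sums n}
    (h : Accurate f N e (rounded m y) (rounded m x) s) :
    Accurate f N (e + R * (n / ((m : ℝ) + 1))) y x s := by
  have key : ∀ {a b c d : ℝ}, |a - N * b| ≤ N * e → |b - c| ≤ d → |a - N * c| ≤ N * (e + d) := by
    intro a b c d h1 h2
    have h3 := mul_le_mul_of_nonneg_left h2 (Nat.cast_nonneg (α := ℝ) N)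
    have := abs_add_le (a - N * b) (N * (b - c))
    rw [abs_mul, Nat.abs_cast] at this
    rw [show a - N * c = (a - N * b) + N * (b - c) by ring]
    linarith
  exact ⟨key h.a0 (abs_mext_rounded_sub_le hR m hy), key h.b0 (abs_mext_rounded_sub_le hR m hx),
    fun u => key (h.a u) (abs_mext_rounded_sub_le (hR.ins u) m hy),
    fun u => key (h.b u) (abs_mext_rounded_sub_le (hR.del u) m hx)⟩

/-- The loss in one step. -/
def stepLoss (n T E : ℕ) (R e : ℝ) : ℝ :=
  1 / (T : ℝ) * (4 * n * e + 2 * (n + 1) * e + 1 / (E : ℝ) * (2 * (n + 1)) ^ 2 * R / 2)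
    + 2 * R * (n * (1 / (T : ℝ))) ^ 2 + 1 / (T : ℝ) * (1 / (T : ℝ) * R / (2 * (1 / (E : ℝ))))

-- The heart of the analysis: each point separately satisfies the recursion that `f O` would drive.
-- The terms of `stepLoss` come from the greedy choice with gains known up to 2e (4ne), from the
-- estimated gap (2(n + 1)e), from the second-order term of the weight update with |gap| ≤ 2(n +
-- 1)R, from the Taylor remainder, and from δc because the potential term is discounted by 1 - δ
-- together with F.
set_option maxHeartbeats 1000000 in
theorem advance_values {f : Finset (Fin n) → ℝ} (hf : IsSubmodular f) (h0 : ∀ S, 0 ≤ f S)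
    {R : ℝ} (hR : ∀ S, f S ≤ R) (hRpos : 0 < R) {k T N E t : ℕ} (hT : 1 ≤ T) (hN : 1 ≤ N)
    (hE : 1 ≤ E) (hk : k ≤ n) {st : Pair n} (h : PairInv k (1 / (T : ℝ)) t st) {s : Sums n} {e : ℝ}
    (hs : Accurate f N e st.y st.x s) (he : 2 * e ≤ R) {O : Finset (Fin n)} (hO : O.card = k)
    {c δ : ℝ} (hδ : δ = 1 / (T : ℝ)) (hc : c = δ * R / (2 * (1 / (E : ℝ)))) :
    (1 - δ) * (mext f st.y - c * (1 - st.lam) ^ 2) + δ * ((1 - δ) ^ t * f O)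
        - stepLoss n T E R e
      ≤ mext f (advance k T N E R st s).y - c * (1 - (advance k T N E R st s).lam) ^ 2 ∧
    (1 - δ) * (mext f st.x - c * st.lam ^ 2) + δ * ((1 - δ) ^ t * f O)
        - stepLoss n T E R e
      ≤ mext f (advance k T N E R st s).x - c * (advance k T N E R st s).lam ^ 2 := by
  have hosc := OscLE.of_bounds h0 hR
  have hδ0 : 0 ≤ δ := by rw [hδ]; positivity
  have hδ1 : δ ≤ 1 := by
    rw [hδ]; exact div_le_one_of_le₀ (by exact_mod_cast hT) (by positivity)
  have hN' : (0 : ℝ) < N := by exact_mod_cast hN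
  have hE' : (0 : ℝ) < 1 / (E : ℝ) := by
    have : (0 : ℝ) < E := by exact_mod_cast hE
    positivity
  have hp0 : 0 ≤ (1 - δ) ^ t := pow_nonneg (by linarith) t
  have hp1 : (1 - δ) ^ t ≤ 1 := pow_le_one₀ (by linarith) (by linarith)
  have hprod := h.prod
  rw [← hδ] at hprod
  -- Both coordinate bounds follow from the invariant product, since neither factor exceeds 1.
  have hy1 : ∀ u, st.y u ≤ 1 - (1 - δ) ^ t := fun u => by
    have h1 := h.cube_y u; have h2 := h.cube_x u
    rw [← hprod u]; nlinarith
  have hx1 : ∀ u, (1 - δ) ^ t ≤ st.x u := fun u => by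
    have h1 := h.cube_y u; have h2 := h.cube_x u
    rw [← hprod u]; nlinarith
  set M := topk k (scores st.lam s) with hM
  set wa := fun u => (s.a u - s.a0) / N with hwa
  set wb := fun u => (s.b u - s.b0) / N with hwb
  have key : ∀ {a b c d : ℝ}, |a - N * b| ≤ N * e → |c - N * d| ≤ N * e →
      |(a - c) / N - (b - d)| ≤ 2 * e := by
    intro a b c d h1 h2
    have h3 := abs_sub (a - N * b) (c - N * d)
    have e1 : (a - c) / N - (b - d) = (a - N * b - (c - N * d)) / N := by field_simp; ring
    rw [e1, abs_div, Nat.abs_cast, div_le_iff₀ hN']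
    linarith
  have ha : ∀ u, |wa u - gainIns f st.y u| ≤ 2 * e := fun u => key (hs.a u) hs.a0
  have hb : ∀ u, |wb u - gainDel f st.x u| ≤ 2 * e := fun u => key (hs.b u) hs.b0
  have he0 : 0 ≤ e := by
    have := (abs_nonneg _).trans hs.a0
    exact nonneg_of_mul_nonneg_right this hN'
  have hMO : ∑ u ∈ O, (st.lam * wa u - (1 - st.lam) * wb u)
      ≤ ∑ u ∈ M, (st.lam * wa u - (1 - st.lam) * wb u) := by
    have h1 := sum_le_sum_topk (sc := scores st.lam s) hk hO
    have e1 : ∀ u, st.lam * wa u - (1 - st.lam) * wb u = scores st.lam s u / N := fun u => by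
      simp only [hwa, hwb, scores]; ring
    simp only [e1, ← Finset.sum_div]
    exact div_le_div_of_nonneg_right h1 hN'.le
  have hMc : M.card = k := card_topk hk
  have hcomb := le_combined hf h0 h.cube_y h.cube_x hp0 hp1 hy1 hx1 h.lam_mem.1 h.lam_mem.2 hk hO
    ha hb hMc hMO
  set v₁ := mext f st.y + ∑ u ∈ M, gainIns f st.y u with hv₁
  set v₂ := mext f st.x + ∑ u ∈ Mᶜ, gainDel f st.x u with hv₂
  have hgap : gap M s / N = (s.a0 - s.b0) / N + (∑ u ∈ M, wa u - ∑ u ∈ Mᶜ, wb u) := by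
    have e1 : ∑ u, (if u ∈ M then s.a u - s.a0 else -(s.b u - s.b0))
        = ∑ u ∈ M, (s.a u - s.a0) - ∑ u ∈ Mᶜ, (s.b u - s.b0) := by
      rw [← Finset.sum_add_sum_compl M, sub_eq_add_neg, ← Finset.sum_neg_distrib]
      congr 1
      · exact Finset.sum_congr rfl fun u hu => if_pos hu
      · exact Finset.sum_congr rfl fun u hu => if_neg (Finset.mem_compl.mp hu)
    have e2 : gap M s = s.a0 - s.b0
        + ∑ u, (if u ∈ M then s.a u - s.a0 else -(s.b u - s.b0)) := by
      unfold gap; congr!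
    rw [e2, e1]
    simp only [hwa, hwb, ← Finset.sum_div]
    ring
  have hcards : (M.card : ℝ) + (Mᶜ.card : ℝ) = n := by
    have := Finset.card_add_card_compl M
    rw [Fintype.card_fin] at this
    exact_mod_cast this
  have hsa : |∑ u ∈ M, wa u - ∑ u ∈ M, gainIns f st.y u| ≤ M.card * (2 * e) := by
    rw [← Finset.sum_sub_distrib]
    refine (Finset.abs_sum_le_sum_abs _ _).trans ?_
    simpa using Finset.sum_le_card_nsmul M _ (2 * e) fun u _ => ha u
  have hsb : |∑ u ∈ Mᶜ, wb u - ∑ u ∈ Mᶜ, gainDel f st.x u| ≤ Mᶜ.card * (2 * e) := by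
    rw [← Finset.sum_sub_distrib]
    refine (Finset.abs_sum_le_sum_abs _ _).trans ?_
    simpa using Finset.sum_le_card_nsmul Mᶜ _ (2 * e) fun u _ => hb u
  have hab := key hs.a0 hs.b0
  have hg : |gap M s / N - (v₁ - v₂)| ≤ 2 * (n + 1) * e := by
    have h1 := abs_le.mp hsa; have h2 := abs_le.mp hsb; have h3 := abs_le.mp hab
    have h4 : M.card * (2 * e) + Mᶜ.card * (2 * e) = n * (2 * e) := by rw [← hcards]; ring
    rw [hgap, hv₁, hv₂, abs_le]
    constructor <;> linarith
  have hF : ∀ (g : Finset (Fin n) → ℝ), (∀ S, 0 ≤ g S) → (∀ S, g S ≤ R) → ∀ z : Fin n → ℝ,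
      InCube z → 0 ≤ mext g z ∧ mext g z ≤ R := fun g hg0 hg1 z hz =>
    ⟨ml_nonneg hz hg0 ∅, ml_le hz hg1 ∅⟩
  have hgi : ∀ u, |gainIns f st.y u| ≤ R := fun u => by
    have h1 := hF f h0 hR _ h.cube_y
    have h2 := hF (ins u f) (fun S => h0 _) (fun S => hR _) _ h.cube_y
    unfold gainIns; rw [abs_le]; constructor <;> linarith
  have hgd : ∀ u, |gainDel f st.x u| ≤ R := fun u => by
    have h1 := hF f h0 hR _ h.cube_x
    have h2 := hF (del u f) (fun S => h0 _) (fun S => hR _) _ h.cube_x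
    unfold gainDel; rw [abs_le]; constructor <;> linarith
  -- The gains contribute nR, the difference of the two values R, and the estimation error (n + 1) *
  -- 2e ≤ (n + 1)R.
  have hB : |gap M s / N| ≤ (2 * (n + 1)) * R := by
    have h1 : |∑ u ∈ M, gainIns f st.y u| ≤ M.card * R := by
      refine (Finset.abs_sum_le_sum_abs _ _).trans ?_
      simpa using Finset.sum_le_card_nsmul M _ R fun u _ => hgi u
    have h2 : |∑ u ∈ Mᶜ, gainDel f st.x u| ≤ Mᶜ.card * R := by
      refine (Finset.abs_sum_le_sum_abs _ _).trans ?_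
      simpa using Finset.sum_le_card_nsmul Mᶜ _ R fun u _ => hgd u
    have h1' := abs_le.mp h1
    have h2' := abs_le.mp h2
    have h3 := abs_le.mp hg
    have h4 := hF f h0 hR _ h.cube_y
    have h5 := hF f h0 hR _ h.cube_x
    have h6 : M.card * R + Mᶜ.card * R = n * R := by rw [← hcards]; ring
    have h7 : (n + 1 : ℝ) * (2 * e) ≤ (n + 1) * R := mul_le_mul_of_nonneg_left he (by positivity)
    rw [hv₁, hv₂] at h3
    rw [abs_le]
    constructor <;> linarith
  obtain ⟨s1, s2⟩ := step_arith hδ0 hRpos hE' h.lam_mem.1 h.lam_mem.2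
    (by rw [show 2 * n * (2 * e) = 4 * n * e by ring] at hcomb; exact hcomb) hg hB
  rw [← hc] at s1 s2
  have r1 := le_mext_raise hosc M hδ0 hδ1 h.cube_y
  have r2 := le_mext_lower hosc M hδ0 hδ1 h.cube_x
  have ey : (advance k T N E R st s).y = raisePt M δ st.y := by rw [hδ]; rfl
  have ex : (advance k T N E R st s).x = lowerPt M δ st.x := by rw [hδ]; rfl
  have el : (advance k T N E R st s).lam = clip (st.lam - 1 / (E : ℝ) * (gap M s / N) / R) := rfl
  have hc0 : 0 ≤ c := by rw [hc]; positivity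
  have hl1 : (1 - st.lam) ^ 2 ≤ 1 := by
    have := h.lam_mem
    nlinarith
  have hl2 : st.lam ^ 2 ≤ 1 := by
    have := h.lam_mem
    nlinarith
  have eloss : stepLoss n T E R e = δ * (4 * n * e + 2 * (n + 1) * e
      + 1 / (E : ℝ) * (2 * (n + 1)) ^ 2 * R / 2) + 2 * R * (n * δ) ^ 2 + δ * c := by
    rw [stepLoss, hc, hδ]
  have m1 := mul_le_mul_of_nonneg_left hl1 (mul_nonneg hδ0 hc0)
  have m2 := mul_le_mul_of_nonneg_left hl2 (mul_nonneg hδ0 hc0)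
  rw [ey, ex, el, eloss]
  constructor
  · rw [hv₁] at s1; linarith
  · rw [hv₂] at s2; linarith

/-- The values that are guaranteed after `t` steps. -/
structure Good (f : Finset (Fin n) → ℝ) (k T E : ℕ) (R e V : ℝ) (t : ℕ) (st : Pair n) : Prop where
  inv : PairInv k (1 / (T : ℝ)) t st
  val_y : t * (1 / (T : ℝ)) * (1 - 1 / (T : ℝ)) ^ (t - 1) * V
      - 1 / (T : ℝ) * R / (2 * (1 / (E : ℝ))) - t * stepLoss n T E R e
    ≤ mext f st.y - 1 / (T : ℝ) * R / (2 * (1 / (E : ℝ))) * (1 - st.lam) ^ 2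
  val_x : t * (1 / (T : ℝ)) * (1 - 1 / (T : ℝ)) ^ (t - 1) * V
      - 1 / (T : ℝ) * R / (2 * (1 / (E : ℝ))) - t * stepLoss n T E R e
    ≤ mext f st.x - 1 / (T : ℝ) * R / (2 * (1 / (E : ℝ))) * st.lam ^ 2

theorem stepLoss_nonneg {T E : ℕ} {R e : ℝ} (hR : 0 ≤ R) (he : 0 ≤ e) :
    0 ≤ stepLoss n T E R e := by
  unfold stepLoss; positivity

theorem Good.start {f : Finset (Fin n) → ℝ} (h0 : ∀ S, 0 ≤ f S) {k T E : ℕ} {R e V : ℝ}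
    (hR : 0 ≤ R) : Good f k T E R e V 0 (Pair.start n) := by
  have hi := pairInv_start (n := n) k (1 / (T : ℝ))
  have hc : 0 ≤ 1 / (T : ℝ) * R / (2 * (1 / (E : ℝ))) := by positivity
  refine ⟨hi, ?_, ?_⟩
  · have := ml_nonneg (l := List.finRange n) hi.cube_y h0 ∅
    simp only [Pair.start, mext, Nat.cast_zero, zero_mul, zero_sub, sub_zero, one_pow,
      mul_one] at this ⊢
    linarith
  · have := ml_nonneg (l := List.finRange n) hi.cube_x h0 ∅
    simp only [Pair.start, mext, Nat.cast_zero, zero_mul, zero_sub, sub_zero, ne_eq,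
      OfNat.ofNat_ne_zero, not_false_eq_true, zero_pow, mul_zero] at this ⊢
    linarith

/-- Whenever the estimates are accurate, the bounds in `Good` propagate: a_t = tδ(1 - δ)^(t-1) V
solves a_(t+1) = (1 - δ)a_t + δ(1 - δ)^t V, and the losses add up. -/
theorem Good.step {f : Finset (Fin n) → ℝ} (hf : IsSubmodular f) (h0 : ∀ S, 0 ≤ f S)
    {R : ℝ} (hR : ∀ S, f S ≤ R) (hRpos : 0 < R) {k m T N E : ℕ} (hT : 1 ≤ T) (hN : 1 ≤ N)
    (hE : 1 ≤ E) (hk : k ≤ n) {e η : ℝ} (he : 0 < e) (hη : R ^ 2 ≤ η * (N * e ^ 2))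
    (he2 : 2 * (e + R * (n / ((m : ℝ) + 1))) ≤ R) {O : Finset (Fin n)} (hO : O.card = k) (t : ℕ)
    (st : Pair n) (h : Good f k T E R (e + R * (n / ((m : ℝ) + 1))) (f O) t st) :
    prob (mainStep f k m T N E R st)
      (fun st' => ¬ Good f k T E R (e + R * (n / ((m : ℝ) + 1))) (f O) (t + 1) st')
      ≤ (2 * n + 2) * ENNReal.ofReal η := by
  have h1 := prob_not_accurate_le h0 hR m st.y st.x hN he hη
  unfold mainStep
  unfold prob at *
  rw [pexp_map]
  refine le_trans ?_ h1
  refine prob_mono fun s hs hacc => hs ?_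
  have hacc' := hacc.of_rounded (OscLE.of_bounds h0 hR) h.inv.cube_y h.inv.cube_x
  obtain ⟨v1, v2⟩ := advance_values hf h0 hR hRpos hT hN hE hk h.inv hacc' he2 hO rfl rfl
  set e' := e + R * (n / ((m : ℝ) + 1))
  set δ := 1 / (T : ℝ) with hδ
  set c := δ * R / (2 * (1 / (E : ℝ)))
  have hδ0 : 0 ≤ δ := by positivity
  have hδ1 : δ ≤ 1 := by
    rw [hδ]; exact div_le_one_of_le₀ (by exact_mod_cast hT) (by positivity)
  have hc : 0 ≤ c := by positivity
  have hl : 0 ≤ stepLoss n T E R e' := stepLoss_nonneg hRpos.le (by positivity)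
  -- At `t = 0` the exponent is truncated to 0, which is harmless because the factor `t` vanishes.
  have hpow : (1 - δ) * ((t : ℝ) * δ * (1 - δ) ^ (t - 1) * f O) = t * δ * (1 - δ) ^ t * f O := by
    rcases Nat.eq_zero_or_pos t with rfl | ht
    · simp
    · obtain ⟨r, rfl⟩ := Nat.exists_eq_add_of_le' ht
      simp only [Nat.add_sub_cancel]; ring
  have key : ∀ w, t * δ * (1 - δ) ^ (t - 1) * f O - c - t * stepLoss n T E R e' ≤ w →
      ((t + 1 : ℕ) : ℝ) * δ * (1 - δ) ^ (t + 1 - 1) * f O - c - ((t + 1 : ℕ) : ℝ) * stepLoss n T E R e'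
      ≤ (1 - δ) * w + δ * ((1 - δ) ^ t * f O) - stepLoss n T E R e' := by
    intro w hw
    have := mul_le_mul_of_nonneg_left hw (sub_nonneg.mpr hδ1)
    have h3 : 0 ≤ δ * (c + t * stepLoss n T E R e') := by positivity
    simp only [Nat.add_sub_cancel]
    push_cast
    linarith
  exact ⟨h.inv.advance hT hk s, (key _ h.val_y).trans v1, (key _ h.val_x).trans v2⟩

end Main

end

noncomputable section

/-! ### The algorithm on the level of sets and points -/

section Algorithm

open scoped ENNReal

variable {n : ℕ}

/-- The point of total mass `k` on the segment between the two points. -/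
def mixPt (k : ℕ) (st : Pair n) : Fin n → ℝ := fun u =>
  st.y u + ((k : ℝ) - ∑ v, st.y v) / (∑ v, st.x v - ∑ v, st.y v) * (st.x u - st.y u)

/-- The whole algorithm. -/
def setAlg (f : Finset (Fin n) → ℝ) (k m T N E : ℕ) (R : ℝ) (c : Fin n) : PMF (Finset (Fin n)) :=
  (piter (mainStep f k m T N E R) T (Pair.start n)).bind fun st =>
    (pipage m ⟨mixPt k st, c⟩).map Carried.out

theorem piter_support {σ : Type*} {K : σ → PMF σ} {Inv : ℕ → σ → Prop}
    (hK : ∀ t s, Inv t s → ∀ s' ∈ (K s).support, Inv (t + 1) s') (m t : ℕ) (s : σ) (hs : Inv t s) :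
    ∀ s' ∈ (piter K m s).support, Inv (t + m) s' := by
  induction m generalizing t s with
  | zero =>
    intro s' hs'
    simp only [piter, PMF.support_pure, Set.mem_singleton_iff] at hs'
    subst hs'; simpa using hs
  | succ m ih =>
    intro s' hs'
    simp only [piter, PMF.mem_support_bind_iff] at hs'
    obtain ⟨a, ha, hs'⟩ := hs'
    have := ih (t + 1) a (hK t s hs a ha) s' hs'
    rwa [show t + (m + 1) = t + 1 + m by omega]

theorem pairInv_of_mem_support {f : Finset (Fin n) → ℝ} {k m T N E : ℕ} {R : ℝ} (hT : 1 ≤ T)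
    (hk : k ≤ n) : ∀ st ∈ (piter (mainStep f k m T N E R) T (Pair.start n)).support,
      PairInv k (1 / (T : ℝ)) T st := by
  intro st hst
  have := piter_support (K := mainStep f k m T N E R) (Inv := PairInv k (1 / (T : ℝ)))
    (fun t s hs s' hs' => by
      simp only [mainStep, PMF.mem_support_map_iff] at hs'
      obtain ⟨a, -, rfl⟩ := hs'
      exact hs.advance hT hk a) T 0 _ (pairInv_start k _) st hst
  simpa using this

/-- With r = T - 1 > 0, the right side is the inverse of (1 + 1/r)^r ≤ e. -/
theorem exp_neg_one_le {T : ℕ} (hT : 1 ≤ T) : Real.exp (-1) ≤ (1 - 1 / (T : ℝ)) ^ (T - 1) := by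
  obtain ⟨r, rfl⟩ := Nat.exists_eq_add_of_le' hT
  simp only [Nat.add_sub_cancel]
  rcases Nat.eq_zero_or_pos r with rfl | hr
  · simp
  have hr' : (0 : ℝ) < r := by exact_mod_cast hr
  have h1 : 1 - 1 / ((r + 1 : ℕ) : ℝ) = (1 + 1 / (r : ℝ))⁻¹ := by
    push_cast; field_simp; ring
  have h2 : (1 + 1 / (r : ℝ)) ^ r ≤ Real.exp 1 := by
    have := Real.add_one_le_exp (1 / (r : ℝ))
    calc (1 + 1 / (r : ℝ)) ^ r ≤ Real.exp (1 / (r : ℝ)) ^ r :=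
          pow_le_pow_left₀ (by positivity) (by linarith) r
      _ = Real.exp 1 := by rw [← Real.exp_nat_mul]; congr 1; field_simp
  rw [h1, inv_pow, Real.exp_neg]
  exact inv_anti₀ (by positivity) h2

theorem quarter_le_pow {T : ℕ} (hT : 4 ≤ T) : 1 / 4 ≤ (1 - 1 / (T : ℝ)) ^ T := by
  have h1 := exp_neg_one_le (T := T) (by omega)
  have h2 := Real.exp_neg_one_gt_d9
  have h3 : (1 - 1 / (T : ℝ)) ^ T = (1 - 1 / (T : ℝ)) ^ (T - 1) * (1 - 1 / (T : ℝ)) := by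
    rw [← pow_succ]; congr 1; omega
  have h4 : 1 / (T : ℝ) ≤ 1 / 4 := one_div_le_one_div_of_le (by norm_num) (by exact_mod_cast hT)
  rw [h3]
  nlinarith

/-- By the inequality of means, (1 - y + x)² ≥ 4(1 - y)x ≥ 1 in each coordinate. Thus y and x have
not crossed, and the segment between them has a nonnegative direction. -/
theorem PairInv.le {k T : ℕ} (hT : 4 ≤ T) {st : Pair n} (h : PairInv k (1 / (T : ℝ)) T st)
    (u : Fin n) : st.y u ≤ st.x u := by
  have h1 := h.prod u
  have h2 := quarter_le_pow hT
  have h3 := h.cube_y u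
  have h4 := h.cube_x u
  nlinarith [sq_nonneg (1 - st.y u - st.x u), sq_nonneg (1 - st.y u + st.x u)]

theorem PairInv.coeff_mem {k T : ℕ} (hT : 4 ≤ T) {st : Pair n}
    (h : PairInv k (1 / (T : ℝ)) T st) :
    0 ≤ ((k : ℝ) - ∑ v, st.y v) / (∑ v, st.x v - ∑ v, st.y v) ∧
    ((k : ℝ) - ∑ v, st.y v) / (∑ v, st.x v - ∑ v, st.y v) ≤ 1 ∧
    ((k : ℝ) - ∑ v, st.y v) / (∑ v, st.x v - ∑ v, st.y v) * (∑ v, st.x v - ∑ v, st.y v)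
      = k - ∑ v, st.y v := by
  have hT' : (T : ℝ) ≠ 0 := by
    have : T ≠ 0 := by omega
    exact_mod_cast this
  have h1 := h.sum_y
  have h2 := h.sum_x
  rw [mul_one_div_cancel hT', mul_one] at h1 h2
  refine ⟨div_nonneg (by linarith) (by linarith),
    div_le_one_of_le₀ (by linarith) (by linarith), ?_⟩
  -- If the two masses agree, both equal `k`, and the quotient 0 is correct.
  rcases eq_or_ne (∑ v, st.x v - ∑ v, st.y v) 0 with h3 | h3
  · rw [h3, mul_zero]; linarith
  · rw [div_mul_cancel₀ _ h3]

theorem PairInv.pipInv_mixPt {k T : ℕ} (hT : 4 ≤ T) {st : Pair n}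
    (h : PairInv k (1 / (T : ℝ)) T st) {c : Fin n} (hc : c.val = 0) :
    PipInv k 0 ⟨mixPt k st, c⟩ := by
  obtain ⟨h0, h1, h2⟩ := h.coeff_mem hT
  refine ⟨fun u => ?_, ?_, Or.inr hc, fun u hu => absurd hu (Nat.not_lt_zero _)⟩
  · have := h.le hT u
    have := h.cube_y u
    have := h.cube_x u
    simp only [mixPt]
    constructor <;> nlinarith
  · simp only [mixPt]
    rw [Finset.sum_add_distrib, ← Finset.mul_sum, Finset.sum_sub_distrib, h2]
    ring

theorem card_of_mem_support {f : Finset (Fin n) → ℝ} {k m T N E : ℕ} {R : ℝ} (hT : 4 ≤ T)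
    (hk : k ≤ n) {c : Fin n} (hc : c.val = 0) :
    ∀ S ∈ (setAlg f k m T N E R c).support, S.card = k := by
  intro S hS
  simp only [setAlg, PMF.mem_support_bind_iff, PMF.mem_support_map_iff] at hS
  obtain ⟨st, hst, s, hs, rfl⟩ := hS
  have hi := pairInv_of_mem_support (by omega) hk st hst
  exact (pipage_support (hi.pipInv_mixPt hT hc) s hs).card_out

theorem PairInv.le_mext_mixPt {f : Finset (Fin n) → ℝ} (hf : IsSubmodular f) {k T : ℕ}
    (hT : 4 ≤ T) {st : Pair n} (h : PairInv k (1 / (T : ℝ)) T st) {V : ℝ}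
    (hy : V ≤ mext f st.y) (hx : V ≤ mext f st.x) : V ≤ mext f (mixPt k st) := by
  obtain ⟨h0, h1, -⟩ := h.coeff_mem hT
  have := ml_concave (l := List.finRange n) h.cube_x h.cube_y (h.le hT) h0 h1 hf ∅
  change _ ≤ mext f (mixPt k st) at this
  unfold mext at hy hx
  nlinarith

/-- The second term on the right is the loss of pipage rounding. The third is the probability that
some step was based on inaccurate estimates, times `V`; nonnegativity of f suffices on that event.
-/
theorem le_pexp_setAlg {f : Finset (Fin n) → ℝ} (hf : IsSubmodular f) (h0 : ∀ S, 0 ≤ f S)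
    {R : ℝ} (hR : ∀ S, f S ≤ R) (hRpos : 0 < R) {k m T N E : ℕ} (hT : 4 ≤ T) (hN : 1 ≤ N)
    (hE : 1 ≤ E) (hk : k ≤ n) {e η : ℝ} (he : 0 < e) (hη : R ^ 2 ≤ η * (N * e ^ 2))
    (he2 : 2 * (e + R * (n / ((m : ℝ) + 1))) ≤ R) {O : Finset (Fin n)} (hO : O.card = k)
    {c : Fin n} (hc : c.val = 0) {V : ℝ}
    (hV : V ≤ Real.exp (-1) * f O - 1 / (T : ℝ) * R / (2 * (1 / (E : ℝ)))
      - T * stepLoss n T E R (e + R * (n / ((m : ℝ) + 1)))) :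
    ENNReal.ofReal V ≤ pexp (setAlg f k m T N E R c) (fun S => ENNReal.ofReal (f S))
      + n * ENNReal.ofReal (R / ((m : ℝ) + 1))
      + T * ((2 * n + 2) * ENNReal.ofReal η) * ENNReal.ofReal V := by
  have hprob := prob_piter_le (K := mainStep f k m T N E R)
    (fun t s hs => Good.step hf h0 hR hRpos (by omega) hN hE hk he hη he2 hO t s hs) T 0
    (Pair.start n) (Good.start h0 hRpos.le)
  rw [zero_add] at hprob
  have hT' : (T : ℝ) * (1 / (T : ℝ)) = 1 := by
    have : (T : ℝ) ≠ 0 := by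
      have : T ≠ 0 := by omega
      exact_mod_cast this
    field_simp
  have h1 := le_pexp_add (g := fun st => pexp (pipage m ⟨mixPt k st, c⟩)
      (fun s => ENNReal.ofReal (f s.out)) + n * ENNReal.ofReal (R / ((m : ℝ) + 1)))
    (c := ENNReal.ofReal V) hprob fun st hst => by
      have hi := hst.inv
      have hcc : 0 ≤ 1 / (T : ℝ) * R / (2 * (1 / (E : ℝ))) := by positivity
      have hexp := mul_le_mul_of_nonneg_right (exp_neg_one_le (T := T) (by omega)) (h0 O)
      have hy := hst.val_y
      have hx := hst.val_x
      rw [hT', one_mul] at hy hx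
      have hp := hi.le_mext_mixPt hf hT (V := V)
        (by linarith [mul_nonneg hcc (sq_nonneg (1 - st.lam))])
        (by linarith [mul_nonneg hcc (sq_nonneg st.lam)])
      exact (ENNReal.ofReal_le_ofReal hp).trans
        (le_pexp_pipage hf h0 hR (hi.pipInv_mixPt hT hc))
  rw [pexp_add, pexp_const] at h1
  simp only [setAlg, pexp_bind, pexp_map]
  exact h1

/-- The guarantee of the algorithm for the parameters used by the program. -/
theorem setAlg_guarantee {f : Finset (Fin n) → ℝ} (hf : IsSubmodular f) (h0 : ∀ S, 0 ≤ f S)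
    {k : ℕ} (hk1 : 1 ≤ k) (hkn : k < n) {O : Finset (Fin n)} (hO : O.card = k)
    (hmax : ∀ S : Finset (Fin n), S.card = k → f S ≤ f O) (hpos : 0 < f O)
    {c : Fin n} (hc : c.val = 0) :
    ENNReal.ofReal ((Real.exp (-1) - 20 / ((n : ℝ) + 1)) * f O)
      ≤ pexp (setAlg f k ((n + 1) ^ 6) ((n + 1) ^ 8) ((n + 1) ^ 20) ((n + 1) ^ 5)
          (f ∅ + ∑ u, f {u}) c) (fun S => ENNReal.ofReal (f S)) := by
  set R := f ∅ + ∑ u, f {u} with hRdef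
  have hR : ∀ S, f S ≤ R := fun S => hf.le_sum_singleton h0 S
  have hRpos : 0 < R := hpos.trans_le (hR O)
  set b : ℝ := (n : ℝ) + 1 with hb
  have hn : (1 : ℝ) ≤ n := by exact_mod_cast (by omega : 1 ≤ n)
  have hb2 : 2 ≤ b := by linarith
  have hb0 : 0 < b := by linarith
  -- Each of the n + 1 values in `R` is at most n * f O.
  have hRb : R ≤ b ^ 2 * f O := by
    have h1 : ∀ S, f S ≤ n * f O := fun S => by
      have := hf.le_card_mul h0 hk1 (by simpa using hkn) hmax S
      simpa using this
    have h2 : ∑ u : Fin n, f {u} ≤ n * (n * f O) := by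
      refine (Finset.sum_le_card_nsmul _ _ _ fun u _ => h1 {u}).trans ?_
      simp
    have h3 := h1 ∅
    rw [hRdef, hb]
    nlinarith
  have cast : ∀ j : ℕ, (((n + 1) ^ j : ℕ) : ℝ) = b ^ j := fun j => by rw [hb]; push_cast; rfl
  have hpow : ∀ i j : ℕ, i ≤ j → b ^ i ≤ b ^ j := fun i j h => pow_le_pow_right₀ (by linarith) h
  have hm : R * (n / (((n + 1) ^ 6 : ℕ) + 1 : ℝ)) ≤ R / b ^ 5 := by
    rw [cast, div_eq_mul_one_div R]
    refine mul_le_mul_of_nonneg_left ?_ hRpos.le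
    rw [div_le_div_iff₀ (by positivity) (by positivity)]
    have : (n : ℝ) * b ^ 5 ≤ b * b ^ 5 := mul_le_mul_of_nonneg_right (by linarith) (by positivity)
    nlinarith
  set e' := R / b ^ 5 + R * (n / (((n + 1) ^ 6 : ℕ) + 1 : ℝ)) with he'
  have he'0 : 0 ≤ e' := by positivity
  have he'1 : e' ≤ 2 * (R / b ^ 5) := by linarith
  have hRb5 : R / b ^ 5 * 32 ≤ R := by
    rw [div_mul_eq_mul_div, div_le_iff₀ (by positivity)]
    have : (2 : ℝ) ^ 5 ≤ b ^ 5 := pow_le_pow_left₀ (by norm_num) hb2 5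
    nlinarith
  -- In units of R/b³: 1 for the potential at the end and its discounting, 12 for estimation errors,
  -- 2 for the weight updates, 2 for the Taylor remainders.
  have hloss : 1 / (((n + 1) ^ 8 : ℕ) : ℝ) * R / (2 * (1 / (((n + 1) ^ 5 : ℕ) : ℝ)))
      + ((n + 1) ^ 8 : ℕ) * stepLoss n ((n + 1) ^ 8) ((n + 1) ^ 5) R e' ≤ 17 * (R / b ^ 3) := by
    have e1 : 1 / (((n + 1) ^ 8 : ℕ) : ℝ) * R / (2 * (1 / (((n + 1) ^ 5 : ℕ) : ℝ)))
      + ((n + 1) ^ 8 : ℕ) * stepLoss n ((n + 1) ^ 8) ((n + 1) ^ 5) R e'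
      = R / b ^ 3 + (4 * n * e' + 2 * b * e') + 2 * (R / b ^ 3) + 2 * (R * n ^ 2 / b ^ 8) := by
      unfold stepLoss
      rw [cast, cast, ← hb]
      field_simp
      ring
    have e2 : 4 * n * e' + 2 * b * e' ≤ 12 * (R / b ^ 3) := by
      have h1 : 4 * n * e' + 2 * b * e' ≤ 6 * b * (2 * (R / b ^ 5)) := by nlinarith
      have h2 : 6 * b * (2 * (R / b ^ 5)) = 12 * (R / b ^ 4) := by field_simp; ring
      have h3 : R / b ^ 4 ≤ R / b ^ 3 :=
        div_le_div_of_nonneg_left hRpos.le (by positivity) (hpow 3 4 (by norm_num))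
      linarith
    have e3 : R * n ^ 2 / b ^ 8 ≤ R / b ^ 3 := by
      rw [div_le_div_iff₀ (by positivity) (by positivity), mul_assoc]
      refine mul_le_mul_of_nonneg_left ?_ hRpos.le
      calc (n : ℝ) ^ 2 * b ^ 3 ≤ b ^ 2 * b ^ 3 :=
            mul_le_mul_of_nonneg_right (pow_le_pow_left₀ (by linarith) (by linarith) 2)
              (by positivity)
        _ = b ^ 5 := by ring
        _ ≤ b ^ 8 := hpow 5 8 (by norm_num)
    rw [e1]; linarith
  have hRb3 : R / b ^ 3 ≤ f O / b := by
    rw [div_le_div_iff₀ (by positivity) hb0]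
    nlinarith
  have hone : ∀ j : ℕ, 1 ≤ (n + 1) ^ j := fun j => Nat.one_le_pow _ _ (by omega)
  have hT4 : 4 ≤ (n + 1) ^ 8 := by
    calc 4 ≤ 2 ^ 8 := by norm_num
      _ ≤ _ := Nat.pow_le_pow_left (by omega) 8
  set V := (Real.exp (-1) - 17 / b) * f O with hV
  -- The failure probability is what Chebyshev's inequality yields: η N e² = b⁻¹⁰ b²⁰ (R/b⁵)² = R².
  have main := le_pexp_setAlg hf h0 hR hRpos (k := k) (m := (n + 1) ^ 6) (T := (n + 1) ^ 8)
    (N := (n + 1) ^ 20) (E := (n + 1) ^ 5) hT4 (hone 20) (hone 5) hkn.le (e := R / b ^ 5)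
    (η := 1 / b ^ 10) (by positivity) (by rw [cast]; field_simp; exact le_rfl)
    (by rw [← he']; linarith) hO hc (V := V)
    (by
      rw [← he', hV]
      have : (Real.exp (-1) - 17 / b) * f O = Real.exp (-1) * f O - 17 * (f O / b) := by ring
      rw [this]
      linarith)
  set P := pexp (setAlg f k ((n + 1) ^ 6) ((n + 1) ^ 8) ((n + 1) ^ 20) ((n + 1) ^ 5) R c)
    (fun S => ENNReal.ofReal (f S))
  have t1 : (n : ℝ≥0∞) * ENNReal.ofReal (R / (((n + 1) ^ 6 : ℕ) + 1 : ℝ))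
      ≤ ENNReal.ofReal (f O / b) := by
    rw [← ENNReal.ofReal_natCast n, ← ENNReal.ofReal_mul (by positivity)]
    refine ENNReal.ofReal_le_ofReal ?_
    calc (n : ℝ) * (R / (((n + 1) ^ 6 : ℕ) + 1 : ℝ))
          = R * (n / (((n + 1) ^ 6 : ℕ) + 1 : ℝ)) := by ring
      _ ≤ R / b ^ 5 := hm
      _ ≤ R / b ^ 3 := div_le_div_of_nonneg_left hRpos.le (by positivity) (hpow 3 5 (by norm_num))
      _ ≤ _ := hRb3
  -- Union bound over b⁸ steps with 2b estimated sums each: b⁸ * 2b * b⁻¹⁰ = 2/b.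
  have t2 : (((n + 1) ^ 8 : ℕ) : ℝ≥0∞) * ((2 * n + 2) * ENNReal.ofReal (1 / b ^ 10))
      * ENNReal.ofReal V ≤ ENNReal.ofReal (2 / b * f O) := by
    have e1 : (((n + 1) ^ 8 : ℕ) : ℝ≥0∞) * ((2 * n + 2) * ENNReal.ofReal (1 / b ^ 10))
        = ENNReal.ofReal (2 / b) := by
      have e2 : (2 * n + 2 : ℝ≥0∞) = ENNReal.ofReal (2 * b) := by
        rw [hb, show (2 : ℝ) * (n + 1) = ((2 * n + 2 : ℕ) : ℝ) by push_cast; ring,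
          ENNReal.ofReal_natCast]
        push_cast; rfl
      rw [e2, ← ENNReal.ofReal_natCast, cast, ← ENNReal.ofReal_mul (by positivity),
        ← ENNReal.ofReal_mul (by positivity)]
      congr 1
      field_simp
    rw [e1, ← ENNReal.ofReal_mul (by positivity)]
    refine ENNReal.ofReal_le_ofReal (mul_le_mul_of_nonneg_left ?_ (by positivity))
    have h1 : Real.exp (-1) ≤ 1 := Real.exp_le_one_iff.mpr (by norm_num)
    have h2 : 0 ≤ 17 / b := by positivity
    rw [hV]; nlinarith
  have t3 : ENNReal.ofReal V ≤ P + ENNReal.ofReal (3 * (f O / b)) := by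
    refine main.trans ?_
    rw [add_assoc]
    refine add_le_add_right ?_ P
    refine (add_le_add t1 t2).trans ?_
    rw [← ENNReal.ofReal_add (by positivity) (by positivity)]
    exact ENNReal.ofReal_le_ofReal (le_of_eq (by ring))
  -- 20 = 17 for the process, 1 for pipage rounding, 2 for the failures.
  have t4 : (Real.exp (-1) - 20 / b) * f O = V - 3 * (f O / b) := by rw [hV]; ring
  rw [t4, ENNReal.ofReal_sub _ (by positivity)]
  exact tsub_le_iff_right.mpr t3

end Algorithm

end

noncomputable section

/-! ### Couplings -/

section Coupling

open scoped ENNReal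

variable {σ τ α β : Type*}

/-- The two distributions have a coupling that is supported on the relation. -/
def Lift (R : σ → α → Prop) (μ : PMF σ) (ν : PMF α) : Prop :=
  ∃ γ : PMF (σ × α), γ.map Prod.fst = μ ∧ γ.map Prod.snd = ν ∧ ∀ x ∈ γ.support, R x.1 x.2

theorem map_const_eq (p : PMF α) (b : β) : (p.map fun _ => b) = PMF.pure b := PMF.map_const p b

theorem map_id_eq (p : PMF α) : (p.map fun a => a) = p := PMF.map_id p

theorem Lift.pure {R : σ → α → Prop} {s : σ} {a : α} (h : R s a) :
    Lift R (PMF.pure s) (PMF.pure a) :=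
  ⟨PMF.pure (s, a), by simp [PMF.pure_map], by simp [PMF.pure_map], fun x hx => by
    simp only [PMF.support_pure, Set.mem_singleton_iff] at hx
    subst hx; exact h⟩

theorem Lift.mono {R R' : σ → α → Prop} {μ : PMF σ} {ν : PMF α} (h : Lift R μ ν)
    (hR : ∀ s a, R s a → R' s a) : Lift R' μ ν := by
  obtain ⟨γ, h1, h2, h3⟩ := h
  exact ⟨γ, h1, h2, fun x hx => hR _ _ (h3 x hx)⟩

theorem Lift.bind {R : σ → α → Prop} {R' : τ → β → Prop} {μ : PMF σ} {ν : PMF α}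
    {g : σ → PMF τ} {k : α → PMF β} (h : Lift R μ ν)
    (hR : ∀ s a, R s a → Lift R' (g s) (k a)) : Lift R' (μ.bind g) (ν.bind k) := by
  classical
  obtain ⟨γ, h1, h2, h3⟩ := h
  have hex : ∀ x : σ × α, ∃ γ' : PMF (τ × β), γ'.map Prod.fst = g x.1 ∧ γ'.map Prod.snd = k x.2 ∧
      (R x.1 x.2 → ∀ z ∈ γ'.support, R' z.1 z.2) := by
    intro x
    by_cases hx : R x.1 x.2
    · obtain ⟨γ', a, b, c⟩ := hR _ _ hx
      exact ⟨γ', a, b, fun _ => c⟩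
    -- Outside the relation any coupling will do, and the product is taken; such pairs have
    -- probability 0 under `γ`.
    · refine ⟨(g x.1).bind fun t => (k x.2).map fun b => (t, b), ?_, ?_, fun h => absurd h hx⟩
      · simp only [PMF.map_bind, PMF.map_comp]
        simp [Function.comp_def, map_const_eq, PMF.bind_pure]
      · simp only [PMF.map_bind, PMF.map_comp]
        simp [Function.comp_def, map_id_eq]
  choose G hG1 hG2 hG3 using hex
  refine ⟨γ.bind G, ?_, ?_, ?_⟩
  · rw [PMF.map_bind, ← h1, PMF.bind_map]
    congr 1; funext x; exact hG1 x
  · rw [PMF.map_bind, ← h2, PMF.bind_map]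
    congr 1; funext x; exact hG2 x
  · intro z hz
    rw [PMF.mem_support_bind_iff] at hz
    obtain ⟨x, hx, hz⟩ := hz
    exact hG3 x (h3 x hx) z hz

theorem Lift.map_same {ι : Type*} {R : σ → α → Prop} (p : PMF ι) {g : ι → σ} {h : ι → α}
    (H : ∀ i, R (g i) (h i)) : Lift R (p.map g) (p.map h) :=
  ⟨p.map fun i => (g i, h i), by simp [PMF.map_comp, Function.comp_def],
    by simp [PMF.map_comp, Function.comp_def], fun x hx => by
      rw [PMF.mem_support_map_iff] at hx
      obtain ⟨i, -, rfl⟩ := hx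
      exact H i⟩

/-- This is how frame conditions, which concern the machine alone, enter a coupling. -/
theorem Lift.and_support {R : σ → α → Prop} {Q : σ → Prop} {μ : PMF σ} {ν : PMF α}
    (h : Lift R μ ν) (hQ : ∀ s ∈ μ.support, Q s) : Lift (fun s a => R s a ∧ Q s) μ ν := by
  obtain ⟨γ, h1, h2, h3⟩ := h
  refine ⟨γ, h1, h2, fun x hx => ⟨h3 x hx, hQ _ ?_⟩⟩
  rw [← h1, PMF.mem_support_map_iff]
  exact ⟨x, hx, rfl⟩

theorem Lift.support {R : σ → α → Prop} {μ : PMF σ} {ν : PMF α} (h : Lift R μ ν) :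
    ∀ s ∈ μ.support, ∃ a ∈ ν.support, R s a := by
  obtain ⟨γ, h1, h2, h3⟩ := h
  intro s hs
  rw [← h1, PMF.mem_support_map_iff] at hs
  obtain ⟨x, hx, rfl⟩ := hs
  refine ⟨x.2, ?_, h3 x hx⟩
  rw [← h2, PMF.mem_support_map_iff]
  exact ⟨x, hx, rfl⟩

theorem Lift.pexp_eq {R : σ → α → Prop} {μ : PMF σ} {ν : PMF α} (h : Lift R μ ν)
    {g : σ → ℝ≥0∞} {k : α → ℝ≥0∞} (hgk : ∀ s a, R s a → g s = k a) : pexp μ g = pexp ν k := by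
  obtain ⟨γ, h1, h2, h3⟩ := h
  rw [← h1, ← h2, pexp_map, pexp_map]
  exact le_antisymm (pexp_mono_support fun x hx => (hgk _ _ (h3 x hx)).le)
    (pexp_mono_support fun x hx => (hgk _ _ (h3 x hx)).ge)

/-- All possible outcomes satisfy `Q`. -/
def Sat (Q : σ → Prop) (μ : PMF σ) : Prop := ∀ s ∈ μ.support, Q s

theorem Sat.pure {Q : σ → Prop} {s : σ} (h : Q s) : Sat Q (PMF.pure s) := fun x hx => by
  simp only [PMF.support_pure, Set.mem_singleton_iff] at hx
  subst hx; exact h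

theorem Sat.mono {Q Q' : σ → Prop} {μ : PMF σ} (h : Sat Q μ) (hQ : ∀ s, Q s → Q' s) : Sat Q' μ :=
  fun s hs => hQ s (h s hs)

theorem Sat.and {Q Q' : σ → Prop} {μ : PMF σ} (h : Sat Q μ) (h' : Sat Q' μ) :
    Sat (fun s => Q s ∧ Q' s) μ := fun s hs => ⟨h s hs, h' s hs⟩

theorem Sat.bind {Q : σ → Prop} {Q' : τ → Prop} {μ : PMF σ} {g : σ → PMF τ} (h : Sat Q μ)
    (hg : ∀ s, Q s → Sat Q' (g s)) : Sat Q' (μ.bind g) := fun t ht => by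
  rw [PMF.mem_support_bind_iff] at ht
  obtain ⟨s, hs, ht⟩ := ht
  exact hg s (h s hs) t ht

theorem Sat.map {ι : Type*} {Q : σ → Prop} {p : PMF ι} {g : ι → σ} (h : ∀ i, Q (g i)) :
    Sat Q (p.map g) := fun s hs => by
  rw [PMF.mem_support_map_iff] at hs
  obtain ⟨i, -, rfl⟩ := hs
  exact h i

/-- A computation that ends in a definite way is coupled to a deterministic one. -/
theorem Sat.lift {R : σ → α → Prop} {μ : PMF σ} {a : α} (h : Sat (fun s => R s a) μ) :
    Lift R μ (PMF.pure a) := by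
  refine ⟨μ.map fun s => (s, a), ?_, ?_, fun x hx => ?_⟩
  · simp [PMF.map_comp, Function.comp_def, map_id_eq]
  · simp [PMF.map_comp, Function.comp_def, map_const_eq]
  · rw [PMF.mem_support_map_iff] at hx
    obtain ⟨s, hs, rfl⟩ := hx
    exact h s hs

theorem Lift.bind_sat {R : σ → α → Prop} {R' : τ → α → Prop} {μ : PMF σ} {ν : PMF α}
    {g : σ → PMF τ} (h : Lift R μ ν) (hR : ∀ s a, R s a → Sat (fun t => R' t a) (g s)) :
    Lift R' (μ.bind g) ν := by
  have := h.bind (k := PMF.pure) fun s a hs => (hR s a hs).lift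
  rwa [PMF.bind_pure] at this

/-- For pieces of the program, such as initializations, that have no counterpart in the abstract
process. -/
theorem Sat.bind_lift {Q : σ → Prop} {R : τ → α → Prop} {μ : PMF σ} {ν : PMF α}
    {g : σ → PMF τ} (h : Sat Q μ) (hR : ∀ s, Q s → Lift R (g s) ν) : Lift R (μ.bind g) ν := by
  have := (Sat.lift (R := fun s (_ : Unit) => Q s) (a := ()) h).bind (k := fun _ => ν)
    fun s _ hs => hR s hs
  rwa [PMF.pure_bind] at this

end Coupling

namespace OracleRAM

/-! ### Frame conditions and running times -/

/-- The program does not write into the natural array `a`. -/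
def Cmd.keepsNat (a : ℕ) : Cmd → Bool
  | skip => true
  | setNat b _ _ => !(Nat.beq b a)
  | setReal _ _ _ => true
  | query _ _ _ => true
  | rand b _ _ => !(Nat.beq b a)
  | seq c₁ c₂ => c₁.keepsNat a && c₂.keepsNat a
  | ite _ c₁ c₂ => c₁.keepsNat a && c₂.keepsNat a
  | loop _ c => c.keepsNat a

/-- The program does not write into the real array `a`. -/
def Cmd.keepsReal (a : ℕ) : Cmd → Bool
  | skip => true
  | setNat _ _ _ => true
  | setReal b _ _ => !(Nat.beq b a)
  | query b _ _ => !(Nat.beq b a)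
  | rand _ _ _ => true
  | seq c₁ c₂ => c₁.keepsReal a && c₂.keepsReal a
  | ite _ c₁ c₂ => c₁.keepsReal a && c₂.keepsReal a
  | loop _ c => c.keepsReal a

section Semantics

variable {n : ℕ} (f : Finset (Fin n) → ℝ)

theorem Sat.rounds {step : State → PMF State} {Q : State → Prop}
    (htick : ∀ s t, Q s → Q (s.tick t)) (h : ∀ s, Q s → Sat Q (step s)) (m : ℕ) {s : State}
    (hs : Q s) : Sat Q (rounds step m s) := by
  induction m generalizing s with
  | zero => exact Sat.pure hs
  | succ m ih => exact Sat.bind (h _ (htick _ _ hs)) fun s hs => ih hs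

variable {f}

theorem ne_of_beq {a b : ℕ} (h : (!(Nat.beq b a)) = true) : a ≠ b := by
  rintro rfl
  simp at h

theorem sat_keepsNat {a : ℕ} {c : Cmd} (hc : c.keepsNat a = true) (s : State) :
    Sat (fun s' => s'.nat a = s.nat a) (c.exec f s) := by
  induction c generalizing s with
  | skip => exact Sat.pure rfl
  | setNat b i e =>
    refine Sat.pure ?_
    simp [State.tick, State.writeNat, Function.update_of_ne (ne_of_beq hc)]
  | setReal b i r => exact Sat.pure rfl
  | query b i d => exact Sat.pure rfl
  | rand b i e =>
    refine Sat.map fun v => ?_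
    simp [State.tick, State.writeNat, Function.update_of_ne (ne_of_beq hc)]
  | seq c₁ c₂ ih₁ ih₂ =>
    simp only [Cmd.keepsNat, Bool.and_eq_true] at hc
    exact Sat.bind (ih₁ hc.1 s) fun t ht => (ih₂ hc.2 t).mono fun r hr => hr.trans ht
  | ite b c₁ c₂ ih₁ ih₂ =>
    simp only [Cmd.keepsNat, Bool.and_eq_true] at hc
    simp only [Cmd.exec]
    split_ifs
    · exact ih₁ hc.1 _
    · exact ih₂ hc.2 _
  | loop e c ih =>
    exact Sat.rounds (Q := fun s' => s'.nat a = s.nat a) (fun _ _ h => h)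
      (fun t ht => (ih hc t).mono fun r hr => hr.trans ht) _ rfl

theorem sat_keepsReal {a : ℕ} {c : Cmd} (hc : c.keepsReal a = true) (s : State) :
    Sat (fun s' => s'.real a = s.real a) (c.exec f s) := by
  induction c generalizing s with
  | skip => exact Sat.pure rfl
  | setNat b i e => exact Sat.pure rfl
  | setReal b i r =>
    refine Sat.pure ?_
    simp [State.tick, State.writeReal, Function.update_of_ne (ne_of_beq hc)]
  | query b i d =>
    refine Sat.pure ?_
    simp [State.tick, State.writeReal, Function.update_of_ne (ne_of_beq hc)]
  | rand b i e => exact Sat.map fun v => rfl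
  | seq c₁ c₂ ih₁ ih₂ =>
    simp only [Cmd.keepsReal, Bool.and_eq_true] at hc
    exact Sat.bind (ih₁ hc.1 s) fun t ht => (ih₂ hc.2 t).mono fun r hr => hr.trans ht
  | ite b c₁ c₂ ih₁ ih₂ =>
    simp only [Cmd.keepsReal, Bool.and_eq_true] at hc
    simp only [Cmd.exec]
    split_ifs
    · exact ih₁ hc.1 _
    · exact ih₂ hc.2 _
  | loop e c ih =>
    exact Sat.rounds (Q := fun s' => s'.real a = s.real a) (fun _ _ h => h)
      (fun t ht => (ih hc t).mono fun r hr => hr.trans ht) _ rfl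

/-- A cell with a constant address in one of the arrays selected by `C`. -/
def NExp.isConstCell (C : ℕ → Bool) : NExp → Bool
  | get a (lit _) => C a
  | _ => false

/-- The program does not write into the arrays selected by `C`, and these hold all its loop bounds
and the ranges of its random numbers. -/
def Cmd.timed (C : ℕ → Bool) : Cmd → Bool
  | skip => true
  | setNat b _ _ => !(C b)
  | setReal _ _ _ => true
  | query _ _ _ => true
  | rand b _ e => !(C b) && e.isConstCell C
  | seq c₁ c₂ => c₁.timed C && c₂.timed C
  | ite _ c₁ c₂ => c₁.timed C && c₂.timed C
  | loop e c => e.isConstCell C && c.timed C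

open Polynomial in
/-- A bound on the content of a constant cell. -/
def NExp.polyBound (π : ℕ → ℕ → ℕ[X]) : NExp → ℕ[X]
  | get a (lit i) => π a i
  | _ => 0

open Polynomial in
/-- A bound on the running time. -/
def Cmd.timePoly (π : ℕ → ℕ → ℕ[X]) : Cmd → ℕ[X]
  | skip => 1
  | setNat _ i e => C (i.cost + e.cost + 1)
  | setReal _ i r => C (i.cost + r.cost + 1)
  | query _ i _ => C (i.cost + 1)
  | rand _ i e => C (i.cost + e.cost + 1) + e.polyBound π
  | seq c₁ c₂ => c₁.timePoly π + c₂.timePoly π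
  | ite b c₁ c₂ => C (b.cost + 1) + c₁.timePoly π + c₂.timePoly π
  | loop e c => C (e.cost + 1) + e.polyBound π * (c.timePoly π + 1)

open Polynomial in
theorem NExp.eval_le_polyBound {C : ℕ → Bool} {π : ℕ → ℕ → ℕ[X]} {N : ℕ} {e : NExp}
    (he : e.isConstCell C = true) {s : State}
    (hs : ∀ a i, C a = true → s.nat a i ≤ (π a i).eval N) : e.eval s ≤ (e.polyBound π).eval N := by
  cases e with
  | get a i =>
    cases i with
    | lit c => exact hs a c he
    | get _ _ => simp [NExp.isConstCell] at he
    | add _ _ => simp [NExp.isConstCell] at he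
    | sub _ _ => simp [NExp.isConstCell] at he
  | lit _ => simp [NExp.isConstCell] at he
  | add _ _ => simp [NExp.isConstCell] at he
  | sub _ _ => simp [NExp.isConstCell] at he

theorem Cmd.keepsNat_of_timed {C : ℕ → Bool} {c : Cmd} (hc : c.timed C = true) {a : ℕ}
    (ha : C a = true) : c.keepsNat a = true := by
  have key : ∀ b, (!(C b)) = true → (!(Nat.beq b a)) = true := by
    intro b hb
    by_contra h
    simp only [Bool.not_eq_true', Bool.not_eq_false, Nat.beq_eq] at h
    subst h
    simp [ha] at hb
  induction c with
  | skip => rfl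
  | setNat b i e => exact key b hc
  | setReal b i r => rfl
  | query b i d => rfl
  | rand b i e =>
    simp only [Cmd.timed, Bool.and_eq_true] at hc
    exact key b hc.1
  | seq c₁ c₂ ih₁ ih₂ =>
    simp only [Cmd.timed, Bool.and_eq_true] at hc
    simp only [Cmd.keepsNat, ih₁ hc.1, ih₂ hc.2, Bool.and_self]
  | ite b c₁ c₂ ih₁ ih₂ =>
    simp only [Cmd.timed, Bool.and_eq_true] at hc
    simp only [Cmd.keepsNat, ih₁ hc.1, ih₂ hc.2, Bool.and_self]
  | loop e c ih =>
    simp only [Cmd.timed, Bool.and_eq_true] at hc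
    exact ih hc.2

-- The arrays selected by `C` are never written, so the bounds on their cells persist throughout.
-- Every loop then multiplies the time of its body, plus one, by a polynomial in the input size.
open Polynomial in
theorem sat_time {C : ℕ → Bool} {π : ℕ → ℕ → ℕ[X]} {N : ℕ} {c : Cmd} (hc : c.timed C = true)
    (s : State) (hs : ∀ a i, C a = true → s.nat a i ≤ (π a i).eval N) :
    Sat (fun s' => s'.time ≤ s.time + (c.timePoly π).eval N) (c.exec f s) := by
  induction c generalizing s with
  | skip => exact Sat.pure (by simp [State.tick, Cmd.timePoly])
  | setNat b i e => exact Sat.pure (by simp [State.tick, State.writeNat, Cmd.timePoly])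
  | setReal b i r => exact Sat.pure (by simp [State.tick, State.writeReal, Cmd.timePoly])
  | query b i d => exact Sat.pure (by simp [State.tick, State.writeReal, Cmd.timePoly])
  | rand b i e =>
    simp only [Cmd.timed, Bool.and_eq_true] at hc
    refine Sat.map fun v => ?_
    have h1 := NExp.eval_le_polyBound hc.2 hs
    -- The bit length is estimated crudely by the number itself.
    have h2 : Nat.size (e.eval s) ≤ e.eval s := Nat.size_le.mpr Nat.lt_two_pow_self
    simp only [State.tick, State.writeNat, Cmd.timePoly, eval_add, eval_C]
    omega
  | seq c₁ c₂ ih₁ ih₂ =>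
    simp only [Cmd.timed, Bool.and_eq_true] at hc
    have hk : Sat (fun s' => ∀ a, C a = true → s'.nat a = s.nat a) (c₁.exec f s) :=
      fun s' hs' a ha => sat_keepsNat (Cmd.keepsNat_of_timed hc.1 ha) s s' hs'
    refine Sat.bind ((ih₁ hc.1 s hs).and hk) fun t ht => (ih₂ hc.2 t ?_).mono fun r hr => ?_
    · intro a i ha
      rw [ht.2 a ha]; exact hs a i ha
    · simp only [Cmd.timePoly, eval_add]
      have := ht.1
      omega
  | ite b c₁ c₂ ih₁ ih₂ =>
    simp only [Cmd.timed, Bool.and_eq_true] at hc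
    simp only [Cmd.exec, Cmd.timePoly, eval_add, eval_C]
    split_ifs
    · refine (ih₁ hc.1 (s.tick (b.cost + 1)) hs).mono fun r hr => ?_
      simp only [State.tick] at hr
      omega
    · refine (ih₂ hc.2 (s.tick (b.cost + 1)) hs).mono fun r hr => ?_
      simp only [State.tick] at hr
      omega
  | loop e c ih =>
    simp only [Cmd.timed, Bool.and_eq_true] at hc
    have key : ∀ (m : ℕ) (t : State), (∀ a, C a = true → t.nat a = s.nat a) →
        Sat (fun s' => s'.time ≤ t.time + m * ((c.timePoly π).eval N + 1))
          (rounds (c.exec f) m t) := by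
      intro m
      induction m with
      | zero => intro t _; exact Sat.pure (by simp)
      | succ m ihm =>
        intro t ht
        have hk : Sat (fun s' => ∀ a, C a = true → s'.nat a = t.nat a)
            (c.exec f (t.tick 1)) :=
          fun s' hs' a ha => sat_keepsNat (Cmd.keepsNat_of_timed hc.2 ha) (t.tick 1) s' hs'
        have h1 := ih hc.2 (t.tick 1) (fun a i ha => by
          show t.nat a i ≤ _
          rw [ht a ha]; exact hs a i ha)
        refine Sat.bind (h1.and hk) fun r hr => (ihm r fun a ha => ?_).mono fun q hq => ?_
        · rw [hr.2 a ha, ht a ha]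
        · have h2 := hr.1
          simp only [State.tick] at h2
          have : (m + 1) * (eval N (c.timePoly π) + 1)
              = m * (eval N (c.timePoly π) + 1) + (eval N (c.timePoly π) + 1) := by ring
          omega
    have h1 := NExp.eval_le_polyBound hc.1 hs
    refine (key (e.eval s) (s.tick (e.cost + 1)) fun _ _ => rfl).mono fun r hr => ?_
    simp only [State.tick] at hr
    simp only [Cmd.timePoly, eval_add, eval_C, eval_mul, eval_one]
    have := Nat.mul_le_mul_right ((c.timePoly π).eval N + 1) h1
    omega

/-! ### Loops -/

/-- Execute `c` with the counter `iv` running through `0, …, n - 1`. -/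
def forLoop (iv : ℕ) (c : Cmd) : Cmd :=
  .seq (.setNat iv (.lit 0) (.lit 0))
    (.loop (.get 0 (.lit 0))
      (.seq c (.setNat iv (.lit 0) (.add (.get iv (.lit 0)) (.lit 1)))))

/-- The states agree except for the natural array `iv` and the running time. -/
def AgreeOff (iv : ℕ) (s s' : State) : Prop :=
  (∀ b, b ≠ iv → s'.nat b = s.nat b) ∧ s'.real = s.real

theorem lift_rounds {α : Type*} {c : Cmd} {K : α → PMF α} {R : State → α → Prop}
    (htick : ∀ s a t, R s a → R (s.tick t) a) (h : ∀ s a, R s a → Lift R (c.exec f s) (K a))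
    (m : ℕ) {s : State} {a : α} (hs : R s a) : Lift R (rounds (c.exec f) m s) (piter K m a) := by
  induction m generalizing s a with
  | zero => exact Lift.pure hs
  | succ m ih => exact Lift.bind (h _ _ (htick _ _ _ hs)) fun s a hs => ih hs

/-- `R i` relates the states before round `i`; by `hR` it ignores the counter and the clock. As the
body preserves the counter and the array that holds `n`, the counter names the element that the
abstract fold treats. -/
theorem lift_forLoop {α : Type*} {iv : ℕ} {c : Cmd} {K : Fin n → α → PMF α}
    {R : ℕ → State → α → Prop} (hiv : iv ≠ 0) (hc : c.keepsNat iv = true)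
    (hc0 : c.keepsNat 0 = true) (hR : ∀ i s s' a, AgreeOff iv s s' → R i s a → R i s' a)
    (h : ∀ (u : Fin n) s a, R u s a → s.nat iv 0 = u → s.nat 0 0 = n →
      Lift (R (u + 1)) (c.exec f s) (K u a))
    {s : State} {a : α} (hn : s.nat 0 0 = n) (hs : R 0 s a) :
    Lift (R n) ((forLoop iv c).exec f s) (pfold K (List.finRange n) a) := by
  have key : ∀ (d i : ℕ), i + d = n → ∀ (s : State) (a : α), s.nat 0 0 = n → s.nat iv 0 = i →
      R i s a → Lift (R n) (rounds ((Cmd.seq c (.setNat iv (.lit 0)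
        (.add (.get iv (.lit 0)) (.lit 1)))).exec f) d s)
        (pfold K ((List.finRange n).drop i) a) := by
    intro d
    induction d with
    | zero =>
      intro i hi s a _ _ hs
      rw [List.drop_of_length_le (by simp; omega)]
      obtain rfl : i = n := by omega
      exact Lift.pure hs
    | succ d ih =>
      intro i hi s a h0 h1 hs
      rw [List.drop_eq_getElem_cons (by simp; omega)]
      simp only [pfold, rounds, Cmd.exec, PMF.bind_bind]
      set u := (List.finRange n)[i]'(by simp; omega) with hu
      have hui : (u : ℕ) = i := by simp [hu]
      have h2 := h u (s.tick 1) a (hR _ s _ _ ⟨fun _ _ => rfl, rfl⟩ (by rwa [hui]))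
        (by rw [hui]; exact h1) h0
      have h3 := (h2.and_support (sat_keepsNat hc _)).and_support (sat_keepsNat hc0 _)
      refine h3.bind fun t b ht => ?_
      rw [PMF.pure_bind]
      obtain ⟨⟨ht1, ht2⟩, ht3⟩ := ht
      refine ih (i + 1) (by omega) _ b ?_ ?_ ?_
      · simp [State.tick, State.writeNat, Function.update_of_ne hiv.symm, ht3, h0]
      · simp [State.tick, State.writeNat, NExp.eval, ht2, h1]
      · rw [← hui]
        exact hR _ t _ _ ⟨fun b hb => by
          simp [State.tick, State.writeNat, Function.update_of_ne hb], rfl⟩ ht1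
  -- The two ticks are the costs of initializing the counter and of entering the loop.
  have := key n 0 (by omega) (State.tick (State.tick (s.writeNat iv 0 0) 3) 3) a
    (by simp [State.tick, State.writeNat, Function.update_of_ne hiv.symm, hn])
    (by simp [State.tick, State.writeNat])
    (hR _ s _ _ ⟨fun b hb => by
      simp [State.tick, State.writeNat, Function.update_of_ne hb], rfl⟩ hs)
  rw [List.drop_zero] at this
  change Lift (R n) ((PMF.pure ((s.writeNat iv 0 0).tick 3)).bind fun s =>
    rounds ((Cmd.seq c (.setNat iv (.lit 0) (.add (.get iv (.lit 0)) (.lit 1)))).exec f)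
      (s.nat 0 0) (s.tick 3)) _
  rw [PMF.pure_bind]
  have e : ((s.writeNat iv 0 0).tick 3).nat 0 0 = n := by
    simp [State.tick, State.writeNat, Function.update_of_ne hiv.symm, hn]
  rw [e]
  exact this

theorem sat_forLoop {iv : ℕ} {c : Cmd} {R : ℕ → State → Prop} (hiv : iv ≠ 0)
    (hc : c.keepsNat iv = true) (hc0 : c.keepsNat 0 = true)
    (hR : ∀ i s s', AgreeOff iv s s' → R i s → R i s')
    (h : ∀ (u : Fin n) s, R u s → s.nat iv 0 = u → s.nat 0 0 = n →
      Sat (R (u + 1)) (c.exec f s))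
    {s : State} (hn : s.nat 0 0 = n) (hs : R 0 s) : Sat (R n) ((forLoop iv c).exec f s) := by
  have h1 := lift_forLoop (f := f) (K := fun _ (_ : Unit) => PMF.pure ())
    (R := fun i s _ => R i s) hiv hc hc0 (fun i s s' _ => hR i s s')
    (fun u s _ hs h1 h2 => (h u s hs h1 h2).lift) hn (a := ()) hs
  intro t ht
  obtain ⟨_, -, h2⟩ := h1.support t ht
  exact h2

end Semantics

end OracleRAM

end

noncomputable section

namespace OracleRAM

-- Memory layout. Natural arrays: 0 input, 1 output, 2 powers of n + 1, 3 singletons, 4 and 5 the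
-- sampled sets, 6 and 7 loop counters, 8 random number, 9 saved cell, 10 rank, 11 carried
-- coordinate. Real arrays: 0 the bound R, 1 query result, 2 and 3 the points y and x, 4 the weight,
-- 5 to 8 the sums, 9 scores, 10 the gap, 11 and 12 total masses, 13 the fractional solution, 14 to
-- 19 auxiliary values for mixing and rounding.
infixr:60 " ;; " => Cmd.seq

/-- The natural number variable `a`. -/
abbrev nv (a : ℕ) : NExp := .get a (.lit 0)

/-- The real number variable `a`. -/
abbrev rv (a : ℕ) : RExp := .get a (.lit 0)

/-- Assignment to a natural number variable. -/
abbrev letN (a : ℕ) (e : NExp) : Cmd := .setNat a (.lit 0) e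

/-- Assignment to a real number variable. -/
abbrev letR (a : ℕ) (r : RExp) : Cmd := .setReal a (.lit 0) r

/-- The program writes neither into the natural arrays `ns` nor into the real arrays `rs`. -/
def Cmd.keeps (ns rs : List ℕ) (c : Cmd) : Bool :=
  ns.all (fun a => c.keepsNat a) && rs.all fun a => c.keepsReal a

section Pieces

variable {n : ℕ} {f : Finset (Fin n) → ℝ}

theorem sat_keeps {ns rs : List ℕ} {c : Cmd} (h : c.keeps ns rs = true) (s : State) :
    Sat (fun s' => (∀ a ∈ ns, s'.nat a = s.nat a) ∧ ∀ a ∈ rs, s'.real a = s.real a)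
      (c.exec f s) := by
  simp only [Cmd.keeps, Bool.and_eq_true, List.all_eq_true] at h
  exact fun s' hs' => ⟨fun a ha => sat_keepsNat (h.1 a ha) s s' hs',
    fun a ha => sat_keepsReal (h.2 a ha) s s' hs'⟩

theorem sat_rounds_index {step : State → PMF State} {Q : ℕ → State → Prop}
    (h : ∀ i s, Q i s → Sat (Q (i + 1)) (step (s.tick 1))) (m i : ℕ) {s : State} (hs : Q i s) :
    Sat (Q (i + m)) (rounds step m s) := by
  induction m generalizing i s with
  | zero => exact Sat.pure hs
  | succ m ih =>
    refine Sat.bind (h i s hs) fun s hs => ?_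
    rw [show i + (m + 1) = i + 1 + m by omega]
    exact ih (i + 1) hs

/-! ### Powers of `n + 1` -/

/-- Store `n + 1` times the cell `j` of the natural array `2` in the cell `j + 1`. -/
def powStep (j : ℕ) : Cmd :=
  .setNat 2 (.lit (j + 1)) (.get 2 (.lit j)) ;;
    .loop (nv 0) (.setNat 2 (.lit (j + 1)) (.add (.get 2 (.lit (j + 1))) (.get 2 (.lit j))))

/-- Store the powers of `n + 1` up to the exponent `J` in the natural array `2`. -/
def powers : ℕ → Cmd
  | 0 => .setNat 2 (.lit 0) (.lit 1)
  | J + 1 => powers J ;; powStep J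

/-- The machine cannot multiply natural numbers, so n additions are made to a copy of the previous
power. -/
theorem sat_powStep (j : ℕ) {s : State} (hn : s.nat 0 0 = n) :
    Sat (fun s' => (s'.nat 2 (j + 1) = (n + 1) * s.nat 2 j ∧ ∀ i, i ≠ j + 1 → s'.nat 2 i = s.nat 2 i)
      ∧ s'.nat 0 = s.nat 0) ((powStep j).exec f s) := by
  refine Sat.and ?_ (sat_keepsNat rfl s)
  simp only [powStep, Cmd.exec, PMF.pure_bind]
  have h := sat_rounds_index (step := (Cmd.setNat 2 (.lit (j + 1))
      (.add (.get 2 (.lit (j + 1))) (.get 2 (.lit j)))).exec f)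
    (Q := fun i t => t.nat 2 (j + 1) = (i + 1) * s.nat 2 j ∧
      ∀ i, i ≠ j + 1 → t.nat 2 i = s.nat 2 i)
    (fun i t ht => Sat.pure (by
      obtain ⟨h1, h2⟩ := ht
      have h3 := h2 j (by omega)
      refine ⟨?_, fun i hi => ?_⟩
      · simp [State.tick, State.writeNat, NExp.eval, h1, h3]; ring
      · simp [State.tick, State.writeNat, NExp.eval, Function.update_of_ne hi, h2 i hi])) n 0
    (s := ((s.writeNat 2 (j + 1) (s.nat 2 j)).tick 4).tick 3)
    ⟨by simp [State.tick, State.writeNat], fun i hi => by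
      simp [State.tick, State.writeNat, Function.update_of_ne hi]⟩
  rw [zero_add] at h
  have e : NExp.eval (State.tick (s.writeNat 2 (NExp.eval s (.lit (j + 1)))
      (NExp.eval s (.get 2 (.lit j)))) (NExp.cost (.lit (j + 1)) + NExp.cost (.get 2 (.lit j)) + 1))
      (nv 0) = n := by
    simp [State.tick, State.writeNat, NExp.eval, hn]
  rw [e]
  exact h

theorem sat_powers (J : ℕ) {s : State} (hn : s.nat 0 0 = n) (h0 : ∀ i, s.nat 2 i = 0) :
    Sat (fun s' => (∀ i, s'.nat 2 i = if i ≤ J then (n + 1) ^ i else 0) ∧ s'.nat 0 = s.nat 0)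
      ((powers J).exec f s) := by
  induction J with
  | zero =>
    refine Sat.pure ⟨fun i => ?_, ?_⟩
    · rcases Nat.eq_zero_or_pos i with rfl | hi
      · simp [State.tick, State.writeNat, NExp.eval]
      · simp [State.tick, State.writeNat, NExp.eval, h0, hi.ne']
    · simp [State.tick, State.writeNat]
  | succ J ih =>
    refine Sat.bind ih fun t ht => (sat_powStep J (by rw [ht.2]; exact hn)).mono fun r hr => ?_
    refine ⟨fun i => ?_, hr.2.trans ht.2⟩
    by_cases hi : i = J + 1
    · subst hi
      rw [hr.1.1, ht.1]
      simp [pow_succ, mul_comm]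
    · rw [hr.1.2 i hi, ht.1]
      have : i ≤ J ↔ i ≤ J + 1 := by omega
      simp only [this]

/-! ### Stored sets -/

theorem mem_storedSet {s : State} {b : ℕ} {u : Fin n} : u ∈ s.storedSet n b ↔ s.nat b u ≠ 0 := by
  simp [State.storedSet]

theorem storedSet_congr {s s' : State} {b : ℕ} (h : s'.nat b = s.nat b) :
    s'.storedSet n b = s.storedSet n b := by
  unfold State.storedSet; rw [h]

/-! ### The upper bound on the function values -/

/-- Compute `f ∅ + ∑ u, f {u}` in the real variable `0`. -/
def boundCmd : Cmd :=
  .query 0 (.lit 0) 3 ;;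
    forLoop 6 (.setNat 3 (nv 6) (.lit 1) ;; .query 1 (.lit 0) 3 ;; letR 0 (.add (rv 0) (rv 1)) ;;
      .setNat 3 (nv 6) (.lit 0))

/-- Loop invariants express accumulated sums as sums over all indices, with those not yet treated
contributing 0. -/
theorem sum_lt_succ {β : Type*} [AddCommMonoid β] (g : Fin n → β) (u : Fin n) :
    ∑ v, (if v.val < u.val + 1 then g v else 0) = (∑ v, if v.val < u.val then g v else 0) + g u := by
  have h : ∀ v : Fin n, (if v.val < u.val + 1 then g v else 0)
      = (if v.val < u.val then g v else 0) + if v = u then g v else 0 := by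
    intro v
    rcases lt_trichotomy v u with h | rfl | h
    · have h' : v.val < u.val := h
      simp [h', h.ne, Nat.lt_succ_of_lt h']
    · simp
    · have h' : u.val < v.val := h
      have h1 : ¬ v.val < u.val := by omega
      have h2 : ¬ v.val < u.val + 1 := by omega
      simp [h1, h2, h.ne']
  simp only [h, Finset.sum_add_distrib]
  simp

theorem sum_lt_all {β : Type*} [AddCommMonoid β] (g : Fin n → β) : ∑ v, (if v.val < n then g v else 0) = ∑ v, g v :=
  Finset.sum_congr rfl fun v _ => if_pos v.isLt

theorem sat_boundCmd {s : State} (hn : s.nat 0 0 = n) (h3 : ∀ i, s.nat 3 i = 0) :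
    Sat (fun s' => s'.real 0 0 = f ∅ + ∑ u, f {u}) (boundCmd.exec f s) := by
  simp only [boundCmd]
  rw [Cmd.exec, Cmd.exec, PMF.pure_bind]
  have hset : ∀ (t : State), (∀ i, t.nat 3 i = 0) → t.storedSet n 3 = ∅ := fun t ht => by
    ext u; simp [mem_storedSet, ht]
  refine (sat_forLoop (f := f) (R := fun i t => (∀ i, t.nat 3 i = 0) ∧
    t.real 0 0 = f ∅ + ∑ u : Fin n, if u.val < i then f {u} else 0) (by decide) rfl rfl
    ?_ ?_ (s := _) ?_ ?_).mono fun t ht => ?_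
  · rintro i s s' ⟨h1, h2⟩ ⟨h4, h5⟩
    rw [h1 3 (by decide), h2]
    exact ⟨h4, h5⟩
  · rintro u t ⟨h4, h5⟩ hu -
    simp only [Cmd.exec, PMF.pure_bind]
    refine Sat.pure ⟨fun i => ?_, ?_⟩
    · by_cases hi : i = u
      · subst hi
        simp [State.tick, State.writeNat, State.writeReal, NExp.eval, hu]
      · simp [State.tick, State.writeNat, State.writeReal, NExp.eval, hu,
          Function.update_of_ne hi, h4]
    · rw [sum_lt_succ]
      have e : State.storedSet (State.tick (t.writeNat 3 (NExp.eval t (nv 6)) (NExp.eval t (.lit 1)))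
          (NExp.cost (nv 6) + NExp.cost (.lit 1) + 1)) n 3 = {u} := by
        ext v
        rw [mem_storedSet]
        by_cases hv : v = u
        · subst hv
          simp [State.tick, State.writeNat, NExp.eval, hu]
        · have : (v : ℕ) ≠ u := fun h => hv (Fin.ext h)
          simp [State.tick, State.writeNat, NExp.eval, hu, Function.update_of_ne this, h4, hv]
      rw [e]
      simp [State.tick, State.writeNat, State.writeReal, NExp.eval, RExp.eval, h5, add_assoc]
  · simpa [State.tick, State.writeReal] using hn
  · refine ⟨fun i => by simpa [State.tick, State.writeReal] using h3 i, ?_⟩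
    rw [hset s h3]
    simp [State.tick, State.writeReal, NExp.eval]
  · rw [ht.2, sum_lt_all]

/-! ### Sampling -/

/-- Sample a random set into the natural array `arr`; the probabilities are in the real array
`pr`. -/
def sampleCmd (arr pr : ℕ) : Cmd :=
  forLoop 6 (.rand 8 (.lit 0) (.get 2 (.lit 6)) ;;
    .ite (.realLE (.mul (.get pr (nv 6)) (.add (.ofNat (.get 2 (.lit 6))) (.ofNat (.lit 1))))
        (.ofNat (nv 8)))
      (.setNat arr (nv 6) (.lit 0)) (.setNat arr (nv 6) (.lit 1)))

open Classical in
theorem lift_rand {a m : ℕ} {i e : NExp} {s : State} (he : e.eval s = m) (θ : ℝ) :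
    Lift (fun s' b => ∃ v t : ℕ, s' = (s.writeNat a (i.eval s) v).tick t ∧
      b = decide (¬ θ * ((m : ℝ) + 1) ≤ v)) ((Cmd.rand a i e).exec f s) (bern m θ) := by
  subst he
  exact Lift.map_same _ fun v => ⟨v.val, _, rfl, rfl⟩

/-- The array may still hold an older sample while the abstract process starts from ∅. The invariant
therefore speaks only of cells already treated; in the end all have been overwritten. -/
theorem lift_sampleCmd {arr pr m : ℕ} {y : Fin n → ℝ} (h6 : Nat.beq arr 6 = false)
    (h0 : Nat.beq arr 0 = false) (h2 : Nat.beq arr 2 = false) (h8 : Nat.beq arr 8 = false)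
    {s : State} (hn : s.nat 0 0 = n) (hm : s.nat 2 6 = m)
    (hy : ∀ u : Fin n, s.real pr u = y u) :
    Lift (fun s' S => s'.storedSet n arr = S) ((sampleCmd arr pr).exec f s)
      (sample m y (List.finRange n) ∅) := by
  have ne : ∀ {a b : ℕ}, Nat.beq a b = false → a ≠ b := fun h => by
    rintro rfl; simp at h
  refine (lift_forLoop (f := f) (R := fun i t S => t.nat 2 6 = m ∧
    (∀ u : Fin n, t.real pr u = y u) ∧
    ∀ u : Fin n, u.val < i → (t.nat arr u ≠ 0 ↔ u ∈ S)) (by decide)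
    (by simp only [Cmd.keepsNat, h6]; rfl)
    (by simp only [Cmd.keepsNat, h0]; rfl) ?_ ?_ hn
    ⟨hm, hy, fun u hu => absurd hu (Nat.not_lt_zero _)⟩).mono fun t S ht => ?_
  · rintro i s s' S ⟨h1, h3⟩ ⟨h4, h5, h7⟩
    rw [h1 2 (by decide), h1 arr (ne h6), h3]
    exact ⟨h4, h5, h7⟩
  · rintro u t S ⟨h4, h5, h7⟩ hu -
    rw [Cmd.exec, PMF.map]
    refine (lift_rand (s := t) (e := .get 2 (.lit 6)) (m := m) h4 (y u)).bind ?_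
    · rintro _ _ ⟨v, T, rfl, rfl⟩
      simp only [Function.comp]
      have hθ : Test.Holds (State.tick (t.writeNat 8 (NExp.eval t (.lit 0)) v) T)
          (.realLE (.mul (.get pr (nv 6)) (.add (.ofNat (.get 2 (.lit 6))) (.ofNat (.lit 1))))
            (.ofNat (nv 8))) ↔ y u * ((m : ℝ) + 1) ≤ v := by
        simp [Test.Holds, RExp.eval, NExp.eval, State.tick, State.writeNat, hu, h5, h4]
      simp only [Cmd.exec]
      have hfin : ∀ (val : ℕ) (S' : Finset (Fin n)), (∀ w, w ≠ u → (w ∈ S' ↔ w ∈ S)) →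
          (val ≠ 0 ↔ u ∈ S') → ∀ (t' : State), t'.real = t.real → t'.nat 2 = t.nat 2 →
          t'.nat arr = Function.update (t.nat arr) u val →
          (t'.nat 2 6 = m ∧ (∀ u : Fin n, t'.real pr u = y u) ∧
            ∀ w : Fin n, w.val < u.val + 1 → (t'.nat arr w ≠ 0 ↔ w ∈ S')) := by
        intro val S' hS' hval t' e1 e2 e3
        refine ⟨by rw [e2, h4], fun w => by rw [e1, h5], fun w hw => ?_⟩
        rw [e3]
        by_cases hwu : w = u
        · subst hwu
          rw [Function.update_self]; exact hval
        · have : (w : ℕ) ≠ u := fun h => hwu (Fin.ext h)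
          rw [Function.update_of_ne this, h7 w (by omega), hS' w hwu]
      by_cases hc : y u * ((m : ℝ) + 1) ≤ v
      · rw [if_pos (hθ.mpr hc)]
        refine Lift.pure (hfin 0 _ ?_ ?_ _ rfl ?_ ?_)
        · intro w hw; simp [hc, hw]
        · simp [hc]
        · simp [State.tick, State.writeNat, Function.update_of_ne (ne h2).symm]
        · simp [State.tick, State.writeNat, NExp.eval, hu, Function.update_of_ne (ne h8)]
      · rw [if_neg (fun h => hc (hθ.mp h))]
        refine Lift.pure (hfin 1 _ ?_ ?_ _ rfl ?_ ?_)
        · intro w hw; simp [hc, hw]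
        · simp [hc]
        · simp [State.tick, State.writeNat, Function.update_of_ne (ne h2).symm]
        · simp [State.tick, State.writeNat, NExp.eval, hu, Function.update_of_ne (ne h8)]
  · ext u
    rw [mem_storedSet]
    exact ht.2.2 u u.isLt

end Pieces

end OracleRAM

end

noncomputable section

namespace OracleRAM

section Accumulate

variable {n : ℕ} {f : Finset (Fin n) → ℝ}

/-! ### Accumulating function values -/

/-- For every element `u`, add to the cell `u` of the real array `acc` the function value of the
set in the natural array `arr` with the cell `u` changed to `val`. -/
def probeCmd (arr val acc : ℕ) : Cmd :=
  forLoop 6 (letN 9 (.get arr (nv 6)) ;; .setNat arr (nv 6) (.lit val) ;; .query 1 (.lit 0) arr ;;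
    .setReal acc (nv 6) (.add (.get acc (nv 6)) (rv 1)) ;; .setNat arr (nv 6) (nv 9))

/-- The changed cell is saved and restored, so every round starts from the same set. `G` covers
insertion (`val = 1`) and erasure (`val = 0`). -/
theorem sat_probeCmd {arr val acc : ℕ} (h6 : Nat.beq arr 6 = false) (h0 : Nat.beq arr 0 = false)
    (h9 : Nat.beq arr 9 = false) (h1 : Nat.beq acc 1 = false)
    {A : Finset (Fin n)} {G : Fin n → Finset (Fin n)}
    (hG : ∀ u v, (v ∈ G u ↔ (v ≠ u ∧ v ∈ A) ∨ (v = u ∧ val ≠ 0)))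
    {s : State} (hn : s.nat 0 0 = n) (hA : s.storedSet n arr = A) :
    Sat (fun s' => ∀ u : Fin n, s'.real acc u = s.real acc u + f (G u))
      ((probeCmd arr val acc).exec f s) := by
  have ne : ∀ {a b : ℕ}, Nat.beq a b = false → a ≠ b := fun h => by
    rintro rfl; simp at h
  refine (sat_forLoop (f := f) (R := fun i t => t.nat arr = s.nat arr ∧
    (∀ u : Fin n, u.val < i → t.real acc u = s.real acc u + f (G u)) ∧
    ∀ u : Fin n, i ≤ u.val → t.real acc u = s.real acc u) (by decide)
    (by simp only [Cmd.keepsNat, h6]; rfl) (by simp only [Cmd.keepsNat, h0]; rfl) ?_ ?_ hn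
    ⟨rfl, fun u hu => absurd hu (Nat.not_lt_zero _), fun u _ => rfl⟩).mono
      fun t ht u => ht.2.1 u u.isLt
  · rintro i t t' ⟨h3, h4⟩ ⟨h5, h7⟩
    rw [h3 arr (ne h6), h4]
    exact ⟨h5, h7⟩
  · rintro u t ⟨h5, h7, h8⟩ hu -
    simp only [Cmd.exec, PMF.pure_bind]
    set t₂ := State.tick ((State.tick (t.writeNat 9 (NExp.eval t (.lit 0))
      (NExp.eval t (.get arr (nv 6)))) (NExp.cost (.lit 0) + NExp.cost (.get arr (nv 6)) + 1)).writeNat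
      arr _ _) _ with ht₂
    have hset : t₂.storedSet n arr = G u := by
      ext v
      rw [mem_storedSet, hG, ← hA, mem_storedSet]
      by_cases hv : v = u
      · subst hv
        simp [ht₂, State.tick, State.writeNat, NExp.eval, hu]
      · have : (v : ℕ) ≠ u := fun h => hv (Fin.ext h)
        simp [ht₂, State.tick, State.writeNat, NExp.eval, hu, hv, this, Function.update_of_ne (ne h9),
          h5]
    have hreal : t₂.real = t.real := rfl
    have h60 : t₂.nat 6 0 = u := by
      simp [ht₂, State.tick, State.writeNat, hu, Function.update_of_ne (ne h6).symm]
    have harr : t₂.nat arr = Function.update (s.nat arr) u val := by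
      simp [ht₂, State.tick, State.writeNat, NExp.eval, hu, Function.update_of_ne (ne h9), h5]
    have h90 : t₂.nat 9 0 = s.nat arr u := by
      simp [ht₂, State.tick, State.writeNat, NExp.eval, hu, Function.update_of_ne (ne h9).symm, h5]
    rw [hset]
    clear_value t₂
    refine Sat.pure ⟨?_, fun v hv => ?_, fun v hv => ?_⟩
    · simp [State.tick, State.writeNat, State.writeReal, NExp.eval, h60, harr, h90]
    · by_cases hvu : v = u
      · subst hvu
        simp [State.tick, State.writeNat, State.writeReal, NExp.eval, RExp.eval, h60, hreal,
          Function.update_of_ne (ne h1), h8]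
      · have : (v : ℕ) ≠ u := fun h => hvu (Fin.ext h)
        simp [State.tick, State.writeNat, State.writeReal, NExp.eval, h60, hreal,
          Function.update_of_ne (ne h1), Function.update_of_ne this, h7 v (by omega)]
    · have : (v : ℕ) ≠ u := by omega
      simp [State.tick, State.writeNat, State.writeReal, NExp.eval, h60, hreal,
        Function.update_of_ne (ne h1), Function.update_of_ne this, h8 v (by omega)]

/-- The parameters: `n`, `k`, the powers of `n + 1` and the bound on the function values. -/
structure Ctx (n k : ℕ) (R : ℝ) (s : State) : Prop where
  n_eq : s.nat 0 0 = n
  k_eq : s.nat 0 1 = k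
  pow_eq : ∀ i ≤ 20, s.nat 2 i = (n + 1) ^ i
  bound_eq : s.real 0 0 = R

/-- The memory holds the pair `st`. -/
structure HoldsPair (st : Pair n) (s : State) : Prop where
  y : ∀ u : Fin n, s.real 2 u = st.y u
  x : ∀ u : Fin n, s.real 3 u = st.x u
  lam : s.real 4 0 = st.lam

/-- The memory holds the sums `q`. -/
structure HoldsSums (q : Sums n) (s : State) : Prop where
  a0 : s.real 7 0 = q.a0
  b0 : s.real 8 0 = q.b0
  a : ∀ u : Fin n, s.real 5 u = q.a u
  b : ∀ u : Fin n, s.real 6 u = q.b u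

theorem Ctx.congr {k : ℕ} {R : ℝ} {s s' : State} (h : Ctx n k R s) (h0 : s'.nat 0 = s.nat 0)
    (h2 : s'.nat 2 = s.nat 2) (hr : s'.real 0 = s.real 0) : Ctx n k R s' :=
  ⟨by rw [h0, h.n_eq], by rw [h0, h.k_eq], fun i hi => by rw [h2, h.pow_eq i hi],
    by rw [hr, h.bound_eq]⟩

theorem HoldsPair.congr {st : Pair n} {s s' : State} (h : HoldsPair st s)
    (h2 : s'.real 2 = s.real 2) (h3 : s'.real 3 = s.real 3) (h4 : s'.real 4 = s.real 4) :
    HoldsPair st s' :=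
  ⟨fun u => by rw [h2, h.y], fun u => by rw [h3, h.x], by rw [h4, h.lam]⟩

theorem HoldsSums.congr {q : Sums n} {s s' : State} (h : HoldsSums q s)
    (h5 : s'.real 5 = s.real 5) (h6 : s'.real 6 = s.real 6) (h7 : s'.real 7 = s.real 7)
    (h8 : s'.real 8 = s.real 8) : HoldsSums q s' :=
  ⟨by rw [h7, h.a0], by rw [h8, h.b0], fun u => by rw [h5, h.a], fun u => by rw [h6, h.b]⟩

theorem sat_ctx {k : ℕ} {R : ℝ} {c : Cmd} (hc : c.keeps [0, 2] [0] = true) {s : State}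
    (h : Ctx n k R s) : Sat (Ctx n k R) (c.exec f s) :=
  (sat_keeps hc s).mono fun _ ht =>
    h.congr (ht.1 0 (by simp)) (ht.1 2 (by simp)) (ht.2 0 (by simp))

theorem sat_holdsPair {st : Pair n} {c : Cmd} (hc : c.keeps [] [2, 3, 4] = true) {s : State}
    (h : HoldsPair st s) : Sat (HoldsPair st) (c.exec f s) :=
  (sat_keeps hc s).mono fun _ ht =>
    h.congr (ht.2 2 (by simp)) (ht.2 3 (by simp)) (ht.2 4 (by simp))

theorem sat_holdsSums {q : Sums n} {c : Cmd} (hc : c.keeps [] [5, 6, 7, 8] = true) {s : State}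
    (h : HoldsSums q s) : Sat (HoldsSums q) (c.exec f s) :=
  (sat_keeps hc s).mono fun _ ht =>
    h.congr (ht.2 5 (by simp)) (ht.2 6 (by simp)) (ht.2 7 (by simp)) (ht.2 8 (by simp))

theorem sat_storedSet {b : ℕ} {A : Finset (Fin n)} {c : Cmd} (hc : c.keepsNat b = true) {s : State}
    (h : s.storedSet n b = A) : Sat (fun s' => s'.storedSet n b = A) (c.exec f s) :=
  (sat_keepsNat hc s).mono fun _ ht => (storedSet_congr ht).trans h

/-- Add the values of the sampled sets. -/
def tallyCmd : Cmd :=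
  .query 1 (.lit 0) 4 ;; letR 7 (.add (rv 7) (rv 1)) ;;
    .query 1 (.lit 0) 5 ;; letR 8 (.add (rv 8) (rv 1))

/-- One round of sampling. -/
def accCmd : Cmd :=
  sampleCmd 4 2 ;; sampleCmd 5 3 ;; tallyCmd ;; probeCmd 4 1 5 ;; probeCmd 5 0 6

theorem sat_tallyCmd {q : Sums n} {A B : Finset (Fin n)} {s : State} (h : HoldsSums q s)
    (hA : s.storedSet n 4 = A) (hB : s.storedSet n 5 = B) :
    Sat (HoldsSums { q with a0 := q.a0 + f A, b0 := q.b0 + f B }) (tallyCmd.exec f s) := by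
  simp only [tallyCmd, Cmd.exec, PMF.pure_bind]
  have e1 : ∀ (r : ℝ) (i j t t' : ℕ) (v : ℝ), State.storedSet (State.tick (State.writeReal
      (State.tick (s.writeReal 1 i r) t) 7 j v) t') n 5 = B := fun _ _ _ _ _ _ => hB
  rw [hA]
  refine Sat.pure ⟨?_, ?_, fun u => ?_, fun u => ?_⟩
  · simp [State.tick, State.writeReal, NExp.eval, RExp.eval, h.a0]
  · rw [e1]
    simp [State.tick, State.writeReal, NExp.eval, RExp.eval, h.b0]
  · simp [State.tick, State.writeReal, h.a]
  · simp [State.tick, State.writeReal, h.b]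

theorem lift_accCmd {k : ℕ} {R : ℝ} {st : Pair n} {q : Sums n} {s : State} (hc : Ctx n k R s)
    (hp : HoldsPair st s) (hq : HoldsSums q s) :
    Lift (fun s' q' => Ctx n k R s' ∧ HoldsPair st s' ∧ HoldsSums q' s') (accCmd.exec f s)
      (accRound f ((n + 1) ^ 6) st.y st.x q) := by
  simp only [accCmd]
  rw [Cmd.exec, accRound]
  refine Lift.bind ((((lift_sampleCmd (f := f) rfl rfl rfl rfl hc.n_eq (hc.pow_eq 6 (by norm_num))
    hp.y).and_support (sat_ctx rfl hc)).and_support (sat_holdsPair rfl hp)).and_support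
    (sat_holdsSums rfl hq)) ?_
  rintro s A ⟨⟨⟨hA, hc⟩, hp⟩, hq⟩
  rw [Cmd.exec]
  refine Lift.bind (((((lift_sampleCmd (f := f) rfl rfl rfl rfl hc.n_eq
    (hc.pow_eq 6 (by norm_num)) hp.x).and_support (sat_ctx rfl hc)).and_support
    (sat_holdsPair rfl hp)).and_support (sat_holdsSums rfl hq)).and_support
    (sat_storedSet (b := 4) rfl hA)) ?_
  rintro s B ⟨⟨⟨⟨hB, hc⟩, hp⟩, hq⟩, hA⟩
  -- Both samples are drawn; the rest of the round is deterministic.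
  refine Sat.lift ?_
  rw [Cmd.exec]
  refine Sat.bind (((((sat_tallyCmd hq hA hB).and (sat_ctx rfl hc)).and (sat_holdsPair rfl hp)).and
    (sat_storedSet (b := 4) rfl hA)).and (sat_storedSet (b := 5) rfl hB)) ?_
  rintro s ⟨⟨⟨⟨hq, hc⟩, hp⟩, hA⟩, hB⟩
  rw [Cmd.exec]
  refine Sat.bind (((((sat_probeCmd (f := f) (val := 1) (acc := 5) rfl rfl rfl rfl
    (G := fun u => insert u A) (fun u v => by
      by_cases h : v = u <;> simp [h]) hc.n_eq hA).and (sat_ctx rfl hc)).and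
    (sat_holdsPair rfl hp)).and (sat_storedSet (b := 5) rfl hB)).and
    (sat_keeps (ns := []) (rs := [6, 7, 8]) rfl s)) ?_
  rintro t ⟨⟨⟨⟨ha, hc⟩, hp⟩, hB⟩, -, hk⟩
  refine ((((sat_probeCmd (f := f) (val := 0) (acc := 6) rfl rfl rfl rfl
    (G := fun u => B.erase u) (fun u v => by
      by_cases h : v = u <;> simp [h]) hc.n_eq hB).and (sat_ctx rfl hc)).and
    (sat_holdsPair rfl hp)).and (sat_keeps (ns := []) (rs := [5, 7, 8]) rfl t)).mono ?_
  rintro r ⟨⟨⟨hb, hc⟩, hp⟩, -, hk'⟩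
  refine ⟨hc, hp, ?_, ?_, fun u => ?_, fun u => ?_⟩
  · rw [hk' 7 (by simp), hk 7 (by simp), hq.a0]; rfl
  · rw [hk' 8 (by simp), hk 8 (by simp), hq.b0]; rfl
  · rw [hk' 5 (by simp), ha, hq.a]; rfl
  · rw [hb, hk 6 (by simp), hq.b]; rfl

/-- Set all sums to zero. -/
def resetCmd : Cmd :=
  letR 7 (.ofNat (.lit 0)) ;; letR 8 (.ofNat (.lit 0)) ;;
    forLoop 6 (.setReal 5 (nv 6) (.ofNat (.lit 0)) ;; .setReal 6 (nv 6) (.ofNat (.lit 0)))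

theorem sat_resetCmd {s : State} (hn : s.nat 0 0 = n) :
    Sat (HoldsSums (Sums.zero n)) (resetCmd.exec f s) := by
  simp only [resetCmd]
  rw [Cmd.exec, Cmd.exec, PMF.pure_bind, Cmd.exec, Cmd.exec, PMF.pure_bind]
  refine (sat_forLoop (f := f) (R := fun i t => t.real 7 0 = 0 ∧ t.real 8 0 = 0 ∧
    ∀ u : Fin n, u.val < i → t.real 5 u = 0 ∧ t.real 6 u = 0) (by decide) rfl rfl
    ?_ ?_ (s := _) ?_ ?_).mono fun t ht => ?_
  · rintro i s s' ⟨h1, h2⟩ h4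
    rwa [h2]
  · rintro u t ⟨h4, h5, h7⟩ hu -
    simp only [Cmd.exec, PMF.pure_bind]
    refine Sat.pure ⟨?_, ?_, fun v hv => ?_⟩
    · simpa [State.tick, State.writeReal] using h4
    · simpa [State.tick, State.writeReal] using h5
    · by_cases hvu : v = u
      · subst hvu
        simp [State.tick, State.writeReal, NExp.eval, RExp.eval, hu]
      · have : (v : ℕ) ≠ u := fun h => hvu (Fin.ext h)
        simp [State.tick, State.writeReal, NExp.eval, RExp.eval, hu, Function.update_of_ne this,
          h7 v (by omega)]
  · simpa [State.tick, State.writeReal] using hn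
  · refine ⟨?_, ?_, fun u hu => absurd hu (Nat.not_lt_zero _)⟩
    · simp [State.tick, State.writeReal, NExp.eval, RExp.eval]
    · simp [State.tick, State.writeReal, NExp.eval, RExp.eval]
  · exact ⟨ht.1, ht.2.1, fun u => (ht.2.2 u u.isLt).1, fun u => (ht.2.2 u u.isLt).2⟩

end Accumulate

end OracleRAM

end

noncomputable section

namespace OracleRAM

section Main

variable {n : ℕ} {f : Finset (Fin n) → ℝ}

/-! ### Selecting the elements of largest score -/

/-- `r` is evaluated in changing states; `h` asks for the right value whenever only the counter
array and the array being filled differ from the start. -/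
theorem sat_fill {arr : ℕ} {r : RExp} {g : Fin n → ℝ} {s : State} (hn : s.nat 0 0 = n)
    (h : ∀ (u : Fin n) (t : State), t.nat 6 0 = u → (∀ a, a ≠ 6 → t.nat a = s.nat a) →
      (∀ a, a ≠ arr → t.real a = s.real a) → r.eval t = g u) :
    Sat (fun s' => ∀ u : Fin n, s'.real arr u = g u)
      ((forLoop 6 (.setReal arr (nv 6) r)).exec f s) := by
  refine (sat_forLoop (f := f) (R := fun i t => (∀ a, a ≠ 6 → t.nat a = s.nat a) ∧
    (∀ a, a ≠ arr → t.real a = s.real a) ∧ ∀ u : Fin n, u.val < i → t.real arr u = g u)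
    (by decide) rfl rfl ?_ ?_ hn ⟨fun _ _ => rfl, fun _ _ => rfl,
      fun u hu => absurd hu (Nat.not_lt_zero _)⟩).mono fun t ht u => ht.2.2 u u.isLt
  · rintro i t t' ⟨h1, h2⟩ ⟨h3, h4, h5⟩
    rw [h2]
    exact ⟨fun a ha => (h1 a ha).trans (h3 a ha), h4, h5⟩
  · rintro u t ⟨h3, h4, h5⟩ hu -
    refine Sat.pure ⟨h3, fun a ha => ?_, fun v hv => ?_⟩
    · simp [State.tick, State.writeReal, Function.update_of_ne ha, h4 a ha]
    · by_cases hvu : v = u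
      · subst hvu
        simp [State.tick, State.writeReal, NExp.eval, hu, h v t hu h3 h4]
      · have : (v : ℕ) ≠ u := fun h => hvu (Fin.ext h)
        simp [State.tick, State.writeReal, NExp.eval, hu, Function.update_of_ne this,
          h5 v (by omega)]

/-- Compute the scores. -/
def scoreCmd : Cmd :=
  forLoop 6 (.setReal 9 (nv 6) (.sub (.mul (rv 4) (.sub (.get 5 (nv 6)) (rv 7)))
    (.mul (.sub (.ofNat (.lit 1)) (rv 4)) (.sub (.get 6 (nv 6)) (rv 8)))))

theorem sat_scoreCmd {st : Pair n} {q : Sums n} {s : State} (hn : s.nat 0 0 = n)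
    (hp : HoldsPair st s) (hq : HoldsSums q s) :
    Sat (fun s' => ∀ u : Fin n, s'.real 9 u = scores st.lam q u) (scoreCmd.exec f s) :=
  sat_fill hn fun u t hu _ hr => by
    simp [RExp.eval, NExp.eval, hr, hu, hp.lam, hq.a0, hq.b0, hq.a, hq.b, scores]

/-- Increase the natural variable `10`. -/
def incCmd : Cmd := letN 10 (.add (nv 10) (.lit 1))

/-- Increase the natural variable `10` if the element in the variable `7` precedes the one in the
variable `6`. -/
def compareCmd : Cmd :=
  .ite (.realLE (.get 9 (nv 7)) (.get 9 (nv 6)))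
    (.ite (.realLE (.get 9 (nv 6)) (.get 9 (nv 7)))
      (.ite (.natLE (.add (nv 7) (.lit 1)) (nv 6)) incCmd .skip) .skip) incCmd

/-- Compute the number of elements that precede the one in the natural variable `6`. -/
def rankCmd : Cmd := letN 10 (.lit 0) ;; forLoop 7 compareCmd

open Classical in
theorem sat_compareCmd {sc : Fin n → ℝ} {u v : Fin n} {s : State} (hu : s.nat 6 0 = u)
    (hv : s.nat 7 0 = v) (hsc : ∀ u : Fin n, s.real 9 u = sc u) :
    Sat (fun s' => s'.nat 10 0 = s.nat 10 0 + if Precedes sc v u then 1 else 0)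
      (compareCmd.exec f s) := by
  have h1 : Sat (fun s' => s'.nat 10 0 = s.nat 10 0 + 1) (incCmd.exec f s) :=
    Sat.pure (by simp [State.tick, State.writeNat, NExp.eval])
  simp only [compareCmd, incCmd, Cmd.exec, Test.Holds, RExp.eval, NExp.eval, State.tick, hu, hv, hsc]
  by_cases a : sc v ≤ sc u
  · by_cases b : sc u ≤ sc v
    · by_cases c : v < u
      · have c' : (v : ℕ) + 1 ≤ u := c
        rw [if_pos a, if_pos b, if_pos c', if_pos (show Precedes sc v u from Or.inr ⟨b, c⟩)]
        exact Sat.pure (by simp [State.writeNat])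
      · have c' : ¬ (v : ℕ) + 1 ≤ u := c
        rw [if_pos a, if_pos b, if_neg c', if_neg]
        · exact Sat.pure rfl
        · rintro (h | h)
          · exact absurd a (not_le.mpr h)
          · exact c h.2
    · rw [if_pos a, if_neg b, if_neg]
      · exact Sat.pure rfl
      · rintro (h | h)
        · exact b h.le
        · exact b h.1
  · rw [if_neg a, if_pos (show Precedes sc v u from Or.inl (not_le.mp a))]
    exact Sat.pure (by simp [State.writeNat])

theorem sat_rankCmd {sc : Fin n → ℝ} {u : Fin n} {s : State} (hn : s.nat 0 0 = n)
    (hu : s.nat 6 0 = u) (hsc : ∀ u : Fin n, s.real 9 u = sc u) :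
    Sat (fun s' => s'.nat 10 0 = rank sc u) (rankCmd.exec f s) := by
  classical
  simp only [rankCmd]
  rw [Cmd.exec, Cmd.exec, PMF.pure_bind]
  refine (sat_forLoop (f := f) (R := fun i t => t.nat 6 0 = u ∧ (∀ u : Fin n, t.real 9 u = sc u) ∧
    t.nat 10 0 = ∑ v : Fin n, if v.val < i then (if Precedes sc v u then 1 else 0) else 0)
    (by decide) rfl rfl ?_ ?_ (s := _) ?_ ?_).mono fun t ht => ?_
  · rintro i s s' ⟨h1, h2⟩ h3
    rwa [h1 6 (by decide), h1 10 (by decide), h2]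
  · rintro v t ⟨h1, h2, h3⟩ hv -
    refine ((sat_compareCmd h1 hv h2).and (sat_keeps (ns := [6]) (rs := [9]) rfl t)).mono ?_
    rintro r ⟨h4, h5, h6⟩
    refine ⟨by rw [h5 6 (by simp), h1], fun w => by rw [h6 9 (by simp), h2], ?_⟩
    rw [h4, h3, sum_lt_succ]
  · simpa [State.tick, State.writeNat] using hn
  · exact ⟨by simpa [State.tick, State.writeNat] using hu,
      fun u => by simpa [State.tick, State.writeNat] using hsc u,
      by simp [State.tick, State.writeNat, NExp.eval]⟩
  · rw [ht.2.2, sum_lt_all, rank, Finset.card_filter]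

/-! ### Moving the two points -/

/-- Replace the coordinate of one of the two points. -/
def moveCmd : Cmd :=
  rankCmd ;; .ite (.natLE (.add (nv 10) (.lit 1)) (.get 0 (.lit 1)))
    (.setReal 2 (nv 6) (.add (.get 2 (nv 6)) (.mul (.sub (.ofNat (.lit 1)) (.get 2 (nv 6)))
      (.div (.ofNat (.lit 1)) (.ofNat (.get 2 (.lit 8)))))) ;;
      letR 10 (.add (rv 10) (.sub (.get 5 (nv 6)) (rv 7))))
    (.setReal 3 (nv 6) (.sub (.get 3 (nv 6)) (.mul (.get 3 (nv 6))
      (.div (.ofNat (.lit 1)) (.ofNat (.get 2 (.lit 8)))))) ;;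
      letR 10 (.sub (rv 10) (.sub (.get 6 (nv 6)) (rv 8))))

open Classical in
/-- The state after the coordinates below `i` have been treated. -/
structure Moving (T : ℕ) (M : Finset (Fin n)) (sc : Fin n → ℝ) (st : Pair n) (q : Sums n) (i : ℕ)
    (s : State) : Prop where
  sums : HoldsSums q s
  lam : s.real 4 0 = st.lam
  sc : ∀ u : Fin n, s.real 9 u = sc u
  y : ∀ u : Fin n, s.real 2 u = if u.val < i then raisePt M (1 / (T : ℝ)) st.y u else st.y u
  x : ∀ u : Fin n, s.real 3 u = if u.val < i then lowerPt M (1 / (T : ℝ)) st.x u else st.x u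
  gap : s.real 10 0 = q.a0 - q.b0 +
    ∑ u : Fin n, if u.val < i then (if u ∈ M then q.a u - q.a0 else -(q.b u - q.b0)) else 0

theorem Moving.congr {T : ℕ} {M : Finset (Fin n)} {sc : Fin n → ℝ} {st : Pair n} {q : Sums n}
    {i : ℕ} {s s' : State} (h : Moving T M sc st q i s)
    (hr : ∀ a ∈ [2, 3, 4, 5, 6, 7, 8, 9, 10], s'.real a = s.real a) :
    Moving T M sc st q i s' :=
  ⟨h.sums.congr (hr 5 (by simp)) (hr 6 (by simp)) (hr 7 (by simp)) (hr 8 (by simp)),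
    by rw [hr 4 (by simp), h.lam], fun u => by rw [hr 9 (by simp), h.sc],
    fun u => by rw [hr 2 (by simp), h.y], fun u => by rw [hr 3 (by simp), h.x],
    by rw [hr 10 (by simp), h.gap]⟩

/-- Membership in the top `k` is decided by recomputing the rank. The scores are stored separately,
so earlier moves of the two points do not affect it. -/
theorem sat_moveCmd {k : ℕ} {R : ℝ} {sc : Fin n → ℝ} {st : Pair n} {q : Sums n} {u : Fin n}
    {s : State} (hc : Ctx n k R s) (hu : s.nat 6 0 = u)
    (h : Moving ((n + 1) ^ 8) (topk k sc) sc st q u s) :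
    Sat (Moving ((n + 1) ^ 8) (topk k sc) sc st q (u + 1)) (moveCmd.exec f s) := by
  simp only [moveCmd]
  rw [Cmd.exec]
  refine Sat.bind (((sat_rankCmd hc.n_eq hu h.sc).and (sat_ctx rfl hc)).and
    (sat_keeps (ns := [6]) (rs := [2, 3, 4, 5, 6, 7, 8, 9, 10]) rfl s)) ?_
  rintro t ⟨⟨hrank, hct⟩, h6, hr⟩
  have ht := h.congr hr
  have hut : t.nat 6 0 = u := by rw [h6 6 (by simp), hu]
  have hT := hct.pow_eq 8 (by norm_num)
  have hyu : t.real 2 u = st.y u := by rw [ht.y, if_neg (lt_irrefl _)]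
  have hxu : t.real 3 u = st.x u := by rw [ht.x, if_neg (lt_irrefl _)]
  have hlt : ∀ w : Fin n, w ≠ u → ((w : ℕ) < u + 1 ↔ (w : ℕ) < u) := fun w hw => by
    have : (w : ℕ) ≠ u := fun h => hw (Fin.ext h)
    omega
  have hne : ∀ w : Fin n, w ≠ u → (w : ℕ) ≠ u := fun w hw h => hw (Fin.ext h)
  simp only [Cmd.exec, Test.Holds, NExp.eval, State.tick, hrank, hct.k_eq, PMF.pure_bind]
  by_cases hM : rank sc u < k
  · have hmem : u ∈ topk k sc := by simp [topk, hM]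
    rw [if_pos (Nat.succ_le_of_lt hM)]
    refine Sat.pure ⟨ht.sums.congr ?_ ?_ ?_ ?_, ?_, fun w => ?_, fun w => ?_, fun w => ?_, ?_⟩
    · simp [State.writeReal]
    · simp [State.writeReal]
    · simp [State.writeReal]
    · simp [State.writeReal]
    · simpa [State.writeReal] using ht.lam
    · simpa [State.writeReal] using ht.sc w
    · by_cases hw : w = u
      · subst hw
        simp [State.writeReal, RExp.eval, NExp.eval, hut, hyu, hT, raisePt, hmem]
      · simp [State.writeReal, RExp.eval, NExp.eval, hut, hlt w hw, Function.update_of_ne (hne w hw),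
          ht.y]
    · by_cases hw : w = u
      · subst hw
        simp [State.writeReal, hxu, lowerPt, hmem]
      · simp [State.writeReal, hlt w hw, ht.x]
    · rw [sum_lt_succ, if_pos hmem, ← add_assoc (q.a0 - q.b0), ← ht.gap]
      simp [State.writeReal, RExp.eval, NExp.eval, hut, ht.sums.a, ht.sums.a0]
  · have hmem : u ∉ topk k sc := by simp [topk, hM]
    rw [if_neg (fun h : rank sc u + 1 ≤ k => hM h)]
    refine Sat.pure ⟨ht.sums.congr ?_ ?_ ?_ ?_, ?_, fun w => ?_, fun w => ?_, fun w => ?_, ?_⟩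
    · simp [State.writeReal]
    · simp [State.writeReal]
    · simp [State.writeReal]
    · simp [State.writeReal]
    · simpa [State.writeReal] using ht.lam
    · simpa [State.writeReal] using ht.sc w
    · by_cases hw : w = u
      · subst hw
        simp [State.writeReal, hyu, raisePt, hmem]
      · simp [State.writeReal, hlt w hw, ht.y]
    · by_cases hw : w = u
      · subst hw
        simp [State.writeReal, RExp.eval, NExp.eval, hut, hxu, hT, lowerPt, hmem]
      · simp [State.writeReal, RExp.eval, NExp.eval, hut, hlt w hw, Function.update_of_ne (hne w hw),
          ht.x]
    · rw [sum_lt_succ, if_neg hmem, ← add_assoc (q.a0 - q.b0), ← ht.gap]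
      simp [State.writeReal, RExp.eval, NExp.eval, hut, ht.sums.b, ht.sums.b0, sub_eq_add_neg]

/-- Move the weight and clip it to the unit interval. -/
def lamCmd : Cmd :=
  letR 4 (.sub (rv 4) (.div (.mul (.div (.ofNat (.lit 1)) (.ofNat (.get 2 (.lit 5))))
    (.div (rv 10) (.ofNat (.get 2 (.lit 20))))) (rv 0))) ;;
    .ite (.realLE (rv 4) (.ofNat (.lit 0))) (letR 4 (.ofNat (.lit 0)))
      (.ite (.realLE (.ofNat (.lit 1)) (rv 4)) (letR 4 (.ofNat (.lit 1))) .skip)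

theorem sat_lamCmd {k : ℕ} {R lam g : ℝ} {s : State} (hc : Ctx n k R s) (hl : s.real 4 0 = lam)
    (hg : s.real 10 0 = g) :
    Sat (fun s' => s'.real 4 0 = clip (lam - 1 / (((n + 1) ^ 5 : ℕ) : ℝ) *
      (g / (((n + 1) ^ 20 : ℕ) : ℝ)) / R)) (lamCmd.exec f s) := by
  simp only [lamCmd]
  rw [Cmd.exec, Cmd.exec, PMF.pure_bind]
  set v := RExp.eval s (.sub (rv 4) (.div (.mul (.div (.ofNat (.lit 1)) (.ofNat (.get 2 (.lit 5))))
    (.div (rv 10) (.ofNat (.get 2 (.lit 20))))) (rv 0))) with hv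
  have hv' : v = lam - 1 / (((n + 1) ^ 5 : ℕ) : ℝ) * (g / (((n + 1) ^ 20 : ℕ) : ℝ)) / R := by
    rw [hv]
    simp only [RExp.eval, NExp.eval, hl, hg, hc.bound_eq, hc.pow_eq 5 (by norm_num),
      hc.pow_eq 20 (by norm_num), Nat.cast_one]
  clear_value v
  rw [← hv']
  simp only [Cmd.exec, Test.Holds, RExp.eval, NExp.eval, State.tick, State.writeReal,
    Function.update_self, clip, Nat.cast_zero, Nat.cast_one]
  split_ifs
  · exact Sat.pure (by simp)
  · exact Sat.pure (by simp)
  · exact Sat.pure (by simp)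

/-- Perform a step on the basis of the sums. -/
def advanceCmd : Cmd :=
  scoreCmd ;; letR 10 (.sub (rv 7) (rv 8)) ;; forLoop 6 moveCmd ;; lamCmd

theorem sat_advanceCmd {k : ℕ} {R : ℝ} {st : Pair n} {q : Sums n} {s : State} (hc : Ctx n k R s)
    (hp : HoldsPair st s) (hq : HoldsSums q s) :
    Sat (HoldsPair (advance k ((n + 1) ^ 8) ((n + 1) ^ 20) ((n + 1) ^ 5) R st q))
      (advanceCmd.exec f s) := by
  simp only [advanceCmd]
  rw [Cmd.exec]
  refine Sat.bind ((((sat_scoreCmd hc.n_eq hp hq).and (sat_ctx rfl hc)).and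
    (sat_holdsPair rfl hp)).and (sat_holdsSums rfl hq)) ?_
  rintro s ⟨⟨⟨hs, hc⟩, hp⟩, hq⟩
  rw [Cmd.exec, Cmd.exec, PMF.pure_bind, Cmd.exec]
  set s₁ := State.tick (s.writeReal 10 _ _) _ with hs₁
  have hc₁ : Ctx n k R s₁ := hc.congr rfl rfl (by simp [hs₁, State.tick, State.writeReal])
  have h₁ : Moving ((n + 1) ^ 8) (topk k (scores st.lam q)) (scores st.lam q) st q 0 s₁ := by
    refine ⟨hq.congr ?_ ?_ ?_ ?_, ?_, fun u => ?_, fun u => ?_, fun u => ?_, ?_⟩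
    · simp [hs₁, State.tick, State.writeReal]
    · simp [hs₁, State.tick, State.writeReal]
    · simp [hs₁, State.tick, State.writeReal]
    · simp [hs₁, State.tick, State.writeReal]
    · simpa [hs₁, State.tick, State.writeReal] using hp.lam
    · simpa [hs₁, State.tick, State.writeReal] using hs u
    · simpa [hs₁, State.tick, State.writeReal] using hp.y u
    · simpa [hs₁, State.tick, State.writeReal] using hp.x u
    · simp [hs₁, State.tick, State.writeReal, RExp.eval, NExp.eval, hq.a0, hq.b0]
  clear_value s₁
  refine Sat.bind (((sat_forLoop (f := f) (R := fun i t => Ctx n k R t ∧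
    Moving ((n + 1) ^ 8) (topk k (scores st.lam q)) (scores st.lam q) st q i t) (by decide) rfl rfl
    ?_ ?_ hc₁.n_eq ⟨hc₁, h₁⟩))) ?_
  · rintro i t t' ⟨h3, h4⟩ ⟨h5, h6⟩
    exact ⟨h5.congr (h3 0 (by decide)) (h3 2 (by decide)) (by rw [h4]),
      h6.congr fun a _ => by rw [h4]⟩
  · rintro u t ⟨h5, h6⟩ hu -
    exact (sat_ctx rfl h5).and (sat_moveCmd h5 hu h6)
  · rintro t ⟨hct, ht⟩
    refine ((sat_lamCmd hct ht.lam ht.gap).and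
      (sat_keeps (ns := []) (rs := [2, 3]) rfl t)).mono ?_
    rintro r ⟨hl, -, hr⟩
    refine ⟨fun u => ?_, fun u => ?_, ?_⟩
    · rw [hr 2 (by simp), ht.y, if_pos u.isLt]; rfl
    · rw [hr 3 (by simp), ht.x, if_pos u.isLt]; rfl
    · rw [hl, sum_lt_all]; rfl

/-- One step of the process. -/
def stepCmd : Cmd := resetCmd ;; .loop (.get 2 (.lit 20)) accCmd ;; advanceCmd

theorem lift_stepCmd {k : ℕ} {R : ℝ} {st : Pair n} {s : State} (hc : Ctx n k R s)
    (hp : HoldsPair st s) :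
    Lift (fun s' st' => Ctx n k R s' ∧ HoldsPair st' s') (stepCmd.exec f s)
      (mainStep f k ((n + 1) ^ 6) ((n + 1) ^ 8) ((n + 1) ^ 20) ((n + 1) ^ 5) R st) := by
  simp only [stepCmd]
  rw [Cmd.exec]
  refine Sat.bind_lift (((sat_resetCmd hc.n_eq).and (sat_ctx rfl hc)).and (sat_holdsPair rfl hp)) ?_
  rintro s ⟨⟨hq, hc⟩, hp⟩
  rw [Cmd.exec, mainStep, PMF.map, Cmd.exec, NExp.eval, NExp.eval, hc.pow_eq 20 le_rfl]
  refine Lift.bind (lift_rounds (R := fun s' q' => Ctx n k R s' ∧ HoldsPair st s' ∧ HoldsSums q' s')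
    ?_ ?_ _ ?_) ?_
  · rintro s q t ⟨h1, h2, h3⟩
    exact ⟨h1.congr rfl rfl rfl, h2.congr rfl rfl rfl, h3.congr rfl rfl rfl rfl⟩
  · rintro s q ⟨h1, h2, h3⟩
    exact lift_accCmd h1 h2 h3
  · exact ⟨hc.congr rfl rfl rfl, hp.congr rfl rfl rfl, hq.congr rfl rfl rfl rfl⟩
  · rintro s q ⟨h1, h2, h3⟩
    exact ((sat_ctx rfl h1).and (sat_advanceCmd h1 h2 h3)).lift

end Main

end OracleRAM

end

noncomputable section

namespace OracleRAM

section Rounding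

variable {n : ℕ} {f : Finset (Fin n) → ℝ}

/-! ### The fractional solution -/

/-- Set the upper point to the all-ones vector. -/
def startCmd : Cmd := forLoop 6 (.setReal 3 (nv 6) (.ofNat (.lit 1)))

/-- The lower point and the weight start at 0 as the memory does, so only the upper point is
written. -/
theorem sat_startCmd {s : State} (hn : s.nat 0 0 = n) (h2 : ∀ i, s.real 2 i = 0)
    (h4 : s.real 4 0 = 0) : Sat (HoldsPair (Pair.start n)) (startCmd.exec f s) := by
  refine ((sat_fill (f := f) (g := fun _ => 1) hn fun u t _ _ _ => by
    simp [RExp.eval, NExp.eval]).and (sat_keeps (ns := []) (rs := [2, 4]) rfl s)).mono ?_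
  rintro t ⟨h, -, hr⟩
  exact ⟨fun u => by rw [hr 2 (by simp), h2]; rfl, h, by rw [hr 4 (by simp), h4]; rfl⟩

/-- The main loop. -/
def mainCmd : Cmd := .loop (.get 2 (.lit 8)) stepCmd

theorem lift_mainCmd {k : ℕ} {R : ℝ} {st : Pair n} {s : State} (hc : Ctx n k R s)
    (hp : HoldsPair st s) :
    Lift (fun s' st' => Ctx n k R s' ∧ HoldsPair st' s') (mainCmd.exec f s)
      (piter (mainStep f k ((n + 1) ^ 6) ((n + 1) ^ 8) ((n + 1) ^ 20) ((n + 1) ^ 5) R)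
        ((n + 1) ^ 8) st) := by
  rw [mainCmd, Cmd.exec, NExp.eval, NExp.eval, hc.pow_eq 8 (by norm_num)]
  refine lift_rounds (R := fun s' st' => Ctx n k R s' ∧ HoldsPair st' s') ?_ ?_ _ ?_
  · rintro s st t ⟨h1, h2⟩
    exact ⟨h1.congr rfl rfl rfl, h2.congr rfl rfl rfl⟩
  · rintro s st ⟨h1, h2⟩
    exact lift_stepCmd h1 h2
  · exact ⟨hc.congr rfl rfl rfl, hp.congr rfl rfl rfl⟩

/-- Compute the sums of the coordinates of the two points. -/
def totalCmd : Cmd :=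
  letR 11 (.ofNat (.lit 0)) ;; letR 12 (.ofNat (.lit 0)) ;;
    forLoop 6 (letR 11 (.add (rv 11) (.get 2 (nv 6))) ;; letR 12 (.add (rv 12) (.get 3 (nv 6))))

theorem sat_totalCmd {st : Pair n} {s : State} (hn : s.nat 0 0 = n) (hp : HoldsPair st s) :
    Sat (fun s' => s'.real 11 0 = ∑ u, st.y u ∧ s'.real 12 0 = ∑ u, st.x u)
      (totalCmd.exec f s) := by
  simp only [totalCmd]
  rw [Cmd.exec, Cmd.exec, PMF.pure_bind, Cmd.exec, Cmd.exec, PMF.pure_bind]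
  refine (sat_forLoop (f := f) (R := fun i t => HoldsPair st t ∧
    t.real 11 0 = (∑ u : Fin n, if u.val < i then st.y u else 0) ∧
    t.real 12 0 = ∑ u : Fin n, if u.val < i then st.x u else 0) (by decide) rfl rfl
    ?_ ?_ (s := _) ?_ ?_).mono fun t ht => ?_
  · rintro i s s' ⟨-, h2⟩ ⟨h3, h4, h5⟩
    exact ⟨h3.congr (by rw [h2]) (by rw [h2]) (by rw [h2]), by rw [h2, h4], by rw [h2, h5]⟩
  · rintro u t ⟨h3, h4, h5⟩ hu -
    simp only [Cmd.exec, PMF.pure_bind]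
    refine Sat.pure ⟨h3.congr ?_ ?_ ?_, ?_, ?_⟩
    · simp [State.tick, State.writeReal]
    · simp [State.tick, State.writeReal]
    · simp [State.tick, State.writeReal]
    · rw [sum_lt_succ]
      simp [State.tick, State.writeReal, RExp.eval, NExp.eval, hu, h3.y, h4]
    · rw [sum_lt_succ]
      simp [State.tick, State.writeReal, RExp.eval, NExp.eval, hu, h3.x, h5]
  · simpa [State.tick, State.writeReal] using hn
  · refine ⟨hp.congr ?_ ?_ ?_, ?_, ?_⟩
    · simp [State.tick, State.writeReal]
    · simp [State.tick, State.writeReal]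
    · simp [State.tick, State.writeReal]
    · simp [State.tick, State.writeReal, RExp.eval, NExp.eval]
    · simp [State.tick, State.writeReal, RExp.eval, NExp.eval]
  · rw [ht.2.1, ht.2.2, sum_lt_all, sum_lt_all]
    exact ⟨rfl, rfl⟩

/-- The memory holds the state `q` of pipage rounding. -/
structure HoldsCarried (q : Carried n) (s : State) : Prop where
  p : ∀ u : Fin n, s.real 13 u = q.p u
  c : s.nat 11 0 = q.c

/-- Compute the fractional solution. -/
def mixCmd : Cmd :=
  totalCmd ;; letR 17 (.div (.sub (.ofNat (.get 0 (.lit 1))) (rv 11)) (.sub (rv 12) (rv 11))) ;;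
    letN 11 (.lit 0) ;;
    forLoop 6 (.setReal 13 (nv 6) (.add (.get 2 (nv 6))
      (.mul (rv 17) (.sub (.get 3 (nv 6)) (.get 2 (nv 6))))))

theorem sat_mixCmd {k : ℕ} {R : ℝ} {st : Pair n} {c : Fin n} {s : State} (hc : Ctx n k R s)
    (hp : HoldsPair st s) (h0 : c.val = 0) :
    Sat (HoldsCarried ⟨mixPt k st, c⟩) (mixCmd.exec f s) := by
  simp only [mixCmd]
  rw [Cmd.exec]
  refine Sat.bind (((sat_totalCmd hc.n_eq hp).and (sat_ctx rfl hc)).and (sat_holdsPair rfl hp)) ?_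
  rintro s ⟨⟨⟨hy, hx⟩, hc⟩, hp⟩
  rw [Cmd.exec, Cmd.exec, PMF.pure_bind, Cmd.exec, Cmd.exec, PMF.pure_bind]
  set s₁ := State.tick (State.writeNat _ 11 _ _) _ with hs₁
  have hp₁ : HoldsPair st s₁ := hp.congr (by simp [hs₁, State.tick, State.writeReal, State.writeNat])
    (by simp [hs₁, State.tick, State.writeReal, State.writeNat])
    (by simp [hs₁, State.tick, State.writeReal, State.writeNat])
  have hθ : s₁.real 17 0 = ((k : ℝ) - ∑ v, st.y v) / (∑ v, st.x v - ∑ v, st.y v) := by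
    simp [hs₁, State.tick, State.writeReal, State.writeNat, RExp.eval, NExp.eval, hc.k_eq, hy, hx]
  have hn : s₁.nat 0 0 = n := by
    simpa [hs₁, State.tick, State.writeReal, State.writeNat] using hc.n_eq
  have hcar : s₁.nat 11 0 = 0 := by
    simp [hs₁, State.tick, State.writeReal, State.writeNat, NExp.eval]
  clear_value s₁
  refine ((sat_fill (f := f) (g := mixPt k st) hn fun u t hu _ hr => ?_).and
    (sat_keeps (ns := [11]) (rs := []) rfl s₁)).mono ?_
  · simp [RExp.eval, NExp.eval, hu, hr, hp₁.y, hp₁.x, hθ, mixPt]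
  · rintro t ⟨h, hk, -⟩
    exact ⟨h, by rw [hk 11 (by simp), hcar, h0]⟩

/-! ### Pipage rounding -/

/-- Compute the extreme values that can be given to the two coordinates. -/
def rangeCmd : Cmd :=
  letR 14 (.add (.get 13 (nv 11)) (.get 13 (nv 6))) ;;
    .ite (.realLE (rv 14) (.ofNat (.lit 1)))
      (letR 15 (.ofNat (.lit 0)) ;; letR 16 (rv 14))
      (letR 15 (.sub (rv 14) (.ofNat (.lit 1))) ;; letR 16 (.ofNat (.lit 1)))

theorem sat_rangeCmd {q : Carried n} {u : Fin n} {s : State} (hq : HoldsCarried q s)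
    (hu : s.nat 6 0 = u) :
    Sat (fun s' => s'.real 15 0 = loVal (q.p q.c + q.p u) ∧
      s'.real 16 0 = hiVal (q.p q.c + q.p u)) (rangeCmd.exec f s) := by
  have e : RExp.eval s (.add (.get 13 (nv 11)) (.get 13 (nv 6))) = q.p q.c + q.p u := by
    simp [RExp.eval, NExp.eval, hu, hq.c, hq.p]
  simp only [rangeCmd]
  rw [Cmd.exec, Cmd.exec, PMF.pure_bind, e]
  generalize q.p q.c + q.p u = t
  simp only [Cmd.exec, Test.Holds, RExp.eval, NExp.eval, State.tick, State.writeReal,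
    Function.update_self, loVal, hiVal, Nat.cast_one, Nat.cast_zero, PMF.pure_bind]
  split_ifs
  · exact Sat.pure (by simp)
  · exact Sat.pure (by simp)

/-- Choose one of the two extreme values at random. -/
def chooseCmd : Cmd :=
  .rand 8 (.lit 0) (.get 2 (.lit 6)) ;;
    .ite (.realLE (.mul (.div (.sub (.get 13 (nv 11)) (rv 15)) (.sub (rv 16) (rv 15)))
        (.add (.ofNat (.get 2 (.lit 6))) (.ofNat (.lit 1)))) (.ofNat (nv 8)))
      (letR 18 (rv 15) ;; letR 19 (rv 16)) (letR 18 (rv 16) ;; letR 19 (rv 15))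

theorem lift_chooseCmd {m : ℕ} {p lo hi : ℝ} {s : State} (hm : s.nat 2 6 = m)
    (hp : s.real 13 (s.nat 11 0) = p) (hlo : s.real 15 0 = lo) (hhi : s.real 16 0 = hi) :
    Lift (fun s' b => s'.real 18 0 = (if b then hi else lo) ∧
      s'.real 19 0 = if b then lo else hi) (chooseCmd.exec f s)
      (bern m ((p - lo) / (hi - lo))) := by
  simp only [chooseCmd]
  rw [Cmd.exec]
  refine (lift_rand (s := s) (e := .get 2 (.lit 6)) (m := m) hm ((p - lo) / (hi - lo))).bind_sat ?_
  rintro _ b ⟨v, T, rfl, rfl⟩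
  have hθ : Test.Holds (State.tick (s.writeNat 8 (NExp.eval s (.lit 0)) v) T)
      (.realLE (.mul (.div (.sub (.get 13 (nv 11)) (rv 15)) (.sub (rv 16) (rv 15)))
        (.add (.ofNat (.get 2 (.lit 6))) (.ofNat (.lit 1)))) (.ofNat (nv 8)))
      ↔ (p - lo) / (hi - lo) * ((m : ℝ) + 1) ≤ v := by
    simp [Test.Holds, RExp.eval, NExp.eval, State.tick, State.writeNat, hm, hp, hlo, hhi]
  simp only [Cmd.exec, PMF.pure_bind]
  by_cases h : (p - lo) / (hi - lo) * ((m : ℝ) + 1) ≤ v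
  · rw [if_pos (hθ.mpr h)]
    exact Sat.pure (by
      simp [State.tick, State.writeReal, State.writeNat, RExp.eval, NExp.eval, h, hlo, hhi])
  · rw [if_neg fun h' => h (hθ.mp h')]
    exact Sat.pure (by
      simp [State.tick, State.writeReal, State.writeNat, RExp.eval, NExp.eval, h, hlo, hhi])

/-- Store the two new coordinates. -/
def storeCmd : Cmd :=
  .setReal 13 (nv 11) (rv 18) ;; .setReal 13 (nv 6) (rv 19) ;;
    .ite (.realLE (rv 18) (.ofNat (.lit 0))) (letN 11 (nv 6))
      (.ite (.realLE (.ofNat (.lit 1)) (rv 18)) (letN 11 (nv 6)) .skip)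

theorem sat_storeCmd {q : Carried n} {u : Fin n} {a b : ℝ} {s : State} (hq : HoldsCarried q s)
    (hu : s.nat 6 0 = u) (ha : s.real 18 0 = a) (hb : s.real 19 0 = b) :
    Sat (HoldsCarried (q.set u a b)) (storeCmd.exec f s) := by
  simp only [storeCmd]
  rw [Cmd.exec, Cmd.exec, PMF.pure_bind, Cmd.exec, Cmd.exec, PMF.pure_bind]
  set s₁ := State.tick (State.writeReal _ 13 _ _) _ with hs₁
  have h13 : s₁.real 13 = Function.update (Function.update (s.real 13) q.c a) u b := by
    simp [hs₁, State.tick, State.writeReal, RExp.eval, NExp.eval, hu, hq.c, ha, hb]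
  have hp : ∀ v : Fin n, s₁.real 13 v = (q.set u a b).p v := by
    intro v
    simp only [h13, Carried.set, Function.update_apply, ← Fin.ext_iff, hq.p]
  have hu₁ : s₁.nat 6 0 = u := hu
  have hc₁ : s₁.nat 11 0 = q.c := hq.c
  have ha₁ : s₁.real 18 0 = a := by simpa [hs₁, State.tick, State.writeReal] using ha
  clear_value s₁
  simp only [Cmd.exec, Test.Holds, RExp.eval, NExp.eval, State.tick, ha₁, hu₁, Nat.cast_zero,
    Nat.cast_one]
  by_cases h1 : a ≤ 0
  · rw [if_pos h1]
    exact Sat.pure ⟨hp, by simp [State.writeNat, Carried.set, h1]⟩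
  · rw [if_neg h1]
    by_cases h2 : 1 ≤ a
    · rw [if_pos h2]
      exact Sat.pure ⟨hp, by simp [State.writeNat, Carried.set, h2]⟩
    · rw [if_neg h2]
      exact Sat.pure ⟨hp, by simp [Carried.set, h1, h2, hc₁]⟩

/-- One step of pipage rounding. -/
def pipStepCmd : Cmd :=
  .ite (.natLE (.lit 1) (nv 6)) (rangeCmd ;; chooseCmd ;; storeCmd) .skip

theorem HoldsCarried.congr {q : Carried n} {s s' : State} (h : HoldsCarried q s)
    (h11 : s'.nat 11 = s.nat 11) (h13 : s'.real 13 = s.real 13) : HoldsCarried q s' :=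
  ⟨fun u => by rw [h13, h.p], by rw [h11, h.c]⟩

theorem lift_pipStepCmd {k : ℕ} {R : ℝ} {q : Carried n} {u : Fin n} {s : State} (hc : Ctx n k R s)
    (hq : HoldsCarried q s) (hu : s.nat 6 0 = u) :
    Lift (fun s' q' => HoldsCarried q' s') (pipStepCmd.exec f s) (pipStep ((n + 1) ^ 6) u q) := by
  simp only [pipStepCmd, pipStep]
  rw [Cmd.exec]
  simp only [Test.Holds, NExp.eval, hu]
  split_ifs
  · have hq₁ : HoldsCarried q (s.tick ((Test.natLE (.lit 1) (nv 6)).cost + 1)) := hq.congr rfl rfl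
    have hc₁ : Ctx n k R (s.tick ((Test.natLE (.lit 1) (nv 6)).cost + 1)) := hc.congr rfl rfl rfl
    have hu₁ : (s.tick ((Test.natLE (.lit 1) (nv 6)).cost + 1)).nat 6 0 = u := hu
    generalize s.tick ((Test.natLE (.lit 1) (nv 6)).cost + 1) = s₁ at hq₁ hc₁ hu₁
    rw [Cmd.exec]
    refine Sat.bind_lift (((sat_rangeCmd hq₁ hu₁).and (sat_ctx rfl hc₁)).and
      (sat_keeps (ns := [6, 11]) (rs := [13]) rfl s₁)) ?_
    rintro s₂ ⟨⟨⟨hlo, hhi⟩, hc₂⟩, hn₂, hr₂⟩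
    have hq₂ : HoldsCarried q s₂ := hq₁.congr (hn₂ 11 (by simp)) (hr₂ 13 (by simp))
    have hu₂ : s₂.nat 6 0 = u := by rw [hn₂ 6 (by simp), hu₁]
    rw [Cmd.exec]
    refine Lift.bind ((lift_chooseCmd (hc₂.pow_eq 6 (by norm_num)) (by rw [hq₂.c, hq₂.p])
      hlo hhi).and_support (sat_keeps (ns := [6, 11]) (rs := [13]) rfl s₂)) ?_
    rintro s₃ b ⟨⟨h18, h19⟩, hn₃, hr₃⟩
    have hq₃ : HoldsCarried q s₃ := hq₂.congr (hn₃ 11 (by simp)) (hr₃ 13 (by simp))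
    have hu₃ : s₃.nat 6 0 = u := by rw [hn₃ 6 (by simp), hu₂]
    refine ((sat_storeCmd hq₃ hu₃ h18 h19).mono fun t ht => ?_).lift
    cases b <;> exact ht
  · exact Lift.pure (hq.congr rfl rfl)

/-- Pipage rounding. -/
def pipageCmd : Cmd := forLoop 6 pipStepCmd

theorem lift_pipageCmd {k : ℕ} {R : ℝ} {q : Carried n} {s : State} (hc : Ctx n k R s)
    (hq : HoldsCarried q s) :
    Lift (fun s' q' => Ctx n k R s' ∧ HoldsCarried q' s') (pipageCmd.exec f s)
      (pipage ((n + 1) ^ 6) q) :=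
  lift_forLoop (R := fun _ s' q' => Ctx n k R s' ∧ HoldsCarried q' s') (by decide) rfl rfl
    (fun _ _ _ _ h1 h2 => ⟨h2.1.congr (h1.1 0 (by decide)) (h1.1 2 (by decide)) (by rw [h1.2]),
      h2.2.congr (h1.1 11 (by decide)) (by rw [h1.2])⟩)
    (fun _ _ _ hs hu _ => ((lift_pipStepCmd hs.1 hs.2 hu).and_support (sat_ctx rfl hs.1)).mono
      fun _ _ h => ⟨h.2, h.1⟩) hc.n_eq ⟨hc, hq⟩

/-- Write the output. -/
def outCmd : Cmd :=
  forLoop 6 (.ite (.realLE (.ofNat (.lit 1)) (.get 13 (nv 6))) (.setNat 1 (nv 6) (.lit 1))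
    (.setNat 1 (nv 6) (.lit 0)))

theorem sat_outCmd {q : Carried n} {s : State} (hn : s.nat 0 0 = n) (hq : HoldsCarried q s) :
    Sat (fun s' => s'.output n = q.out) (outCmd.exec f s) := by
  refine (sat_forLoop (f := f) (R := fun i t => (∀ u : Fin n, t.real 13 u = q.p u) ∧
    ∀ u : Fin n, u.val < i → (t.nat 1 u ≠ 0 ↔ 1 ≤ q.p u)) (by decide) rfl rfl ?_ ?_ hn
    ⟨hq.p, fun u hu => absurd hu (Nat.not_lt_zero _)⟩).mono fun t ht => ?_
  · rintro i s s' ⟨h1, h2⟩ h3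
    rwa [h1 1 (by decide), h2]
  · rintro u t ⟨h1, h2⟩ hu -
    simp only [Cmd.exec, Test.Holds, RExp.eval, NExp.eval, State.tick, hu, h1, Nat.cast_one]
    have hfin : ∀ val : ℕ, (val ≠ 0 ↔ 1 ≤ q.p u) → ∀ v : Fin n, v.val < u.val + 1 →
        (Function.update (t.nat 1) u val v ≠ 0 ↔ 1 ≤ q.p v) := by
      intro val hval v hv
      by_cases hvu : v = u
      · subst hvu
        rwa [Function.update_self]
      · have : (v : ℕ) ≠ u := fun h => hvu (Fin.ext h)
        rw [Function.update_of_ne this]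
        exact h2 v (by omega)
    by_cases h : 1 ≤ q.p u
    · rw [if_pos h]
      exact Sat.pure ⟨h1, by simpa [State.writeNat] using hfin 1 (by simp [h])⟩
    · rw [if_neg h]
      exact Sat.pure ⟨h1, by simpa [State.writeNat] using hfin 0 (by simp [h])⟩
  · ext u
    rw [State.output, mem_storedSet, ht.2 u u.isLt]
    simp [Carried.out]

/-! ### The whole program -/

/-- The program, except for the computation of the powers of `n + 1`. -/
def bodyCmd : Cmd :=
  boundCmd ;; startCmd ;; mainCmd ;; mixCmd ;; pipageCmd ;; outCmd

/-- The program. -/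
def wholeCmd : Cmd := powers 20 ;; bodyCmd

theorem lift_wholeCmd (f : Finset (Fin n) → ℝ) (k : ℕ) {c : Fin n} (hc : c.val = 0) :
    Lift (fun s S => s.output n = S) (wholeCmd.run f k)
      (setAlg f k ((n + 1) ^ 6) ((n + 1) ^ 8) ((n + 1) ^ 20) ((n + 1) ^ 5)
        (f ∅ + ∑ u, f {u}) c) := by
  simp only [Cmd.run, wholeCmd, bodyCmd, setAlg]
  have hreal : ∀ a i, (init n k).real a i = 0 := fun _ _ => rfl
  have hn : (init n k).nat 0 0 = n := rfl
  have hk : (init n k).nat 0 1 = k := rfl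
  have hnat : ∀ a i, a ≠ 0 → (init n k).nat a i = 0 := fun a i ha => if_neg ha
  generalize init n k = s at *
  rw [Cmd.exec]
  refine Sat.bind_lift ((sat_powers 20 hn fun i => hnat 2 i (by decide)).and
    (sat_keeps (ns := [3]) (rs := [2, 4]) rfl s)) ?_
  rintro s₁ ⟨⟨hpow, h0⟩, hn₁, hr₁⟩
  rw [Cmd.exec]
  refine Sat.bind_lift ((sat_boundCmd (f := f) (by rw [h0, hn]) fun i => by
    rw [hn₁ 3 (by simp)]; exact hnat 3 i (by decide)).and
    (sat_keeps (ns := [0, 2]) (rs := [2, 4]) rfl s₁)) ?_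
  rintro s₂ ⟨hbound, hn₂, hr₂⟩
  have hc₂ : Ctx n k (f ∅ + ∑ u, f {u}) s₂ :=
    ⟨by rw [hn₂ 0 (by simp), h0, hn], by rw [hn₂ 0 (by simp), h0, hk],
      fun i hi => by rw [hn₂ 2 (by simp), hpow, if_pos hi], hbound⟩
  rw [Cmd.exec]
  refine Sat.bind_lift ((sat_startCmd (f := f) hc₂.n_eq
    (fun i => by rw [hr₂ 2 (by simp), hr₁ 2 (by simp), hreal])
    (by rw [hr₂ 4 (by simp), hr₁ 4 (by simp), hreal])).and (sat_ctx rfl hc₂)) ?_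
  rintro s₃ ⟨hp₃, hc₃⟩
  rw [Cmd.exec]
  refine (lift_mainCmd hc₃ hp₃).bind ?_
  rintro s₄ st ⟨hc₄, hp₄⟩
  rw [Cmd.exec]
  refine Sat.bind_lift ((sat_mixCmd (f := f) hc₄ hp₄ hc).and (sat_ctx rfl hc₄)) ?_
  rintro s₅ ⟨hq₅, hc₅⟩
  rw [Cmd.exec, PMF.map]
  refine (lift_pipageCmd hc₅ hq₅).bind ?_
  rintro s₆ q ⟨hc₆, hq₆⟩
  exact (sat_outCmd hc₆.n_eq hq₆).lift

open Polynomial in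
/-- Bounds on the parameters and the powers of `n + 1`. -/
def cellBound : ℕ → ℕ → ℕ[X]
  | 2, i => (X + 1) ^ i
  | _, _ => X

open Polynomial in
/-- A bound on the running time of the program. -/
def wholeTime : ℕ[X] :=
  (powers 20).timePoly cellBound + bodyCmd.timePoly cellBound

-- Two phases: while the powers are computed, only array 0 is read-only; afterwards array 2, with
-- its known contents, is read-only as well and supplies loop bounds and ranges of random numbers.
open Polynomial in
theorem sat_time_wholeCmd (f : Finset (Fin n) → ℝ) {k : ℕ} (hk : k ≤ n) :
    Sat (fun s => s.time ≤ wholeTime.eval n) (wholeCmd.run f k) := by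
  simp only [Cmd.run, wholeCmd]
  have hcell : ∀ i, (init n k).nat 0 i ≤ n := by
    intro i
    simp only [init, if_true]
    split_ifs <;> omega
  have hn : (init n k).nat 0 0 = n := rfl
  have h2 : ∀ i, (init n k).nat 2 i = 0 := fun _ => rfl
  have ht : (init n k).time = 0 := rfl
  generalize init n k = s at *
  rw [Cmd.exec]
  refine Sat.bind ((sat_time (f := f) (C := fun a => Nat.beq a 0) (π := cellBound) (N := n)
    (c := powers 20) rfl s ?_).and (sat_powers 20 hn h2)) ?_
  · intro a i ha
    rw [Nat.beq_eq] at ha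
    subst ha
    simpa [cellBound] using hcell i
  · rintro t ⟨h3, h4, h5⟩
    refine (sat_time (f := f) (C := fun a => Nat.beq a 0 || Nat.beq a 2) (π := cellBound) (N := n)
      (c := bodyCmd) rfl t ?_).mono fun r hr => ?_
    · intro a i ha
      rw [Bool.or_eq_true, Nat.beq_eq, Nat.beq_eq] at ha
      rcases ha with rfl | rfl
      · rw [h5]
        simpa [cellBound] using hcell i
      · rw [h4]
        simp only [cellBound, eval_pow, eval_add, eval_X, eval_one]
        split_ifs
        · exact le_rfl
        · exact Nat.zero_le _
    · rw [wholeTime, eval_add]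
      omega

end Rounding

end OracleRAM

end

/-! ### Transfer of the guarantees to the program. -/

section Conclusion

open scoped ENNReal

namespace OracleRAM

variable {n : ℕ}

theorem Cmd.expectedValue_nonneg (c : Cmd) {f : Finset (Fin n) → ℝ} (h0 : ∀ S, 0 ≤ f S) (k : ℕ) :
    0 ≤ c.expectedValue f k :=
  Finset.sum_nonneg fun S _ => mul_nonneg ENNReal.toReal_nonneg (h0 S)

theorem Cmd.ofReal_expectedValue (c : Cmd) {f : Finset (Fin n) → ℝ} (h0 : ∀ S, 0 ≤ f S) (k : ℕ) :
    ENNReal.ofReal (c.expectedValue f k)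
      = pexp (c.run f k) fun s => ENNReal.ofReal (f (s.output n)) := by
  have h := pexp_map (p := c.run f k) (fun s => s.output n) fun S => ENNReal.ofReal (f S)
  rw [← h, Cmd.expectedValue, ENNReal.ofReal_sum_of_nonneg
    fun S _ => mul_nonneg ENNReal.toReal_nonneg (h0 S), pexp, tsum_fintype]
  refine Finset.sum_congr rfl fun S _ => ?_
  rw [ENNReal.ofReal_mul ENNReal.toReal_nonneg, ENNReal.ofReal_toReal (PMF.apply_ne_top _ _)]
  rfl

theorem card_output_wholeCmd {k : ℕ} (h1 : 1 ≤ k) (hk : k ≤ n) (f : Finset (Fin n) → ℝ) :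
    Sat (fun s => (s.output n).card = k) (wholeCmd.run f k) := by
  intro s hs
  obtain ⟨S, hS, rfl⟩ := (lift_wholeCmd f k (c := ⟨0, by omega⟩) rfl).support s hs
  refine card_of_mem_support ?_ hk rfl _ hS
  calc 4 ≤ 2 ^ 8 := by norm_num
    _ ≤ (n + 1) ^ 8 := Nat.pow_le_pow_left (by omega) 8

theorem expectedValue_wholeCmd {k : ℕ} (h1 : 1 ≤ k) (hk : k ≤ n) {f : Finset (Fin n) → ℝ}
    (h0 : ∀ S, 0 ≤ f S) (hf : IsSubmodular f) {S : Finset (Fin n)} (hS : S.card = k) :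
    (Real.exp (-1) - 20 / ((n : ℝ) + 1)) * f S ≤ wholeCmd.expectedValue f k := by
  have hE := wholeCmd.expectedValue_nonneg h0 k
  obtain ⟨O, hO, hmax⟩ := Finset.exists_max_image (Finset.univ.powersetCard k) f
    (Finset.powersetCard_nonempty.mpr (by simpa using hk))
  rw [Finset.mem_powersetCard_univ] at hO
  have hSO : f S ≤ f O := hmax S (Finset.mem_powersetCard_univ.mpr hS)
  -- For small `n` the factor is not positive and the bound is trivial.
  rcases le_or_gt (Real.exp (-1) - 20 / ((n : ℝ) + 1)) 0 with hneg | hpos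
  · exact (mul_nonpos_of_nonpos_of_nonneg hneg (h0 S)).trans hE
  · refine (mul_le_mul_of_nonneg_left hSO hpos.le).trans ?_
    rcases (h0 O).eq_or_lt with hz | hO'
    · rwa [← hz, mul_zero]
    · rw [← ENNReal.ofReal_le_ofReal_iff hE, Cmd.ofReal_expectedValue _ h0]
      -- Bounding all values of f by those on sets of size `k` needs `k < n`. For `k = n` the ground
      -- set is the only feasible set, and the program returns it.
      rcases hk.eq_or_lt with rfl | hlt
      · have hconst : pexp (wholeCmd.run f k) (fun s => ENNReal.ofReal (f (s.output k)))
            = ENNReal.ofReal (f O) := by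
          rw [← pexp_const (p := wholeCmd.run f k) (ENNReal.ofReal (f O))]
          have huniv : ∀ A : Finset (Fin k), A.card = k → A = Finset.univ := fun A hA =>
            Finset.eq_univ_of_card A (by simpa using hA)
          have h : ∀ s ∈ (wholeCmd.run f k).support, f (s.output k) = f O := fun s hs => by
            rw [huniv _ (card_output_wholeCmd h1 le_rfl f s hs), huniv O hO]
          exact le_antisymm (pexp_mono_support fun s hs => by rw [h s hs])
            (pexp_mono_support fun s hs => by rw [h s hs])
        rw [hconst]
        refine ENNReal.ofReal_le_ofReal (mul_le_of_le_one_left hO'.le ?_)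
        have h2 : Real.exp (-1) ≤ 1 := Real.exp_le_one_iff.mpr (by norm_num)
        have h3 : 0 ≤ 20 / ((k : ℝ) + 1) := by positivity
        linarith
      · rw [(lift_wholeCmd f k (c := ⟨0, by omega⟩) rfl).pexp_eq
          (k := fun S => ENNReal.ofReal (f S)) fun s S h => by rw [h]]
        exact setAlg_guarantee hf h0 h1 hlt hO
          (fun A hA => hmax A (Finset.mem_powersetCard_univ.mpr hA)) hO' rfl

end OracleRAM

end Conclusion

theorem theorem3 :
    ∃ (alg : OracleRAM.Cmd) (p : Polynomial ℕ) (ε : ℕ → ℝ),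
      Tendsto ε atTop (𝓝 0) ∧
      ∀ (n k : ℕ), 1 ≤ k → k ≤ n →
      ∀ f : Finset (Fin n) → ℝ, (∀ S, 0 ≤ f S) → IsSubmodular f →
        (∀ s ∈ (alg.run f k).support, s.time ≤ p.eval n ∧ (s.output n).card = k) ∧
        (∀ S : Finset (Fin n), S.card = k →
          (Real.exp (-1) - ε n) * f S ≤ alg.expectedValue f k) := by
  refine ⟨OracleRAM.wholeCmd, OracleRAM.wholeTime, fun n => 20 / ((n : ℝ) + 1), ?_, ?_⟩
  · exact tendsto_const_nhds.div_atTop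
      (tendsto_atTop_add_const_right _ _ tendsto_natCast_atTop_atTop)
  · intro n k h1 hk f h0 hf
    exact ⟨fun s hs => ⟨OracleRAM.sat_time_wholeCmd f hk s hs,
      OracleRAM.card_output_wholeCmd h1 hk f s hs⟩,
      fun S hS => OracleRAM.expectedValue_wholeCmd h1 hk h0 hf hS⟩
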